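/- **Setting.** A junction joins $n$ incoming roads $i=1,\dots,n$ with $\Omega_i=(-\infty,0)$ and $m$ outgoing roads $j=n+1,\dots,n+m$ with $\Omega_j=(0,\infty)$; put $s_i=+1$ and $s_j=-1$. For each road $h$ let $K_h=[a_h,b_h]$ with $a_h<b_h$ and $0\in K_h$, and let $f_h\colon K_h\to[0,\infty)$ be Lipschitz and concave with $f_h(a_h)=f_h(b_h)=0$ and with $f_h'$ not constant on any nontrivial subinterval ($f_h'$ denotes any monotone representative of the derivative). Assume $\sum_h s_hf_h(0)=0$. Let $\hat\eta_h\colon\mathbb R\to\mathbb R$ be convex. For $M\in\mathbb R$ let $\Pi^M_h\colon[0,1]\to\{\rho\in K_h:\hat\eta_h'(\rho-)\le M\le\hat\eta_h'(\rho+)\}$ be nondecreasing and surjective, with the convention $\hat\eta_h'(a_h-)=-\infty$, $\hat\eta_h'(b_h+)=+\infty$. Let $$\Gamma_h^{\rm in}=\operatorname{Int}_{K_h}\{\rho\in K_h: s_hf_h'(\rho)\ge0\},\qquad \Gamma_h^{\rm out}=\overline{\{\rho\in K_h: s_hf_h'(\rho)<0\}}.$$ **Riemann solver.** For $\rho_0\in\prod_hK_h$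 we write $\mathcal{RP}(\rho_0)=\rho_1$ with auxiliary states $\hat\rho$ if there are $M\in\mathbb R$ and $z\in[0,1]$ with $\hat\rho_h=\Pi_h^M(z)$ for all $h$ such that the entropy solutions of $\partial_tu+\partial_xf_h(u)=0$ on $\mathbb R$ with Riemann data $\rho_{0,h}$ on $\Omega_h$ and $\hat\rho_h$ on $\mathbb R\setminus\overline{\Omega_h}$ have the traces $\rho_{1,h}$ at $x=0$ from inside $\Omega_h$, and $\sum_hs_hf_h(\rho_{1,h})=0$. Let $\mathcal K$ be the set of $\bar\rho\in\prod_hK_h$ for which there are states $\hat\rho$, called junction states of $\bar\rho$, such that $\mathcal{RP}(\bar\rho)=\bar\rho$ with auxiliary states $\hat\rho$ and, for every $h$: if $f_h(\bar\rho_h)=f_h(\hat\rho_h)$ and $\hat\rho_h\in\Gamma_h^{\rm out}$, then $\bar\rho_h\in\Gamma_h^{\rm out}$. **BGK model.** Let $\chi(\rho,\xi)=1$ if $0<\xi<\rho$, $\chi(\rho,\xi)=-1$ if $\rho<\xi<0$, and $\chi(\rho,\xi)=0$ otherwise. A solution of the BGK network model for $\varepsilon>0$ consists of measurable $g_h(t,x,\xi)$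 with $\operatorname{sgn}(\xi)g_h=|g_h|\le1$ that satisfy, in the distributional sense, $$\partial_tg_h+f_h'(\xi)\,\partial_xg_h=\frac{\chi(\rho_{g_h},\xi)-g_h}{\varepsilon},\qquad \rho_{g_h}=\int_{K_h}g_h\,d\xi,\qquad t>0,\ x\in\Omega_h,\ \xi\in K_h,$$ and whose traces at $x=0$ satisfy the coupling condition $g_h(t,0,\xi)=\Psi_h[g(t,0,\Gamma^{\rm in})](\xi)$ for a.e. $\xi\in\Gamma_h^{\rm out}$. Here $\Psi_h[\gamma](\xi)=\chi(\hat\rho_h,\xi)$, where $\hat\rho_h=\Pi_h^M(z)$ with $M\in\mathbb R$, $z\in[0,1]$ common to all roads and $$\sum_hs_h\Big(\int_{\Gamma_h^{\rm out}}f_h'\,\chi(\hat\rho_h,\cdot)\,d\xi+\int_{\Gamma_h^{\rm in}}f_h'\,\gamma_h\,d\xi\Big)=0.$$ A solution is stationary if it does not depend on $t$. Uniqueness is meant up to null sets. **Statement.** Let $\bar\rho\in\mathcal K$. 1. For every choice $\hat\rho$ of junction states of $\bar\rho$ and every $\varepsilon>0$ there is a unique stationary solution $\bar g^\varepsilon$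 of the BGK network model such that $\bar g_h^\varepsilon(0,\cdot)=\chi(\hat\rho_h,\cdot)$ a.e. on $\Gamma_h^{\rm out}$ and $\bar g_h^\varepsilon(x,\cdot)\to\chi(\bar\rho_h,\cdot)$ in $L^1(K_h)$ as $|x|\to\infty$, $x\in\Omega_h$, for every road $h$. For fixed $\hat\rho$, $\bar g_h^\varepsilon\to\chi(\bar\rho_h,\cdot)$ in $L^1_{\rm loc}((0,\infty)_t\times\Omega_h\times K_h)$ as $\varepsilon\to0$. 2. If the functions $\chi(\hat\rho_h,\cdot)|_{\Gamma_h^{\rm out}}$ (up to null sets) are the same for all choices of junction states $\hat\rho$ of $\bar\rho$, then for every $\varepsilon>0$ the stationary solution of the BGK network model with $\bar g_h^\varepsilon(x,\cdot)\to\chi(\bar\rho_h,\cdot)$ in $L^1(K_h)$ as $|x|\to\infty$ for every road $h$ exists and is unique without prescribing its values at the junction. -/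

import Mathlib

open MeasureTheory Filter Topology Set
open scoped ContDiff

namespace BGKNetwork

/-! ### Roads and the junction

A junction joins `n` incoming roads, indexed by `Sum.inl i`, each of them the half-line `x < 0`,
and `m` outgoing roads, indexed by `Sum.inr j`, each of them the half-line `x > 0`. -/

/-- The data attached to one road. -/
structure Road where
  /-- left end point of the set of states `K = [a, b]` -/
  a : ℝ
  /-- right end point of the set of states `K = [a, b]` -/
  b : ℝ
  /-- the flux; only its values on `K` are ever used -/
  f : ℝ → ℝ
  /-- the chosen monotone representative of the derivative of the flux on `K` -/
  df : ℝ → ℝ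
  /-- the convex entropy used in the coupling condition -/
  η : ℝ → ℝ
  /-- the priority function, written `Pri M z` for `z ∈ [0, 1]` -/
  Pri : ℝ → ℝ → ℝ

/-- The set of states. -/
def Road.K (r : Road) : Set ℝ := Icc r.a r.b

/-- The set `{ρ ∈ K | η'(ρ-) ≤ M ≤ η'(ρ+)}`, with the convention
`η'(a-) = -∞` and `η'(b+) = +∞` at the end points of `K`. -/
def Road.levelSet (r : Road) (M : ℝ) : Set ℝ :=
  {ρ | ρ ∈ r.K ∧ (ρ = r.a ∨ derivWithin r.η (Iio ρ) ρ ≤ M) ∧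
    (ρ = r.b ∨ M ≤ derivWithin r.η (Ioi ρ) ρ)}

/-- The assumptions on the flux, the entropy and the priority function of a single road. -/
structure Road.Admissible (r : Road) : Prop where
  /-- `K` is a nondegenerate interval -/
  lt : r.a < r.b
  /-- the empty road is a state -/
  zero_mem : (0 : ℝ) ∈ r.K
  nonneg : ∀ ρ ∈ r.K, 0 ≤ r.f ρ
  lipschitz : ∃ L, LipschitzOnWith L r.f r.K
  concave : ConcaveOn ℝ r.K r.f
  f_a : r.f r.a = 0
  f_b : r.f r.b = 0
  /-- `df` is a representative of the derivative of `f` -/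
  hasDeriv : ∀ᵐ ρ ∂(volume.restrict r.K), HasDerivAt r.f (r.df ρ) ρ
  /-- `df` is monotone in the classical sense -/
  antitone : AntitoneOn r.df r.K
  /-- `df` is not constant on any nontrivial subinterval of `K` -/
  nondegenerate : ∀ c d, r.a ≤ c → c < d → d ≤ r.b → ¬ ∃ q, ∀ ρ ∈ Ioo c d, r.df ρ = q
  convex : ConvexOn ℝ univ r.η
  priority_monotone : ∀ M, MonotoneOn (r.Pri M) (Icc 0 1)
  priority_range : ∀ M, r.Pri M '' Icc 0 1 = r.levelSet M

variable {n m : ℕ}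

/-- The sign of a road: `+1` on incoming roads and `-1` on outgoing roads. -/
def sgn : Fin n ⊕ Fin m → ℝ := Sum.elim (fun _ => 1) (fun _ => -1)

/-- The spatial domain of a road. -/
def dom : Fin n ⊕ Fin m → Set ℝ := Sum.elim (fun _ => Iio 0) (fun _ => Ioi 0)

/-- The infinite end of a road. -/
def roadEnd : Fin n ⊕ Fin m → Filter ℝ := Sum.elim (fun _ => atBot) (fun _ => atTop)

/-- The states whose characteristics run into the junction: the interior, relative to `K`, of
`{f' ≥ 0}` on incoming roads and of `{f' ≤ 0}` on outgoing roads. -/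
def ΓIn (R : Fin n ⊕ Fin m → Road) (h : Fin n ⊕ Fin m) : Set ℝ :=
  Subtype.val '' interior {ρ : (R h).K | 0 ≤ sgn h * (R h).df ρ}

/-- The states whose characteristics leave the junction: the closure of `{f' < 0}` on incoming
roads and of `{f' > 0}` on outgoing roads. -/
def ΓOut (R : Fin n ⊕ Fin m → Road) (h : Fin n ⊕ Fin m) : Set ℝ :=
  closure {ρ : ℝ | ρ ∈ (R h).K ∧ sgn h * (R h).df ρ < 0}

/-! ### The macroscopic Riemann solver -/

/-- `u = u(t, x)` is a weak (Kruzkov) entropy solution on `t > 0`, `x ∈ ℝ`, with values in `K`, of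
`∂ₜ u + ∂ₓ f(u) = 0` with initial data `uL` for `x < 0` and `uR` for `x > 0`. -/
def IsRiemannSolution (r : Road) (uL uR : ℝ) (u : ℝ → ℝ → ℝ) : Prop :=
  AEStronglyMeasurable (fun p : ℝ × ℝ => u p.1 p.2) (volume.restrict (Ioi 0 ×ˢ univ)) ∧
  (∀ᵐ p : ℝ × ℝ ∂(volume.restrict (Ioi 0 ×ˢ univ)), u p.1 p.2 ∈ r.K) ∧
  ∀ k ∈ r.K, ∀ φ : ℝ × ℝ → ℝ, ContDiff ℝ ∞ φ → HasCompactSupport φ → (∀ p, 0 ≤ φ p) →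
    0 ≤ (∫ p in Ioi (0 : ℝ) ×ˢ (univ : Set ℝ),
          (|u p.1 p.2 - k| * deriv (fun t => φ (t, p.2)) p.1
            + Real.sign (u p.1 p.2 - k) * (r.f (u p.1 p.2) - r.f k)
              * deriv (fun x => φ (p.1, x)) p.2))
        + ∫ x, |(if x < 0 then uL else uR) - k| * φ (0, x)

/-- The constant `c` is the strong trace at `x = 0`, taken from inside the road `h`, of `u`. -/
def HasTrace (h : Fin n ⊕ Fin m) (u : ℝ → ℝ → ℝ) (c : ℝ) : Prop :=
  ∀ T : ℝ, Tendsto (fun x => ∫⁻ t in Ioo 0 T, ‖u t x - c‖ₑ) (𝓝[dom h] 0 ⊓ ae volume) (𝓝 0)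

/-- The left state of the standard Riemann problem with `ρ₀` on the road and `ρh` beyond it. -/
def leftState (h : Fin n ⊕ Fin m) (ρ₀ ρh : ℝ) : ℝ := Sum.elim (fun _ => ρ₀) (fun _ => ρh) h

/-- The right state of the standard Riemann problem with `ρ₀` on the road and `ρh` beyond it. -/
def rightState (h : Fin n ⊕ Fin m) (ρ₀ ρh : ℝ) : ℝ := Sum.elim (fun _ => ρh) (fun _ => ρ₀) h

/-- The states `ρh` are the priority states for a common pair `(M, z)`. -/
def IsPriorityState (R : Fin n ⊕ Fin m → Road) (ρh : Fin n ⊕ Fin m → ℝ) : Prop :=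
  ∃ M : ℝ, ∃ z ∈ Icc (0 : ℝ) 1, ∀ h, ρh h ∈ (R h).levelSet M ∧ ρh h = (R h).Pri M z

/-- The generalized Riemann problem with initial data `ρ₀` is solved with the auxiliary states
`ρh` and has the traces `ρ₁` at the junction, that is, `ρ₁ = RP(ρ₀)`. -/
def IsRiemannSolver (R : Fin n ⊕ Fin m → Road) (ρ₀ ρh ρ₁ : Fin n ⊕ Fin m → ℝ) : Prop :=
  IsPriorityState R ρh ∧
  (∀ h, ∃ u : ℝ → ℝ → ℝ,
    IsRiemannSolution (R h) (leftState h (ρ₀ h) (ρh h)) (rightState h (ρ₀ h) (ρh h)) u ∧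
    HasTrace h u (ρ₁ h)) ∧
  ∑ h, sgn h * (R h).f (ρ₁ h) = 0

/-- `ρh` are auxiliary states which show that `ρb` belongs to the set `𝒦`. -/
def IsKState (R : Fin n ⊕ Fin m → Road) (ρb ρh : Fin n ⊕ Fin m → ℝ) : Prop :=
  IsRiemannSolver R ρb ρh ρb ∧
  ∀ h, (R h).f (ρb h) = (R h).f (ρh h) → ρh h ∈ ΓOut R h → ρb h ∈ ΓOut R h

/-- The set `𝒦` of fixed points of the Riemann solver with the outgoing-state condition. -/
def setK (R : Fin n ⊕ Fin m → Road) : Set (Fin n ⊕ Fin m → ℝ) :=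
  {ρb | (∀ h, ρb h ∈ (R h).K) ∧ ∃ ρh, IsKState R ρb ρh}

/-! ### The BGK model on the network -/

/-- The equilibrium function. -/
noncomputable def chi (ρ ξ : ℝ) : ℝ :=
  if 0 < ξ ∧ ξ < ρ then 1 else if ρ < ξ ∧ ξ < 0 then -1 else 0

/-- The set `D_ξ`. -/
def D (ξ : ℝ) : Set ℝ := {g | Real.sign ξ * g = |g| ∧ |g| ≤ 1}

/-- The outgoing part of the kinetic boundary values `γ` is `χ(ρh, ·)`. -/
def HasOutgoing (R : Fin n ⊕ Fin m → Road) (ρh : Fin n ⊕ Fin m → ℝ)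
    (γ : Fin n ⊕ Fin m → ℝ → ℝ) : Prop :=
  ∀ h, ∀ᵐ ξ ∂(volume.restrict (ΓOut R h)), γ h ξ = chi (ρh h) ξ

/-- The states `ρh` define the value of the coupling function at the incoming data `γ|_{ΓIn}`,
that is, `Ψ_h[γ(ΓIn)] = χ(ρh h, ·)` on `ΓOut` for all `h`. -/
def IsCouplingState (R : Fin n ⊕ Fin m → Road) (γ : Fin n ⊕ Fin m → ℝ → ℝ)
    (ρh : Fin n ⊕ Fin m → ℝ) : Prop :=
  IsPriorityState R ρh ∧
  ∑ h, sgn h * ((∫ ξ in ΓOut R h, (R h).df ξ * chi (ρh h) ξ)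
    + ∫ ξ in ΓIn R h, (R h).df ξ * γ h ξ) = 0

/-- The kinetic coupling condition `γ_h = Ψ_h[γ(ΓIn)]` a.e. on `ΓOut`, for all `h`. -/
def Coupled (R : Fin n ⊕ Fin m → Road) (γ : Fin n ⊕ Fin m → ℝ → ℝ) : Prop :=
  ∃ ρh, IsCouplingState R γ ρh ∧ HasOutgoing R ρh γ

/-- `g = g_h(t, x, ξ)` is a distributional solution of the BGK model on the network
`∂ₜ g_h + f_h'(ξ) ∂ₓ g_h = (χ(ρ_{g_h}, ξ) - g_h) / ε`, `ρ_{g_h} = ∫_K g_h dξ`,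
with initial data `g₀` and with boundary values `γ = γ_h(t, ξ)` at `x = 0` which satisfy the
coupling condition. Initial and boundary values are encoded by test functions which need not
vanish at `t = 0` and at `x = 0`. -/
structure IsBGKSolution (R : Fin n ⊕ Fin m → Road) (ε : ℝ)
    (g₀ : Fin n ⊕ Fin m → ℝ → ℝ → ℝ) (g : Fin n ⊕ Fin m → ℝ → ℝ → ℝ → ℝ)
    (γ : Fin n ⊕ Fin m → ℝ → ℝ → ℝ) : Prop where
  measurable : ∀ h, AEStronglyMeasurable (fun p : ℝ × ℝ × ℝ => g h p.1 p.2.1 p.2.2)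
    (volume.restrict (Ioi 0 ×ˢ dom h ×ˢ (R h).K))
  mem_D : ∀ h, ∀ᵐ p : ℝ × ℝ × ℝ ∂(volume.restrict (Ioi 0 ×ˢ dom h ×ˢ (R h).K)),
    g h p.1 p.2.1 p.2.2 ∈ D p.2.2
  measurable_initial : ∀ h, AEStronglyMeasurable (fun p : ℝ × ℝ => g₀ h p.1 p.2)
    (volume.restrict (dom h ×ˢ (R h).K))
  initial_mem_D : ∀ h, ∀ᵐ p : ℝ × ℝ ∂(volume.restrict (dom h ×ˢ (R h).K)), g₀ h p.1 p.2 ∈ D p.2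
  measurable_trace : ∀ h, AEStronglyMeasurable (fun p : ℝ × ℝ => γ h p.1 p.2)
    (volume.restrict (Ioi 0 ×ˢ (R h).K))
  trace_mem_D : ∀ h, ∀ᵐ p : ℝ × ℝ ∂(volume.restrict (Ioi 0 ×ˢ (R h).K)), γ h p.1 p.2 ∈ D p.2
  equation : ∀ h, ∀ φ : ℝ × ℝ × ℝ → ℝ, ContDiff ℝ ∞ φ → HasCompactSupport φ →
    (∫ p in Ioi (0 : ℝ) ×ˢ dom h ×ˢ (R h).K,
      (g h p.1 p.2.1 p.2.2 * (deriv (fun t => φ (t, p.2.1, p.2.2)) p.1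
          + (R h).df p.2.2 * deriv (fun x => φ (p.1, x, p.2.2)) p.2.1)
        + (chi (∫ ξ in (R h).K, g h p.1 p.2.1 ξ) p.2.2 - g h p.1 p.2.1 p.2.2) / ε * φ p))
      + (∫ p in dom h ×ˢ (R h).K, g₀ h p.1 p.2 * φ (0, p.1, p.2))
    = sgn h * ∫ p in Ioi (0 : ℝ) ×ˢ (R h).K, (R h).df p.2 * γ h p.1 p.2 * φ (p.1, 0, p.2)
  coupling : ∀ᵐ t ∂(volume.restrict (Ioi (0 : ℝ))), Coupled R (fun h => γ h t)

/-- `g = g_h(x, ξ)` is a stationary solution of the BGK model on the network, with boundary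
values `γ = γ_h(ξ)` at the junction. -/
def IsStationarySolution (R : Fin n ⊕ Fin m → Road) (ε : ℝ)
    (g : Fin n ⊕ Fin m → ℝ → ℝ → ℝ) (γ : Fin n ⊕ Fin m → ℝ → ℝ) : Prop :=
  IsBGKSolution R ε g (fun h _ => g h) (fun h _ => γ h)

/-- `g_h(x, ·) → χ(ρb_h, ·)` in `L¹(K_h)` as `|x| → ∞` in the road `h`, for every road. -/
def TendsAtInfinity (R : Fin n ⊕ Fin m → Road) (ρb : Fin n ⊕ Fin m → ℝ)
    (g : Fin n ⊕ Fin m → ℝ → ℝ → ℝ) : Prop :=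
  ∀ h, Tendsto (fun x => ∫⁻ ξ in (R h).K, ‖g h x ξ - chi (ρb h) ξ‖ₑ) (roadEnd h) (𝓝 0)

/-- The same convergence, where a null set of positions `x` is disregarded; this does not depend
on the representative of `g`. -/
def TendsAtInfinityAE (R : Fin n ⊕ Fin m → Road) (ρb : Fin n ⊕ Fin m → ℝ)
    (g : Fin n ⊕ Fin m → ℝ → ℝ → ℝ) : Prop :=
  ∀ h, Tendsto (fun x => ∫⁻ ξ in (R h).K, ‖g h x ξ - chi (ρb h) ξ‖ₑ)
    (roadEnd h ⊓ ae volume) (𝓝 0)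

/-- Two kinetic densities agree almost everywhere on every road. -/
def AEEqual (R : Fin n ⊕ Fin m → Road) (g g' : Fin n ⊕ Fin m → ℝ → ℝ → ℝ) : Prop :=
  ∀ h, ∀ᵐ p : ℝ × ℝ ∂(volume.restrict (dom h ×ˢ (R h).K)), g h p.1 p.2 = g' h p.1 p.2

/-- Convergence `g^ε_h → χ(ρb_h, ·)` in `L¹_loc((0,∞) × Ω_h × K_h)` as `ε → 0`, for every road. -/
def TendsLocally (R : Fin n ⊕ Fin m → Road) (ρb : Fin n ⊕ Fin m → ℝ)
    (g : ℝ → Fin n ⊕ Fin m → ℝ → ℝ → ℝ) : Prop :=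
  ∀ h, ∀ C : Set (ℝ × ℝ × ℝ), IsCompact C → C ⊆ Ioi 0 ×ˢ dom h ×ˢ (R h).K →
    Tendsto (fun ε => ∫⁻ p in C, ‖g ε h p.2.1 p.2.2 - chi (ρb h) p.2.2‖ₑ) (𝓝[>] 0) (𝓝 0)

end BGKNetwork

/-!
Every road is treated as a half-line `y = |x| > 0`, with the velocity `α = -s f'`, which points away
from the junction where it is positive, and the kinetic density is shifted by `1_{ξ ≤ 0}` to a
density `G` with values in `[0, 1]`. Then equilibria become the functions `1_{ξ ≤ ρ}`, and a
stationary solution on the road is a solution of the half-space problem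
`α ∂_y G = 1_{ξ ≤ ρ_G} - G` with the incoming values `1_{ξ ≤ ρ̂}` and the limit `1_{ξ ≤ ρ̄}`. The
parameter `ε` only changes the length scale. With the flux `Φ' = α`, the half-space problem is
solvable if and only if the pair `(ρ̂, ρ̄)` satisfies a strict entropy condition, called
`StrictlyCompatible`: `Φ` lies strictly above `Φ ρ̄` on `[ρ̂, ρ̄)` and strictly below it on `(ρ̄, ρ̂]`.

*Uniqueness and necessity.* For two solutions, the flux of `(G₁ - G₂)⁺` is nonincreasing in `y`,
nonpositive at `y = 0` if the incoming values are ordered, and has an explicit limit at infinity. If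
this limit is nonnegative, the flux vanishes identically, and so does the dissipation, which by
Gronwall's inequality gives `G₁ ≤ G₂` (`mild_comparison`). Applied in both directions this is
uniqueness (`mild_unique`); comparison with constant equilibria shows that solvability forces strict
compatibility (`strictlyCompatible_of_mild`).

*Existence.* For `ρ̂ < ρ̄`, averaging the equilibria along the characteristics defines a monotone map
on nondecreasing density profiles. Its iterates starting from `ρ̄` decrease to a fixed point. The flux
of the fixed point is at most `Φ ρ̄`, since this holds along the iteration, and it equals the flux of
its limit state at infinity, which is therefore `ρ̄` (`exists_mild_of_lt`). The case `ρ̂ > ρ̄` follows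
by the reflection `ξ ↦ -ξ`.

*Junction states.* Strict compatibility on all roads characterises the junction states among the
priority states with balanced fluxes. If the Riemann problem has the trace `ρ̄`, testing suitable
Kruzkov entropies near the junction gives the entropy condition with nonstrict inequalities
(`compatible_of_trace`), and by strict concavity of the fluxes the condition on `Γ^out` turns them
into strict ones. Conversely, for strictly compatible states the explicit shock or rarefaction wave
leaves the road (`exists_riemannSolution`).

*Conclusion.* The weak formulation with test functions is equivalent to the integrated equation along
characteristics (`IsStationarySolution.exists_isMild`, `IsMild.equation`), and the coupling condition
reduces to the balance of the fluxes `f_h ρ̄_h`. This gives existence and uniqueness for prescribed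
junction states. The solutions have the form `G(|x| / ε, ξ)`, whence the limit `ε → 0`. Without
prescribed values at the junction, the states which define the coupling of any stationary solution
are junction states of `ρ̄` again (`isKState_of_stationary`), so that they have the prescribed values
if these are the same for all junction states.
-/

open scoped Convolution

namespace BGKNetwork

/-! ### Calculus of primitives of bounded functions -/

/-- Chain rule for the positive part of a primitive of a bounded function. -/
theorem posPart_primitive {w k : ℝ → ℝ} {C : ℝ} (hk : Measurable k)
    (hb : ∀ z, 0 ≤ z → |k z| ≤ C) (hw : ∀ y, 0 ≤ y → w y = w 0 + ∫ z in (0 : ℝ)..y, k z)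
    {y : ℝ} (hy : 0 ≤ y) :
    max (w y) 0 = max (w 0) 0 + ∫ z in (0 : ℝ)..y, (if 0 < w z then k z else 0) := by
  have hC : 0 ≤ C := (abs_nonneg _).trans (hb 0 le_rfl)
  -- `k` is only controlled on `y ≥ 0`; extend it by zero to obtain a Lipschitz primitive on the line
  set k' : ℝ → ℝ := (Ici (0 : ℝ)).indicator k with hk'
  have hk'm : Measurable k' := hk.indicator measurableSet_Ici
  have hk'b : ∀ z, |k' z| ≤ C := by
    intro z
    by_cases hz : 0 ≤ z
    · rw [hk', indicator_of_mem (mem_Ici.2 hz)]; exact hb z hz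
    · rw [hk', indicator_of_notMem (by simpa using hz)]; simpa using hC
  have hk'i : ∀ u v, IntervalIntegrable k' volume u v := fun u v =>
    (intervalIntegrable_const (c := C)).mono_fun' hk'm.aestronglyMeasurable
      (ae_of_all _ fun z => by simpa using hk'b z)
  have hk'L : LocallyIntegrable k' volume := by
    refine (locallyIntegrable_const C).mono hk'm.aestronglyMeasurable (ae_of_all _ fun z => ?_)
    rw [Real.norm_eq_abs, Real.norm_eq_abs, abs_of_nonneg hC]; exact hk'b z
  set W : ℝ → ℝ := fun y => w 0 + ∫ z in (0 : ℝ)..y, k' z with hW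
  have hWw : ∀ y, 0 ≤ y → W y = w y := by
    intro y hy
    rw [hW, hw y hy]
    simp only [add_right_inj]
    refine intervalIntegral.integral_congr fun z hz => ?_
    rw [uIcc_of_le hy] at hz
    simp [hk', hz.1]
  have hWlip : LipschitzWith (Real.toNNReal C) W := by
    refine LipschitzWith.of_dist_le_mul fun u v => ?_
    rw [Real.dist_eq, Real.dist_eq, Real.coe_toNNReal _ hC]
    have : W u - W v = ∫ z in v..u, k' z := by
      simp only [hW, add_sub_add_left_eq_sub]
      exact intervalIntegral.integral_interval_sub_left (hk'i _ _) (hk'i _ _)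
    rw [this, ← Real.norm_eq_abs]
    exact intervalIntegral.norm_integral_le_of_norm_le_const fun z _ => hk'b z
  have hflip : LipschitzWith (Real.toNNReal C) (fun y => max (W y) 0) := hWlip.max_const 0
  -- it remains to identify the derivative; at points with `W z = 0` it is zero, since `z` is a minimum
  have hac : AbsolutelyContinuousOnInterval (fun y => max (W y) 0) 0 y :=
    (hflip.lipschitzOnWith (s := uIcc 0 y)).absolutelyContinuousOnInterval
  have h1 := hac.integral_deriv_eq_sub
  have h2 : ∫ z in (0 : ℝ)..y, deriv (fun y => max (W y) 0) z
      = ∫ z in (0 : ℝ)..y, (if 0 < w z then k z else 0) := by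
    refine intervalIntegral.integral_congr_ae ?_
    filter_upwards [LocallyIntegrable.ae_hasDerivAt_integral hk'L] with z hz hzm
    rw [uIoc_of_le hy] at hzm
    have hd : HasDerivAt W (k' z) z := (hz 0).const_add _
    have hkz : k' z = k z := by simp [hk', hzm.1.le]
    rw [← hWw z hzm.1.le, ← hkz]
    rcases lt_trichotomy (W z) 0 with h | h | h
    · rw [if_neg (not_lt.2 h.le)]
      have : (fun y => max (W y) 0) =ᶠ[𝓝 z] fun _ => 0 := by
        filter_upwards [hWlip.continuous.continuousAt.eventually (gt_mem_nhds h)] with x hx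
        exact max_eq_right (le_of_lt hx)
      rw [this.deriv_eq]; simp
    · rw [if_neg (by rw [h]; exact lt_irrefl _)]
      apply IsLocalMin.deriv_eq_zero
      refine Eventually.of_forall fun x => ?_
      simp [h]
    · rw [if_pos h]
      have : (fun y => max (W y) 0) =ᶠ[𝓝 z] W := by
        filter_upwards [hWlip.continuous.continuousAt.eventually (lt_mem_nhds h)] with x hx
        exact max_eq_left (le_of_lt hx)
      rw [this.deriv_eq, hd.deriv]
  rw [← h2, h1, hWw y hy]
  simp [hW]

/-- Gronwall's inequality with zero initial value. -/
theorem eq_zero_of_le_integral {v : ℝ → ℝ} {C : ℝ} (hv : ContinuousOn v (Ici 0))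
    (h0 : ∀ y, 0 ≤ y → 0 ≤ v y) (hle : ∀ y, 0 ≤ y → v y ≤ C * ∫ z in (0 : ℝ)..y, v z)
    {y : ℝ} (hy : 0 ≤ y) : v y = 0 := by
  -- a continuous extension of `v` to the line, whose primitive is differentiable everywhere
  set V : ℝ → ℝ := fun x => v (max x 0) with hV
  have hVc : Continuous V := by
    have : ContinuousOn (fun x : ℝ => v (max x 0)) univ :=
      hv.comp (by fun_prop) fun x _ => le_max_right x 0
    exact continuousOn_univ.1 this
  have hVv : ∀ x, 0 ≤ x → V x = v x := fun x hx => by simp [hV, hx]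
  set U : ℝ → ℝ := fun x => ∫ z in (0 : ℝ)..x, V z with hU
  have hUd : ∀ x, HasDerivAt U (V x) x := fun x =>
    intervalIntegral.integral_hasDerivAt_right (hVc.intervalIntegrable _ _)
      (hVc.stronglyMeasurableAtFilter _ _) hVc.continuousAt
  have hUv : ∀ x, 0 ≤ x → U x = ∫ z in (0 : ℝ)..x, v z := by
    intro x hx
    refine intervalIntegral.integral_congr fun z hz => ?_
    rw [uIcc_of_le hx] at hz
    exact hVv z hz.1
  have hle' : ∀ x, 0 ≤ x → V x ≤ C * U x := fun x hx => by
    rw [hVv x hx, hUv x hx]; exact hle x hx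
  set E : ℝ → ℝ := fun x => U x * Real.exp (-(C * x)) with hE
  have hEd : ∀ x, HasDerivAt E ((V x - C * U x) * Real.exp (-(C * x))) x := by
    intro x
    have h1 : HasDerivAt (fun x => Real.exp (-(C * x))) (Real.exp (-(C * x)) * (-(C * 1))) x :=
      (((hasDerivAt_id x).const_mul C).neg).exp
    convert! (hUd x).mul h1 using 1
    ring
  have hanti : AntitoneOn E (Ici 0) := by
    refine antitoneOn_of_deriv_nonpos (convex_Ici 0)
      (fun x _ => (hEd x).continuousAt.continuousWithinAt)
      (fun x _ => (hEd x).differentiableAt.differentiableWithinAt) fun x hx => ?_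
    rw [interior_Ici] at hx
    rw [(hEd x).deriv]
    exact mul_nonpos_of_nonpos_of_nonneg (by linarith [hle' x (le_of_lt hx)]) (Real.exp_pos _).le
  have hEy : E y ≤ 0 := by
    have := hanti (mem_Ici.2 le_rfl) (mem_Ici.2 hy) hy
    simpa [hE, hU] using this
  have hUy : U y ≤ 0 := by
    by_contra h
    push Not at h
    have := mul_pos h (Real.exp_pos (-(C * y)))
    exact absurd hEy (not_le.2 this)
  have hUy' : U y = 0 := by
    refine le_antisymm hUy ?_
    rw [hUv y hy]
    exact intervalIntegral.integral_nonneg hy fun z hz => h0 z hz.1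
  have := hle' y hy
  rw [hUy', mul_zero, hVv y hy] at this
  exact le_antisymm this (h0 y hy)

/-! ### The half-space problem -/

/-- The shifted equilibrium `χ(ρ, ξ) + 1_{ξ ≤ 0}`, up to the null set `ξ ∈ {0, ρ}`. The value
at `ξ = ρ` makes it continuous along decreasing sequences of `ρ`. -/
noncomputable def equil (ρ ξ : ℝ) : ℝ := if ξ ≤ ρ then 1 else 0

/-- The density belonging to a shifted kinetic density with values in `[0, 1]`. -/
noncomputable def dens (a b : ℝ) (G : ℝ → ℝ → ℝ) (y : ℝ) : ℝ := a + ∫ ξ in Icc a b, G y ξ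

/-- A bounded velocity which vanishes only on a null set. -/
structure IsVelocity (a b : ℝ) (α : ℝ → ℝ) : Prop where
  lt : a < b
  measurable : Measurable α
  bounded : ∃ A, ∀ ξ, |α ξ| ≤ A
  ne_zero : ∀ᵐ ξ ∂(volume.restrict (Icc a b)), α ξ ≠ 0

/-- Solutions of `α ∂_y G = 1_{ξ ≤ ρ_G} - G` on the half-line `y ≥ 0`, in integrated form. -/
structure IsMild (a b : ℝ) (α : ℝ → ℝ) (G : ℝ → ℝ → ℝ) : Prop where
  measurable : Measurable (Function.uncurry G)
  range : ∀ y ξ, G y ξ ∈ Icc (0 : ℝ) 1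
  mild : ∀ᵐ ξ ∂(volume.restrict (Icc a b)), ∀ y, 0 ≤ y →
    α ξ * G y ξ = α ξ * G 0 ξ + ∫ z in (0 : ℝ)..y, (equil (dens a b G z) ξ - G z ξ)

section
variable {a b : ℝ} {α : ℝ → ℝ}

theorem equil_mem (ρ ξ : ℝ) : equil ρ ξ ∈ Icc (0 : ℝ) 1 := by
  unfold equil; split_ifs <;> simp

theorem equil_mono (ξ : ℝ) : Monotone fun ρ => equil ρ ξ := by
  intro r s h
  simp only [equil]
  split_ifs with h1 h2
  · exact le_rfl
  · exact absurd (h1.trans h) h2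
  · exact zero_le_one
  · exact le_rfl

theorem measurable_equil : Measurable (Function.uncurry equil) :=
  Measurable.ite (measurableSet_le measurable_snd measurable_fst) measurable_const
    measurable_const

/-- A bounded measurable function is integrable on a bounded interval. -/
theorem integrable_Icc_of_bounded {f : ℝ → ℝ} {C : ℝ} (hf : Measurable f) (hC : ∀ ξ, |f ξ| ≤ C) :
    Integrable f (volume.restrict (Icc a b)) :=
  (integrable_const C).mono' hf.aestronglyMeasurable (ae_of_all _ hC)

theorem integral_mul_equil (f : ℝ → ℝ) {r : ℝ} (hr : r ∈ Icc a b) :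
    ∫ ξ in Icc a b, f ξ * equil r ξ = ∫ ξ in a..r, f ξ := by
  have : (fun ξ => f ξ * equil r ξ) = (Iic r).indicator f := by
    ext ξ
    by_cases h : ξ ≤ r <;> simp [equil, h]
  rw [this, integral_indicator measurableSet_Iic, Measure.restrict_restrict measurableSet_Iic,
    intervalIntegral.integral_of_le hr.1, ← integral_Icc_eq_integral_Ioc]
  congr 2
  ext ξ
  simp only [mem_inter_iff, mem_Iic, mem_Icc]
  exact ⟨fun h => ⟨h.2.1, h.1⟩, fun h => ⟨h.2, h.1, h.2.trans hr.2⟩⟩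

theorem integral_equil {r : ℝ} (hr : r ∈ Icc a b) : ∫ ξ in Icc a b, equil r ξ = r - a := by
  have := integral_mul_equil (fun _ => 1) hr
  simpa using this

theorem IsMild.integrable {G : ℝ → ℝ → ℝ} (hG : IsMild a b α G) (y : ℝ) :
    Integrable (G y) (volume.restrict (Icc a b)) :=
  integrable_Icc_of_bounded (C := 1) (hG.measurable.comp measurable_prodMk_left) fun ξ => by
    rw [abs_of_nonneg (hG.range y ξ).1]; exact (hG.range y ξ).2

theorem dens_mem_of {G : ℝ → ℝ → ℝ} (hab : a ≤ b) (hm : Measurable (Function.uncurry G))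
    (hr : ∀ y ξ, G y ξ ∈ Icc (0 : ℝ) 1) (y : ℝ) : dens a b G y ∈ Icc a b := by
  have h0 : 0 ≤ ∫ ξ in Icc a b, G y ξ := integral_nonneg fun ξ => (hr y ξ).1
  have h1 : ∫ ξ in Icc a b, G y ξ ≤ ∫ ξ in Icc a b, (1 : ℝ) := by
    refine integral_mono ?_ (integrable_const _) fun ξ => (hr y ξ).2
    exact integrable_Icc_of_bounded (C := 1) (hm.comp measurable_prodMk_left) fun ξ => by
      rw [abs_of_nonneg (hr y ξ).1]; exact (hr y ξ).2
  have h2 : ∫ ξ in Icc a b, (1 : ℝ) = b - a := by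
    simp [hab]
  unfold dens
  constructor <;> linarith

theorem IsMild.dens_mem {G : ℝ → ℝ → ℝ} (hG : IsMild a b α G) (hα : IsVelocity a b α) (y : ℝ) :
    dens a b G y ∈ Icc a b := dens_mem_of hα.lt.le hG.measurable hG.range y

theorem measurable_dens {G : ℝ → ℝ → ℝ} (hm : Measurable (Function.uncurry G)) :
    Measurable (dens a b G) :=
  (hm.stronglyMeasurable.integral_prod_right (ν := volume.restrict (Icc a b))).measurable.const_add
    a

/-- Constant equilibria are solutions. -/
theorem isMild_equil {k : ℝ} (hk : k ∈ Icc a b) : IsMild a b α fun _ => equil k where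
  measurable := measurable_equil.comp (measurable_const.prodMk measurable_snd)
  range _ ξ := equil_mem k ξ
  mild := by
    have : ∀ z, dens a b (fun _ => equil k) z = k := fun z => by
      simp only [dens, integral_equil hk]; ring
    refine ae_of_all _ fun ξ y _ => ?_
    simp [this]

theorem sub_mem_Icc {u v : ℝ} (hu : u ∈ Icc (0 : ℝ) 1) (hv : v ∈ Icc (0 : ℝ) 1) : |u - v| ≤ 1 := by
  rw [abs_le]; constructor <;> linarith [hu.1, hu.2, hv.1, hv.2]

theorem measurable_equil_dens {G : ℝ → ℝ → ℝ} (hm : Measurable (Function.uncurry G)) :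
    Measurable fun p : ℝ × ℝ => equil (dens a b G p.1) p.2 :=
  measurable_equil.comp (((measurable_dens hm).comp measurable_fst).prodMk measurable_snd)

/-- Exchange of the order of integration for a bounded source. -/
theorem integral_intervalIntegral_swap {k : ℝ → ℝ → ℝ} {C : ℝ}
    (hk : Measurable (Function.uncurry k)) (hC : ∀ z ξ, |k z ξ| ≤ C) (u v : ℝ) :
    ∫ ξ in Icc a b, (∫ z in u..v, k z ξ) = ∫ z in u..v, (∫ ξ in Icc a b, k z ξ) := by
  refine (intervalIntegral_integral_swap ?_).symm
  have : IsFiniteMeasure (volume.restrict (uIoc u v)) :=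
    isFiniteMeasure_restrict.2 (by simp [uIoc])
  exact (integrable_const C).mono' hk.aestronglyMeasurable (ae_of_all _ fun p => hC p.1 p.2)

/-- The positive part of the difference of two solutions satisfies the difference of the equations
where it is positive. -/
theorem mild_posPart {G₁ G₂ : ℝ → ℝ → ℝ} (hα : IsVelocity a b α)
    (h₁ : IsMild a b α G₁) (h₂ : IsMild a b α G₂) :
    ∀ᵐ ξ ∂(volume.restrict (Icc a b)), ContinuousOn (fun y => max (G₁ y ξ - G₂ y ξ) 0) (Ici 0) ∧
      ∀ y, 0 ≤ y → α ξ * max (G₁ y ξ - G₂ y ξ) 0 = α ξ * max (G₁ 0 ξ - G₂ 0 ξ) 0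
        + ∫ z in (0 : ℝ)..y, (if 0 < G₁ z ξ - G₂ z ξ then
            equil (dens a b G₁ z) ξ - equil (dens a b G₂ z) ξ - (G₁ z ξ - G₂ z ξ) else 0) := by
  filter_upwards [h₁.mild, h₂.mild, hα.ne_zero] with ξ e₁ e₂ hne
  set K : ℝ → ℝ := fun z => (α ξ)⁻¹ *
    (equil (dens a b G₁ z) ξ - equil (dens a b G₂ z) ξ - (G₁ z ξ - G₂ z ξ)) with hK
  have m₁ : Measurable fun z => equil (dens a b G₁ z) ξ :=
    (measurable_equil_dens h₁.measurable).comp measurable_prodMk_right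
  have m₂ : Measurable fun z => equil (dens a b G₂ z) ξ :=
    (measurable_equil_dens h₂.measurable).comp measurable_prodMk_right
  have n₁ : Measurable fun z => G₁ z ξ := h₁.measurable.comp measurable_prodMk_right
  have n₂ : Measurable fun z => G₂ z ξ := h₂.measurable.comp measurable_prodMk_right
  have hKm : Measurable K := ((m₁.sub m₂).sub (n₁.sub n₂)).const_mul _
  have hKb : ∀ z, |K z| ≤ |(α ξ)⁻¹| * 2 := by
    intro z
    rw [hK, abs_mul]
    refine mul_le_mul_of_nonneg_left ?_ (abs_nonneg _)
    refine (abs_sub _ _).trans ?_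
    have := sub_mem_Icc (equil_mem (dens a b G₁ z) ξ) (equil_mem (dens a b G₂ z) ξ)
    have := sub_mem_Icc (h₁.range z ξ) (h₂.range z ξ)
    linarith
  have ib : ∀ {f : ℝ → ℝ}, Measurable f → (∀ z, |f z| ≤ 1) → ∀ y,
      IntervalIntegrable f volume 0 y := fun hf hb y =>
    (intervalIntegrable_const (c := (1 : ℝ))).mono_fun' hf.aestronglyMeasurable
      (ae_of_all _ fun z => by simpa using hb z)
  have hw : ∀ y, 0 ≤ y → G₁ y ξ - G₂ y ξ = (G₁ 0 ξ - G₂ 0 ξ) + ∫ z in (0 : ℝ)..y, K z := by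
    intro y hy
    have i₁ : IntervalIntegrable (fun z => equil (dens a b G₁ z) ξ - G₁ z ξ) volume 0 y :=
      ib (m₁.sub n₁) (fun z => sub_mem_Icc (equil_mem _ _) (h₁.range z ξ)) y
    have i₂ : IntervalIntegrable (fun z => equil (dens a b G₂ z) ξ - G₂ z ξ) volume 0 y :=
      ib (m₂.sub n₂) (fun z => sub_mem_Icc (equil_mem _ _) (h₂.range z ξ)) y
    have e : ∫ z in (0 : ℝ)..y, K z = (α ξ)⁻¹ *
        ((∫ z in (0 : ℝ)..y, (equil (dens a b G₁ z) ξ - G₁ z ξ))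
          - ∫ z in (0 : ℝ)..y, (equil (dens a b G₂ z) ξ - G₂ z ξ)) := by
      rw [← intervalIntegral.integral_sub i₁ i₂, ← intervalIntegral.integral_const_mul]
      congr 1
      ext z
      simp only [hK]; ring
    rw [e]
    apply mul_left_cancel₀ hne
    rw [mul_add, ← mul_assoc, mul_inv_cancel₀ hne, one_mul]
    linear_combination e₁ y hy - e₂ y hy
  have hcont : ContinuousOn (fun y => max (G₁ y ξ - G₂ y ξ) 0) (Ici 0) := by
    have hKi : ∀ u v, IntervalIntegrable K volume u v := fun u v =>
      (intervalIntegrable_const (c := |(α ξ)⁻¹| * 2)).mono_fun' hKm.aestronglyMeasurable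
        (ae_of_all _ fun z => by simpa using hKb z)
    have : Continuous fun y => max ((G₁ 0 ξ - G₂ 0 ξ) + ∫ z in (0 : ℝ)..y, K z) 0 :=
      (continuous_const.add (intervalIntegral.continuous_primitive hKi 0)).max continuous_const
    exact this.continuousOn.congr fun y hy => by simp only [hw y hy]
  refine ⟨hcont, fun y hy => ?_⟩
  rw [posPart_primitive hKm (fun z _ => hKb z) hw hy, mul_add, ← intervalIntegral.integral_const_mul]
  congr 2
  ext z
  split_ifs
  · simp only [hK]; rw [← mul_assoc, mul_inv_cancel₀ hne, one_mul]
  · simp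

/-- The source of the positive part, integrated in `ξ`, is a dissipation: it is nonpositive, and if it
vanishes, then the equilibrium of `G₂` is at most that of `G₁` at almost all `ξ` with `G₁ > G₂`. -/
theorem source_posPart_nonpos {G₁ G₂ : ℝ → ℝ → ℝ} (hα : IsVelocity a b α)
    (h₁ : IsMild a b α G₁) (h₂ : IsMild a b α G₂) (z : ℝ) :
    (∫ ξ in Icc a b, (if 0 < G₁ z ξ - G₂ z ξ then
      equil (dens a b G₁ z) ξ - equil (dens a b G₂ z) ξ - (G₁ z ξ - G₂ z ξ) else 0)) ≤ 0 ∧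
    ((∫ ξ in Icc a b, (if 0 < G₁ z ξ - G₂ z ξ then
      equil (dens a b G₁ z) ξ - equil (dens a b G₂ z) ξ - (G₁ z ξ - G₂ z ξ) else 0)) = 0 →
      ∀ᵐ ξ ∂(volume.restrict (Icc a b)), 0 < G₁ z ξ - G₂ z ξ →
        equil (dens a b G₂ z) ξ ≤ equil (dens a b G₁ z) ξ) := by
  have n₁ : Measurable fun ξ => G₁ z ξ := h₁.measurable.comp measurable_prodMk_left
  have n₂ : Measurable fun ξ => G₂ z ξ := h₂.measurable.comp measurable_prodMk_left
  have me : ∀ r, Measurable fun ξ => equil r ξ := fun r => measurable_equil.comp measurable_prodMk_left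
  have hms : MeasurableSet {ξ | 0 < G₁ z ξ - G₂ z ξ} := measurableSet_lt measurable_const (n₁.sub n₂)
  set r₁ := dens a b G₁ z with hr₁
  set r₂ := dens a b G₂ z with hr₂
  have iw : Integrable (fun ξ => G₁ z ξ - G₂ z ξ) (volume.restrict (Icc a b)) :=
    (h₁.integrable z).sub (h₂.integrable z)
  have iw' : Integrable (fun ξ => max (G₁ z ξ - G₂ z ξ) 0) (volume.restrict (Icc a b)) :=
    iw.pos_part
  have is : Integrable (fun ξ => if 0 < G₁ z ξ - G₂ z ξ then
      equil r₁ ξ - equil r₂ ξ - (G₁ z ξ - G₂ z ξ) else 0) (volume.restrict (Icc a b)) := by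
    refine integrable_Icc_of_bounded (C := 2) ?_ fun ξ => ?_
    · exact Measurable.ite hms (((me r₁).sub (me r₂)).sub (n₁.sub n₂)) measurable_const
    · split_ifs
      · refine (abs_sub _ _).trans ?_
        have := sub_mem_Icc (equil_mem r₁ ξ) (equil_mem r₂ ξ)
        have := sub_mem_Icc (h₁.range z ξ) (h₂.range z ξ)
        linarith
      · simp
  have iM : Integrable (fun ξ => equil r₁ ξ - equil r₂ ξ) (volume.restrict (Icc a b)) :=
    integrable_Icc_of_bounded (C := 1) ((me r₁).sub (me r₂)) fun ξ =>
      sub_mem_Icc (equil_mem r₁ ξ) (equil_mem r₂ ξ)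
  rcases le_total r₁ r₂ with hle | hle
  · -- the source is bounded above by `-(G₁ - G₂)⁺`
    have hs : ∀ ξ, (if 0 < G₁ z ξ - G₂ z ξ then
        equil r₁ ξ - equil r₂ ξ - (G₁ z ξ - G₂ z ξ) else 0) ≤ -max (G₁ z ξ - G₂ z ξ) 0 := by
      intro ξ
      have := equil_mono ξ hle
      simp only at this
      split_ifs with h
      · rw [max_eq_left h.le]; linarith
      · rw [max_eq_right (not_lt.1 h)]; simp
    have hint := integral_mono is iw'.neg hs
    simp only [Pi.neg_apply, integral_neg] at hint
    have h0 : 0 ≤ ∫ ξ in Icc a b, max (G₁ z ξ - G₂ z ξ) 0 := integral_nonneg fun ξ => le_max_right _ _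
    refine ⟨by linarith, fun he => ?_⟩
    have : ∫ ξ in Icc a b, max (G₁ z ξ - G₂ z ξ) 0 = 0 := by linarith
    rw [integral_eq_zero_iff_of_nonneg (fun ξ => le_max_right (G₁ z ξ - G₂ z ξ) 0) iw'] at this
    filter_upwards [this] with ξ hξ hpos
    simp only [Pi.zero_apply, max_eq_left hpos.le] at hξ
    exact absurd hξ hpos.ne'
  -- the source is bounded above by the difference of the equilibria minus `G₁ - G₂`, whose
  -- integral vanishes by the definition of the densities
  · refine ⟨?_, fun _ => ae_of_all _ fun ξ _ => equil_mono ξ hle⟩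
    have hs : ∀ ξ, (if 0 < G₁ z ξ - G₂ z ξ then
        equil r₁ ξ - equil r₂ ξ - (G₁ z ξ - G₂ z ξ) else 0)
          ≤ (equil r₁ ξ - equil r₂ ξ) - (G₁ z ξ - G₂ z ξ) := by
      intro ξ
      have := equil_mono ξ hle
      simp only at this
      split_ifs with h
      · exact le_rfl
      · linarith
    have hint := integral_mono is (iM.sub iw) hs
    have e1 : ∫ ξ in Icc a b, (fun ξ => (equil r₁ ξ - equil r₂ ξ)) ξ = r₁ - r₂ := by
      have i : ∀ r, Integrable (fun ξ => equil r ξ) (volume.restrict (Icc a b)) := fun r =>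
        integrable_Icc_of_bounded (C := 1) (me r) fun ξ => by
          rw [abs_of_nonneg (equil_mem r ξ).1]; exact (equil_mem r ξ).2
      rw [integral_sub (i _) (i _), integral_equil (h₁.dens_mem hα z),
        integral_equil (h₂.dens_mem hα z)]
      ring
    have e2 : ∫ ξ in Icc a b, (fun ξ => (G₁ z ξ - G₂ z ξ)) ξ = r₁ - r₂ := by
      rw [integral_sub (h₁.integrable z) (h₂.integrable z)]
      simp only [hr₁, hr₂, dens]; ring
    have e3 := integral_sub iM iw
    simp only at e1 e2
    rw [e1, e2] at e3
    have : (∫ ξ in Icc a b, ((fun ξ => equil r₁ ξ - equil r₂ ξ) - fun ξ => G₁ z ξ - G₂ z ξ) ξ) = 0 := by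
      simpa using e3
    linarith

/-- Comparison principle: if `G₁ ≤ G₂` on the incoming velocities at `y = 0` and the flux of
`(G₁ - G₂)⁺` does not become negative at infinity, then `G₁ ≤ G₂`. The flux is nonincreasing
in `y` and nonpositive at `y = 0`, so that it vanishes identically, and the dissipation with it. -/
theorem mild_comparison {G₁ G₂ : ℝ → ℝ → ℝ} (hα : IsVelocity a b α)
    (h₁ : IsMild a b α G₁) (h₂ : IsMild a b α G₂)
    (hin : ∀ᵐ ξ ∂(volume.restrict (Icc a b)), 0 < α ξ → G₁ 0 ξ ≤ G₂ 0 ξ)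
    {l : Filter ℝ} [l.NeBot] (hl : l ≤ atTop) {q : ℝ}
    (hq : Tendsto (fun y => ∫ ξ in Icc a b, α ξ * max (G₁ y ξ - G₂ y ξ) 0) l (𝓝 q))
    (hq0 : 0 ≤ q) {y : ℝ} (hy : 0 ≤ y) :
    ∀ᵐ ξ ∂(volume.restrict (Icc a b)), G₁ y ξ ≤ G₂ y ξ := by
  revert y
  obtain ⟨A, hA⟩ := hα.bounded
  set μ := volume.restrict (Icc a b) with hμ
  set S : ℝ → ℝ → ℝ := fun z ξ => if 0 < G₁ z ξ - G₂ z ξ then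
      equil (dens a b G₁ z) ξ - equil (dens a b G₂ z) ξ - (G₁ z ξ - G₂ z ξ) else 0 with hS
  set Q : ℝ → ℝ := fun y => ∫ ξ in Icc a b, α ξ * max (G₁ y ξ - G₂ y ξ) 0 with hQ
  set d : ℝ → ℝ := fun z => ∫ ξ in Icc a b, S z ξ with hd
  have hSm : Measurable (Function.uncurry S) := by
    refine Measurable.ite (measurableSet_lt measurable_const (h₁.measurable.sub h₂.measurable)) ?_
      measurable_const
    exact ((measurable_equil_dens h₁.measurable).sub (measurable_equil_dens h₂.measurable)).sub
      (h₁.measurable.sub h₂.measurable)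
  have hSb : ∀ z ξ, |S z ξ| ≤ 2 := by
    intro z ξ
    simp only [hS]
    split_ifs
    · refine (abs_sub _ _).trans ?_
      have := sub_mem_Icc (equil_mem (dens a b G₁ z) ξ) (equil_mem (dens a b G₂ z) ξ)
      have := sub_mem_Icc (h₁.range z ξ) (h₂.range z ξ)
      linarith
    · simp
  have hwm : Measurable (Function.uncurry fun y ξ => max (G₁ y ξ - G₂ y ξ) 0) :=
    (h₁.measurable.sub h₂.measurable).max measurable_const
  have hwb : ∀ y ξ, |max (G₁ y ξ - G₂ y ξ) 0| ≤ 1 := by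
    intro y ξ
    rw [abs_of_nonneg (le_max_right _ _)]
    exact max_le ((le_abs_self _).trans (sub_mem_Icc (h₁.range y ξ) (h₂.range y ξ))) zero_le_one
  have iq : ∀ y, Integrable (fun ξ => α ξ * max (G₁ y ξ - G₂ y ξ) 0) μ := fun y =>
    integrable_Icc_of_bounded (C := A * 1) (hα.measurable.mul (hwm.comp measurable_prodMk_left))
      fun ξ => by
        rw [abs_mul]
        exact mul_le_mul (hA ξ) (hwb y ξ) (abs_nonneg _) ((abs_nonneg _).trans (hA ξ))
  have hpos := mild_posPart hα h₁ h₂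
  have hSi : ∀ y, Integrable (fun ξ => ∫ z in (0 : ℝ)..y, S z ξ) μ := by
    intro y
    refine (integrable_const (2 * |y - 0|)).mono' ?_ (ae_of_all _ fun ξ => ?_)
    · have : Measurable fun ξ => ∫ z in (0 : ℝ)..y, S z ξ := by
        simp only [intervalIntegral]
        exact (hSm.stronglyMeasurable.integral_prod_left'.measurable).sub
          (hSm.stronglyMeasurable.integral_prod_left'.measurable)
      exact this.aestronglyMeasurable
    · exact intervalIntegral.norm_integral_le_of_norm_le_const fun z _ => hSb z ξ
  have hQeq : ∀ y, 0 ≤ y → Q y = Q 0 + ∫ z in (0 : ℝ)..y, d z := by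
    intro y hy
    simp only [hQ, hd]
    rw [← integral_intervalIntegral_swap hSm hSb, ← integral_add (iq 0) (hSi y)]
    refine integral_congr_ae ?_
    filter_upwards [hpos] with ξ hξ
    exact hξ.2 y hy
  have hd0 : ∀ z, d z ≤ 0 := fun z => (source_posPart_nonpos hα h₁ h₂ z).1
  have hdm : Measurable d :=
    (hSm.stronglyMeasurable.integral_prod_right (ν := volume.restrict (Icc a b))).measurable
  have hdi : ∀ u v, IntervalIntegrable d volume u v := fun u v => by
    refine (intervalIntegrable_const (c := 2 * (volume.restrict (Icc a b)).real univ)).mono_fun'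
      hdm.aestronglyMeasurable (ae_of_all _ fun z => ?_)
    exact norm_integral_le_of_norm_le_const (ae_of_all _ fun ξ => hSb z ξ)
  have hQ0 : Q 0 ≤ 0 := by
    refine integral_nonpos_of_ae ?_
    filter_upwards [hin] with ξ hξ
    rcases lt_or_ge 0 (α ξ) with h | h
    · simp [hξ h]
    · exact mul_nonpos_of_nonpos_of_nonneg h (le_max_right _ _)
  have hint0 : ∀ u v, u ≤ v → ∫ z in u..v, d z ≤ 0 := fun u v huv => by
    have := intervalIntegral.integral_nonneg (f := fun z => -d z) (μ := volume) huv
      fun z _ => neg_nonneg.2 (hd0 z)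
    rw [intervalIntegral.integral_neg] at this
    linarith
  have hQanti : ∀ u v, 0 ≤ u → u ≤ v → Q v ≤ Q u := by
    intro u v hu huv
    rw [hQeq u hu, hQeq v (hu.trans huv),
      ← intervalIntegral.integral_add_adjacent_intervals (hdi 0 u) (hdi u v)]
    linarith [hint0 u v huv]
  have hQge : ∀ y, 0 ≤ y → q ≤ Q y := by
    intro y hy
    refine le_of_tendsto hq ?_
    filter_upwards [hl (eventually_ge_atTop y)] with v hv
    exact hQanti y v hy hv
  have hQz : ∀ y, 0 ≤ y → Q y = 0 := fun y hy =>
    le_antisymm ((hQanti 0 y le_rfl hy).trans hQ0) (hq0.trans (hQge y hy))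
  -- the dissipation vanishes
  have hdz : ∀ᵐ z ∂(volume.restrict (Ioi (0 : ℝ))), d z = 0 := by
    have key : ∀ n : ℕ, ∀ᵐ z ∂(volume.restrict (Ioc (0 : ℝ) n)), d z = 0 := by
      intro n
      have h := hQeq n n.cast_nonneg
      rw [hQz _ n.cast_nonneg, hQz 0 le_rfl, zero_add,
        intervalIntegral.integral_of_le n.cast_nonneg] at h
      have h' : ∫ z in Ioc (0 : ℝ) n, -d z = 0 := by rw [integral_neg, ← h, neg_zero]
      rw [integral_eq_zero_iff_of_nonneg (fun z => neg_nonneg.2 (hd0 z))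
        ((hdi 0 n).1.neg)] at h'
      filter_upwards [h'] with z hz
      simpa using hz
    have hU : Ioi (0 : ℝ) = ⋃ n : ℕ, Ioc (0 : ℝ) n := by
      ext z
      simp only [mem_Ioi, mem_iUnion, mem_Ioc]
      exact ⟨fun h => (exists_nat_ge z).imp fun n hn => ⟨h, hn⟩, fun ⟨n, h, _⟩ => h⟩
    rw [hU, ae_restrict_iUnion_iff]
    exact key
  have hsgn : ∀ᵐ ξ ∂μ, ∀ᵐ z ∂(volume.restrict (Ioi (0 : ℝ))), 0 < G₁ z ξ - G₂ z ξ →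
      equil (dens a b G₂ z) ξ ≤ equil (dens a b G₁ z) ξ := by
    have hmeas : MeasurableSet {p : ℝ × ℝ | 0 < G₁ p.1 p.2 - G₂ p.1 p.2 →
        equil (dens a b G₂ p.1) p.2 ≤ equil (dens a b G₁ p.1) p.2} := by
      refine MeasurableSet.imp ?_ ?_
      · exact measurableSet_lt measurable_const (h₁.measurable.sub h₂.measurable)
      · exact measurableSet_le (measurable_equil_dens h₂.measurable)
          (measurable_equil_dens h₁.measurable)
    rw [← Measure.ae_ae_comm hmeas]
    filter_upwards [hdz] with z hz
    exact (source_posPart_nonpos hα h₁ h₂ z).2 hz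
  -- at `y = 0` the flux has a nonpositive integrand, so that the positive part vanishes
  have h0neg : ∀ᵐ ξ ∂μ, max (G₁ 0 ξ - G₂ 0 ξ) 0 = 0 := by
    have hz := hQz 0 le_rfl
    have hz' : ∫ ξ in Icc a b, -(α ξ * max (G₁ 0 ξ - G₂ 0 ξ) 0) = 0 := by
      rw [integral_neg]; simpa [hQ] using hz
    rw [integral_eq_zero_iff_of_nonneg_ae
      (f := fun ξ => -(α ξ * max (G₁ 0 ξ - G₂ 0 ξ) 0)) ?_ (iq 0).neg] at hz'
    · filter_upwards [hz', hα.ne_zero] with ξ hξ hne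
      simpa [hne] using hξ
    · filter_upwards [hin] with ξ hξ
      rcases lt_or_ge 0 (α ξ) with h | h
      · simp [hξ h]
      · simpa using mul_nonpos_of_nonpos_of_nonneg h (le_max_right (G₁ 0 ξ - G₂ 0 ξ) 0)
  -- at these velocities the positive part is bounded by its own primitive, since without
  -- dissipation its source is at least `-(G₁ - G₂)⁺`
  have hneg : ∀ᵐ ξ ∂μ, α ξ < 0 → ∀ y, 0 ≤ y → max (G₁ y ξ - G₂ y ξ) 0 = 0 := by
    filter_upwards [hpos, hsgn, h0neg] with ξ hξ hs h0 hlt y hy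
    refine eq_zero_of_le_integral (C := (-α ξ)⁻¹) hξ.1 (fun z _ => le_max_right _ _) ?_ hy
    intro x hx
    have hE := hξ.2 x hx
    rw [h0, mul_zero, zero_add] at hE
    have n : Measurable fun z => max (G₁ z ξ - G₂ z ξ) 0 := hwm.comp measurable_prodMk_right
    have i1 : IntervalIntegrable (fun z => max (G₁ z ξ - G₂ z ξ) 0) volume 0 x :=
      (intervalIntegrable_const (c := (1 : ℝ))).mono_fun' n.aestronglyMeasurable
        (ae_of_all _ fun z => hwb z ξ)
    have i2 : IntervalIntegrable (fun z => S z ξ) volume 0 x :=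
      (intervalIntegrable_const (c := (2 : ℝ))).mono_fun'
        (hSm.comp measurable_prodMk_right).aestronglyMeasurable (ae_of_all _ fun z => hSb z ξ)
    have hle : -(∫ z in (0 : ℝ)..x, max (G₁ z ξ - G₂ z ξ) 0) ≤ ∫ z in (0 : ℝ)..x, S z ξ := by
      rw [← intervalIntegral.integral_neg, intervalIntegral.integral_of_le hx,
        intervalIntegral.integral_of_le hx]
      refine integral_mono_ae i1.neg.1 i2.1 ?_
      filter_upwards [ae_restrict_of_ae_restrict_of_subset Ioc_subset_Ioi_self hs] with z hz
      simp only [hS]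
      split_ifs with h
      · rw [max_eq_left h.le]; linarith [hz h]
      · rw [max_eq_right (not_lt.1 h)]; simp
    have hαp : 0 < -α ξ := by linarith
    rw [inv_mul_eq_div, le_div_iff₀ hαp]
    simp only [hS] at hle
    linarith
  -- the integrand of the flux is now nonnegative, which gives the positive velocities
  have hall : ∀ y, 0 ≤ y → ∀ᵐ ξ ∂μ, max (G₁ y ξ - G₂ y ξ) 0 = 0 := by
    intro y hy
    have hz := hQz y hy
    simp only [hQ] at hz
    rw [integral_eq_zero_iff_of_nonneg_ae ?_ (iq y)] at hz
    · filter_upwards [hz, hα.ne_zero] with ξ hξ hne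
      simpa [hne] using hξ
    · filter_upwards [hneg] with ξ hξ
      rcases lt_or_ge (α ξ) 0 with h | h
      · simp [hξ h y hy]
      · exact mul_nonneg h (le_max_right _ _)
  intro y hy
  filter_upwards [hall y hy] with ξ hξ
  have := le_max_left (G₁ y ξ - G₂ y ξ) 0
  linarith

/-! ### Strictly compatible states -/

/-- The flux of the equilibrium with density `r`. -/
noncomputable def equilFlux (a : ℝ) (α : ℝ → ℝ) (r : ℝ) : ℝ := ∫ ξ in a..r, α ξ

/-- The condition on the flux, between the boundary state `ρh` and the far state `ρb`, under which
the half-space problem is solvable: `ρb` strictly minimises the flux from below and strictly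
maximises it from above. -/
def StrictlyCompatible (Φ : ℝ → ℝ) (ρh ρb : ℝ) : Prop :=
  (∀ k, ρb < k → k ≤ ρh → Φ k < Φ ρb) ∧ (∀ k, ρh ≤ k → k < ρb → Φ ρb < Φ k)

/-- `G y` tends to the equilibrium with density `ρ` in `L¹` along the filter `l`. -/
def TendsToEquil (a b : ℝ) (G : ℝ → ℝ → ℝ) (l : Filter ℝ) (ρ : ℝ) : Prop :=
  Tendsto (fun y => ∫ ξ in Icc a b, |G y ξ - equil ρ ξ|) l (𝓝 0)

theorem measurable_equil_right (r : ℝ) : Measurable (equil r) :=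
  measurable_equil.comp measurable_prodMk_left

theorem integrable_equil (r : ℝ) : Integrable (equil r) (volume.restrict (Icc a b)) :=
  integrable_Icc_of_bounded (C := 1) (measurable_equil_right r) fun ξ => by
    rw [abs_of_nonneg (equil_mem r ξ).1]; exact (equil_mem r ξ).2

theorem tendsToEquil_equil (k : ℝ) (l : Filter ℝ) : TendsToEquil a b (fun _ => equil k) l k := by
  simpa [TendsToEquil] using tendsto_const_nhds

theorem integral_mul_posPart_equil (hα : IsVelocity a b α) {r s : ℝ} (hr : r ∈ Icc a b)
    (hs : s ∈ Icc a b) (hrs : r ≤ s) :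
    ∫ ξ in Icc a b, α ξ * max (equil s ξ - equil r ξ) 0 = equilFlux a α s - equilFlux a α r := by
  obtain ⟨A, hA⟩ := hα.bounded
  have i : ∀ k, Integrable (fun ξ => α ξ * equil k ξ) (volume.restrict (Icc a b)) := fun k =>
    integrable_Icc_of_bounded (C := A) (hα.measurable.mul (measurable_equil_right k)) fun ξ => by
      rw [abs_mul, abs_of_nonneg (equil_mem k ξ).1]
      exact (mul_le_of_le_one_right (abs_nonneg _) (equil_mem k ξ).2).trans (hA ξ)
  have : ∀ ξ, α ξ * max (equil s ξ - equil r ξ) 0 = α ξ * equil s ξ - α ξ * equil r ξ := by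
    intro ξ
    have := equil_mono ξ hrs
    simp only at this
    rw [max_eq_left (by linarith)]; ring
  simp_rw [this]
  rw [integral_sub (i s) (i r), integral_mul_equil α hs, integral_mul_equil α hr]
  rfl

/-- The flux of the positive part of a difference is continuous in `L¹`. -/
theorem tendsto_flux_posPart {G₁ G₂ : ℝ → ℝ → ℝ} (hα : IsVelocity a b α)
    (m₁ : ∀ y, Integrable (G₁ y) (volume.restrict (Icc a b)))
    (m₂ : ∀ y, Integrable (G₂ y) (volume.restrict (Icc a b)))
    {l : Filter ℝ} {r s : ℝ} (t₁ : TendsToEquil a b G₁ l r) (t₂ : TendsToEquil a b G₂ l s) :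
    Tendsto (fun y => ∫ ξ in Icc a b, α ξ * max (G₁ y ξ - G₂ y ξ) 0) l
      (𝓝 (∫ ξ in Icc a b, α ξ * max (equil r ξ - equil s ξ) 0)) := by
  obtain ⟨A, hA⟩ := hα.bounded
  have hA0 : 0 ≤ A := (abs_nonneg _).trans (hA 0)
  have im : ∀ {f : ℝ → ℝ}, Integrable f (volume.restrict (Icc a b)) →
      Integrable (fun ξ => α ξ * f ξ) (volume.restrict (Icc a b)) := fun hf =>
    hf.bdd_mul hα.measurable.aestronglyMeasurable (ae_of_all _ hA)
  rw [tendsto_iff_norm_sub_tendsto_zero]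
  have hlim : Tendsto (fun y => A * ((∫ ξ in Icc a b, |G₁ y ξ - equil r ξ|)
      + ∫ ξ in Icc a b, |G₂ y ξ - equil s ξ|)) l (𝓝 0) := by
    simpa using (t₁.add t₂).const_mul A
  refine squeeze_zero (fun y => norm_nonneg _) (fun y => ?_) hlim
  have j₁ : Integrable (fun ξ => |G₁ y ξ - equil r ξ|) (volume.restrict (Icc a b)) :=
    ((m₁ y).sub (integrable_equil r)).abs
  have j₂ : Integrable (fun ξ => |G₂ y ξ - equil s ξ|) (volume.restrict (Icc a b)) :=
    ((m₂ y).sub (integrable_equil s)).abs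
  have p₁ : Integrable (fun ξ => α ξ * max (G₁ y ξ - G₂ y ξ) 0) (volume.restrict (Icc a b)) :=
    im ((m₁ y).sub (m₂ y)).pos_part
  have p₂ : Integrable (fun ξ => α ξ * max (equil r ξ - equil s ξ) 0)
      (volume.restrict (Icc a b)) :=
    im ((integrable_equil r).sub (integrable_equil s)).pos_part
  rw [← integral_sub p₁ p₂]
  refine (norm_integral_le_integral_norm _).trans ?_
  rw [← integral_add j₁ j₂, ← integral_const_mul]
  refine integral_mono_of_nonneg (ae_of_all _ fun ξ => norm_nonneg _)
    ((j₁.add j₂).const_mul A) (ae_of_all _ fun ξ => ?_)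
  simp only [Real.norm_eq_abs]
  rw [← mul_sub, abs_mul]
  refine mul_le_mul (hA ξ) ?_ (abs_nonneg _) hA0
  refine (abs_max_sub_max_le_abs _ _ _).trans ?_
  have : G₁ y ξ - G₂ y ξ - (equil r ξ - equil s ξ) = (G₁ y ξ - equil r ξ) - (G₂ y ξ - equil s ξ) := by
    ring
  rw [this]
  exact abs_sub _ _

/-- Solutions of the half-space problem are determined by their incoming boundary values and by
their limit at infinity. -/
theorem mild_unique {G₁ G₂ : ℝ → ℝ → ℝ} (hα : IsVelocity a b α)
    (h₁ : IsMild a b α G₁) (h₂ : IsMild a b α G₂)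
    (hin : ∀ᵐ ξ ∂(volume.restrict (Icc a b)), 0 < α ξ → G₁ 0 ξ = G₂ 0 ξ)
    {l : Filter ℝ} [l.NeBot] (hl : l ≤ atTop) {ρ : ℝ}
    (t₁ : TendsToEquil a b G₁ l ρ) (t₂ : TendsToEquil a b G₂ l ρ) {y : ℝ} (hy : 0 ≤ y) :
    ∀ᵐ ξ ∂(volume.restrict (Icc a b)), G₁ y ξ = G₂ y ξ := by
  have c₁ := mild_comparison hα h₁ h₂ (hin.mono fun ξ h hp => (h hp).le) hl
    (tendsto_flux_posPart hα h₁.integrable h₂.integrable t₁ t₂) (by simp) hy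
  have c₂ := mild_comparison hα h₂ h₁ (hin.mono fun ξ h hp => (h hp).ge) hl
    (tendsto_flux_posPart hα h₂.integrable h₁.integrable t₂ t₁) (by simp) hy
  filter_upwards [c₁, c₂] with ξ e₁ e₂ using le_antisymm e₁ e₂

/-- If the half-space problem with incoming equilibrium `ρh` and limit `ρb` is solvable, the two
states are strictly compatible: otherwise the comparison with a constant equilibrium between the
two states separates the solution from its limit. -/
theorem strictlyCompatible_of_mild {G : ℝ → ℝ → ℝ} (hα : IsVelocity a b α)
    (hG : IsMild a b α G) {ρh ρb : ℝ} (hh : ρh ∈ Icc a b) (hb : ρb ∈ Icc a b)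
    (hin : ∀ᵐ ξ ∂(volume.restrict (Icc a b)), 0 < α ξ → G 0 ξ = equil ρh ξ)
    {l : Filter ℝ} [l.NeBot] (hl : l ≤ atTop) (ht : TendsToEquil a b G l ρb) :
    StrictlyCompatible (equilFlux a α) ρh ρb := by
  have hy : ∀ᶠ y in l, 0 ≤ y := hl (eventually_ge_atTop 0)
  have iG := hG.integrable
  constructor
  · intro k hk hkh
    by_contra hcon
    push Not at hcon
    have hkm : k ∈ Icc a b := ⟨hb.1.trans hk.le, hkh.trans hh.2⟩
    have hq := tendsto_flux_posPart hα (fun _ => integrable_equil k) iG (tendsToEquil_equil k l) ht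
    have hcmp := fun (y : ℝ) (h : 0 ≤ y) => mild_comparison hα (isMild_equil hkm) hG
      (hin.mono fun ξ h hp => by rw [h hp]; exact equil_mono ξ hkh) hl hq
      (by rw [integral_mul_posPart_equil hα hb hkm hk.le]; linarith) h
    -- `G` lies above the equilibrium `k`, hence away from the equilibrium `ρb`
    have hge : ∀ᶠ y in l, k - ρb ≤ ∫ ξ in Icc a b, |G y ξ - equil ρb ξ| := by
      filter_upwards [hy] with y h
      have e : k - ρb = ∫ ξ in Icc a b, (equil k ξ - equil ρb ξ) := by
        rw [integral_sub (integrable_equil k) (integrable_equil ρb), integral_equil hkm,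
          integral_equil hb]; ring
      rw [e]
      refine integral_mono_ae ((integrable_equil k).sub (integrable_equil ρb))
        ((iG y).sub (integrable_equil ρb)).abs ?_
      filter_upwards [hcmp y h] with ξ hξ
      exact le_trans (by linarith) (le_abs_self _)
    have := ge_of_tendsto ht hge
    linarith
  · intro k hkh hk
    by_contra hcon
    push Not at hcon
    have hkm : k ∈ Icc a b := ⟨hh.1.trans hkh, hk.le.trans hb.2⟩
    have hq := tendsto_flux_posPart hα iG (fun _ => integrable_equil k) ht (tendsToEquil_equil k l)
    have hcmp := fun (y : ℝ) (h : 0 ≤ y) => mild_comparison hα hG (isMild_equil hkm)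
      (hin.mono fun ξ h hp => by rw [h hp]; exact equil_mono ξ hkh) hl hq
      (by rw [integral_mul_posPart_equil hα hkm hb hk.le]; linarith) h
    -- `G` lies below the equilibrium `k`, hence away from the equilibrium `ρb`
    have hge : ∀ᶠ y in l, ρb - k ≤ ∫ ξ in Icc a b, |G y ξ - equil ρb ξ| := by
      filter_upwards [hy] with y h
      have e : ρb - k = ∫ ξ in Icc a b, (equil ρb ξ - equil k ξ) := by
        rw [integral_sub (integrable_equil ρb) (integrable_equil k), integral_equil hkm,
          integral_equil hb]; ring
      rw [e]
      refine integral_mono_ae ((integrable_equil ρb).sub (integrable_equil k))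
        ((iG y).sub (integrable_equil ρb)).abs ?_
      filter_upwards [hcmp y h] with ξ hξ
      exact le_trans (by linarith) (neg_le_abs _)
    have := ge_of_tendsto ht hge
    linarith

/-- Integrated form of the equation for a given source `h`. -/
theorem flux_sub_eq {G h : ℝ → ℝ → ℝ} (hα : IsVelocity a b α)
    (hGm : Measurable (Function.uncurry G)) (hGr : ∀ y ξ, G y ξ ∈ Icc (0 : ℝ) 1)
    (hhm : Measurable (Function.uncurry h)) (hhr : ∀ y ξ, h y ξ ∈ Icc (0 : ℝ) 1) {y : ℝ}
    (heq : ∀ᵐ ξ ∂(volume.restrict (Icc a b)),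
      α ξ * G y ξ = α ξ * G 0 ξ + ∫ z in (0 : ℝ)..y, (h z ξ - G z ξ)) :
    ∫ ξ in Icc a b, α ξ * G y ξ = (∫ ξ in Icc a b, α ξ * G 0 ξ)
      + ∫ z in (0 : ℝ)..y, (dens a b h z - dens a b G z) := by
  obtain ⟨A, hA⟩ := hα.bounded
  have iG : ∀ y, Integrable (G y) (volume.restrict (Icc a b)) := fun y =>
    integrable_Icc_of_bounded (C := 1) (hGm.comp measurable_prodMk_left) fun ξ => by
      rw [abs_of_nonneg (hGr y ξ).1]; exact (hGr y ξ).2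
  have ih : ∀ y, Integrable (h y) (volume.restrict (Icc a b)) := fun y =>
    integrable_Icc_of_bounded (C := 1) (hhm.comp measurable_prodMk_left) fun ξ => by
      rw [abs_of_nonneg (hhr y ξ).1]; exact (hhr y ξ).2
  have iq : ∀ y, Integrable (fun ξ => α ξ * G y ξ) (volume.restrict (Icc a b)) := fun y =>
    (iG y).bdd_mul hα.measurable.aestronglyMeasurable (ae_of_all _ hA)
  have hkm : Measurable (Function.uncurry fun z ξ => h z ξ - G z ξ) := hhm.sub hGm
  have hkb : ∀ z ξ, |h z ξ - G z ξ| ≤ 1 := fun z ξ => sub_mem_Icc (hhr z ξ) (hGr z ξ)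
  have iS : Integrable (fun ξ => ∫ z in (0 : ℝ)..y, (h z ξ - G z ξ))
      (volume.restrict (Icc a b)) := by
    refine (integrable_const (1 * |y - 0|)).mono' ?_ (ae_of_all _ fun ξ => ?_)
    · have : Measurable fun ξ => ∫ z in (0 : ℝ)..y, (h z ξ - G z ξ) := by
        simp only [intervalIntegral]
        exact (hkm.stronglyMeasurable.integral_prod_left'.measurable).sub
          (hkm.stronglyMeasurable.integral_prod_left'.measurable)
      exact this.aestronglyMeasurable
    · exact intervalIntegral.norm_integral_le_of_norm_le_const fun z _ => hkb z ξ
  rw [integral_congr_ae heq, integral_add (iq 0) iS, integral_intervalIntegral_swap hkm hkb]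
  congr 2
  ext z
  rw [integral_sub (ih z) (iG z)]
  simp only [dens]; ring

theorem tendsto_flux {G : ℝ → ℝ → ℝ} (hα : IsVelocity a b α)
    (hi : ∀ y, Integrable (G y) (volume.restrict (Icc a b))) (h0 : ∀ y ξ, 0 ≤ G y ξ)
    {l : Filter ℝ} {ρ : ℝ} (hρ : ρ ∈ Icc a b) (ht : TendsToEquil a b G l ρ) :
    Tendsto (fun y => ∫ ξ in Icc a b, α ξ * G y ξ) l (𝓝 (equilFlux a α ρ)) := by
  -- compare with the zero density, which is the equilibrium `a - 1` on `[a, b]`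
  have h1 := tendsto_flux_posPart hα hi (fun _ => integrable_zero _ _ _) ht
    (s := a - 1) (G₂ := fun _ _ => 0) (by
      have : ∀ ξ ∈ Icc a b, |0 - equil (a - 1) ξ| = 0 := by
        intro ξ hξ
        have : ¬ ξ ≤ a - 1 := by linarith [hξ.1]
        simp [equil, this]
      simp only [TendsToEquil]
      rw [setIntegral_congr_fun measurableSet_Icc this]
      simpa using tendsto_const_nhds)
  have h2 : ∫ ξ in Icc a b, α ξ * max (equil ρ ξ - equil (a - 1) ξ) 0 = equilFlux a α ρ := by
    rw [equilFlux, ← integral_mul_equil α hρ]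
    refine setIntegral_congr_fun measurableSet_Icc fun ξ hξ => ?_
    have : ¬ ξ ≤ a - 1 := by linarith [hξ.1]
    have e : equil (a - 1) ξ = 0 := by simp [equil, this]
    simp only [e, sub_zero, max_eq_left (equil_mem ρ ξ).1]
  rw [h2] at h1
  refine h1.congr fun y => ?_
  congr 1
  ext ξ
  rw [sub_zero, max_eq_left (h0 y ξ)]

/-- The flux of a solution is the flux of its limit. -/
theorem mild_flux {G : ℝ → ℝ → ℝ} (hα : IsVelocity a b α) (hG : IsMild a b α G)
    {l : Filter ℝ} [l.NeBot] (hl : l ≤ atTop) {ρ : ℝ} (hρ : ρ ∈ Icc a b)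
    (ht : TendsToEquil a b G l ρ) :
    ∫ ξ in Icc a b, α ξ * G 0 ξ = equilFlux a α ρ := by
  have hc : ∀ y, 0 ≤ y → ∫ ξ in Icc a b, α ξ * G y ξ = ∫ ξ in Icc a b, α ξ * G 0 ξ := by
    intro y hy
    have hm : Measurable (Function.uncurry fun z ξ => equil (dens a b G z) ξ) :=
      measurable_equil_dens hG.measurable
    rw [flux_sub_eq (y := y) hα hG.measurable hG.range hm (fun z ξ => equil_mem _ _)
      (hG.mild.mono fun ξ h => h y hy)]
    have : ∀ z, dens a b (fun z ξ => equil (dens a b G z) ξ) z = dens a b G z := fun z => by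
      simp only [dens]
      have := integral_equil (hG.dens_mem hα z)
      simp only [dens] at this
      rw [this]; ring
    simp [this]
  refine (tendsto_nhds_unique ((tendsto_flux hα hG.integrable (fun y ξ => (hG.range y ξ).1) hρ
    ht).congr' ?_) tendsto_const_nhds).symm
  filter_upwards [hl (eventually_ge_atTop 0)] with y hy using hc y hy

/-- Change of the length scale. -/
theorem IsMild.scale {G : ℝ → ℝ → ℝ} (hG : IsMild a b α G) {c : ℝ} (hc : 0 < c) :
    IsMild a b (fun ξ => c * α ξ) fun y => G (y / c) where
  measurable := hG.measurable.comp ((measurable_fst.div_const c).prodMk measurable_snd)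
  range y ξ := hG.range _ _
  mild := by
    filter_upwards [hG.mild] with ξ h y hy
    have e : (∫ z in (0 : ℝ)..y, (equil (dens a b (fun y => G (y / c)) z) ξ - G (z / c) ξ))
        = c * ∫ z in (0 : ℝ)..(y / c), (equil (dens a b G z) ξ - G z ξ) := by
      have := intervalIntegral.integral_comp_div (a := 0) (b := y)
        (fun z => equil (dens a b G z) ξ - G z ξ) hc.ne'
      rw [zero_div, smul_eq_mul] at this
      rw [← this]
      rfl
    rw [e, zero_div, mul_assoc, mul_assoc, h (y / c) (div_nonneg hy hc.le)]
    ring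

theorem TendsToEquil.scale {G : ℝ → ℝ → ℝ} {ρ : ℝ} (h : TendsToEquil a b G atTop ρ) {c : ℝ}
    (hc : 0 < c) : TendsToEquil a b (fun y => G (y / c)) atTop ρ :=
  h.comp (tendsto_id.atTop_div_const hc)

theorem IsVelocity.scale (hα : IsVelocity a b α) {c : ℝ} (hc : 0 < c) :
    IsVelocity a b fun ξ => c * α ξ where
  lt := hα.lt
  measurable := hα.measurable.const_mul c
  bounded := by
    obtain ⟨A, hA⟩ := hα.bounded
    exact ⟨c * A, fun ξ => by rw [abs_mul, abs_of_pos hc]; exact mul_le_mul_of_nonneg_left (hA ξ) hc.le⟩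
  ne_zero := hα.ne_zero.mono fun ξ h => mul_ne_zero hc.ne' h

/-! ### Averages along characteristics -/

/-- Fubini's theorem for a primitive against the exponential weight. -/
theorem integral_exp_primitive {k : ℝ → ℝ} {C : ℝ} (hk : Measurable k) (hC : ∀ r, |k r| ≤ C) :
    IntegrableOn (fun s => Real.exp (-s) * ∫ r in (0 : ℝ)..s, k r) (Ioi 0) ∧
    ∫ s in Ioi (0 : ℝ), Real.exp (-s) * ∫ r in (0 : ℝ)..s, k r
      = ∫ r in Ioi (0 : ℝ), Real.exp (-r) * k r := by
  have hC0 : 0 ≤ C := (abs_nonneg _).trans (hC 0)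
  set F : ℝ → ℝ → ℝ := fun s r => if r ≤ s then Real.exp (-s) * k r else 0 with hF
  have hFm : Measurable (Function.uncurry F) := by
    refine Measurable.ite (measurableSet_le measurable_snd measurable_fst) ?_ measurable_const
    exact (Real.measurable_exp.comp measurable_fst.neg).mul (hk.comp measurable_snd)
  have he : IntegrableOn (fun s : ℝ => Real.exp (-(1 / 2) * s)) (Ioi 0) :=
    integrableOn_exp_mul_Ioi (by norm_num) 0
  have hFi : Integrable (Function.uncurry F)
      ((volume.restrict (Ioi (0 : ℝ))).prod (volume.restrict (Ioi (0 : ℝ)))) := by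
    refine ((he.mul_prod he).const_mul C).mono' hFm.aestronglyMeasurable
      (ae_of_all _ fun p => ?_)
    simp only [Function.uncurry, hF]
    split_ifs with h
    · rw [Real.norm_eq_abs, abs_mul, Real.abs_exp, mul_comm, ← Real.exp_add]
      refine mul_le_mul (hC _) (Real.exp_le_exp.2 (by linarith)) (Real.exp_pos _).le hC0
    · simp; positivity
  have e1 : ∀ s ∈ Ioi (0 : ℝ), ∫ r in Ioi (0 : ℝ), F s r = Real.exp (-s) * ∫ r in (0 : ℝ)..s, k r := by
    intro s hs
    have : F s = (Iic s).indicator fun r => Real.exp (-s) * k r := by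
      ext r; by_cases h : r ≤ s <;> simp [hF, h]
    rw [this, integral_indicator measurableSet_Iic, Measure.restrict_restrict measurableSet_Iic,
      inter_comm, Ioi_inter_Iic, integral_const_mul, intervalIntegral.integral_of_le (le_of_lt hs)]
  have e2 : ∀ r ∈ Ioi (0 : ℝ), ∫ s in Ioi (0 : ℝ), F s r = Real.exp (-r) * k r := by
    intro r hr
    have : (fun s => F s r) = (Ici r).indicator fun s => Real.exp (-s) * k r := by
      ext s; by_cases h : r ≤ s <;> simp [hF, h]
    rw [this, integral_indicator measurableSet_Ici, Measure.restrict_restrict measurableSet_Ici,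
      inter_eq_left.2 (Ici_subset_Ioi.2 hr), integral_mul_const,
      integral_Ici_eq_integral_Ioi, integral_exp_neg_Ioi]
  constructor
  · have := hFi.integral_prod_left
    refine (integrable_congr ?_).1 this
    filter_upwards [ae_restrict_mem measurableSet_Ioi] with s hs using e1 s hs
  · rw [← setIntegral_congr_fun measurableSet_Ioi e1, integral_integral_swap hFi,
      setIntegral_congr_fun measurableSet_Ioi e2]

/-- The solution at `(y, ξ)` of the free transport equation with relaxation to the equilibrium with
density `ρ`: the average of the equilibrium along the backward characteristic. -/
noncomputable def charAvg (α ρ : ℝ → ℝ) (y ξ : ℝ) : ℝ :=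
  ∫ s in Ioi (0 : ℝ), Real.exp (-s) * equil (ρ (y - α ξ * s)) ξ

theorem integrableOn_exp_neg : IntegrableOn (fun s : ℝ => Real.exp (-s)) (Ioi 0) := by
  simpa using integrableOn_exp_mul_Ioi (a := -1) (by norm_num) 0

theorem integrableOn_exp_mul {h : ℝ → ℝ} {C : ℝ} (hm : Measurable h) (hC : ∀ s, |h s| ≤ C) :
    IntegrableOn (fun s => Real.exp (-s) * h s) (Ioi 0) :=
  integrableOn_exp_neg.mul_bdd hm.aestronglyMeasurable (ae_of_all _ hC)

theorem abs_equil_le (r ξ : ℝ) : |equil r ξ| ≤ 1 := by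
  rw [abs_of_nonneg (equil_mem r ξ).1]; exact (equil_mem r ξ).2

section
variable {ρ : ℝ → ℝ}

theorem measurable_equil_comp (hρ : Measurable ρ) (ξ : ℝ) : Measurable fun z => equil (ρ z) ξ :=
  measurable_equil.comp (hρ.prodMk measurable_const)

theorem integrableOn_charAvg (hρ : Measurable ρ) (y ξ : ℝ) :
    IntegrableOn (fun s => Real.exp (-s) * equil (ρ (y - α ξ * s)) ξ) (Ioi 0) :=
  integrableOn_exp_mul (C := 1)
    ((measurable_equil_comp hρ ξ).comp (measurable_const.sub (measurable_id.const_mul _)))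
    fun _ => abs_equil_le _ _

theorem measurable_charAvg (hα : Measurable α) (hρ : Measurable ρ) :
    Measurable (Function.uncurry (charAvg α ρ)) := by
  have : Measurable fun q : (ℝ × ℝ) × ℝ =>
      Real.exp (-q.2) * equil (ρ (q.1.1 - α q.1.2 * q.2)) q.1.2 := by
    have h1 : Measurable fun q : (ℝ × ℝ) × ℝ => q.1.1 - α q.1.2 * q.2 :=
      (measurable_fst.comp measurable_fst).sub
        ((hα.comp (measurable_snd.comp measurable_fst)).mul measurable_snd)
    have h2 : Measurable fun q : (ℝ × ℝ) × ℝ => (ρ (q.1.1 - α q.1.2 * q.2), q.1.2) :=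
      (hρ.comp h1).prodMk (measurable_snd.comp measurable_fst)
    exact (Real.measurable_exp.comp measurable_snd.neg).mul (measurable_equil.comp h2)
  exact (this.stronglyMeasurable.integral_prod_right
    (ν := volume.restrict (Ioi (0 : ℝ)))).measurable

theorem charAvg_mono {ρ' : ℝ → ℝ} (hρ : Measurable ρ) (hρ' : Measurable ρ') {y y' ξ : ℝ}
    (h : ∀ s, 0 < s → ρ (y - α ξ * s) ≤ ρ' (y' - α ξ * s)) :
    charAvg α ρ y ξ ≤ charAvg α ρ' y' ξ := by
  refine setIntegral_mono_on (integrableOn_charAvg hρ y ξ) (integrableOn_charAvg hρ' y' ξ)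
    measurableSet_Ioi fun s hs => ?_
  exact mul_le_mul_of_nonneg_left (equil_mono ξ (h s hs)) (Real.exp_pos _).le

theorem charAvg_of_const {y ξ r : ℝ} (h : ∀ s, 0 < s → ρ (y - α ξ * s) = r) :
    charAvg α ρ y ξ = equil r ξ := by
  unfold charAvg
  rw [setIntegral_congr_fun (g := fun s => Real.exp (-s) * equil r ξ) measurableSet_Ioi
    (fun s hs => by simp only [h s hs]), integral_mul_const, integral_exp_neg_Ioi]
  simp

theorem charAvg_mem (hρ : Measurable ρ) (y ξ : ℝ) : charAvg α ρ y ξ ∈ Icc (0 : ℝ) 1 := by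
  constructor
  · exact integral_nonneg fun s => mul_nonneg (Real.exp_pos _).le (equil_mem _ _).1
  · have : charAvg α ρ y ξ ≤ ∫ s in Ioi (0 : ℝ), Real.exp (-s) := by
      refine setIntegral_mono_on (integrableOn_charAvg hρ y ξ) integrableOn_exp_neg
        measurableSet_Ioi fun s _ => ?_
      exact mul_le_of_le_one_right (Real.exp_pos _).le (equil_mem _ _).2
    rwa [integral_exp_neg_Ioi_zero] at this

/-- The characteristic average solves the transport equation, whatever the sign of the velocity. -/
theorem charAvg_mild (hρ : Measurable ρ) (y ξ : ℝ) :
    α ξ * charAvg α ρ y ξ = α ξ * charAvg α ρ 0 ξ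
      + ∫ z in (0 : ℝ)..y, (equil (ρ z) ξ - charAvg α ρ z ξ) := by
  set c := α ξ with hc
  set h : ℝ → ℝ := fun z => equil (ρ z) ξ with hh
  have hm : Measurable h := measurable_equil_comp hρ ξ
  have hb : ∀ z, |h z| ≤ 1 := fun z => abs_equil_le _ _
  have hi : ∀ u v, IntervalIntegrable h volume u v := fun u v =>
    (intervalIntegrable_const (c := (1 : ℝ))).mono_fun' hm.aestronglyMeasurable
      (ae_of_all _ fun z => by simpa using hb z)
  -- both sides are averages over `s`, with the weight `exp (-s)`, of integrals of `h` over intervals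
  -- with the end points `-c s`, `0`, `y - c s` and `y`
  have key : ∀ x, IntegrableOn (fun s => Real.exp (-s) * ∫ z in (x - c * s)..x, h z) (Ioi 0) ∧
      c * charAvg α ρ x ξ = ∫ s in Ioi (0 : ℝ), Real.exp (-s) * ∫ z in (x - c * s)..x, h z := by
    intro x
    have hkm : Measurable fun r => c * h (x - c * r) :=
      (hm.comp (measurable_const.sub (measurable_id.const_mul c))).const_mul c
    have hkb : ∀ r, |c * h (x - c * r)| ≤ |c| := fun r => by
      rw [abs_mul]; exact mul_le_of_le_one_right (abs_nonneg _) (hb _)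
    have h1 := integral_exp_primitive hkm hkb
    have e : ∀ s : ℝ, ∫ r in (0 : ℝ)..s, c * h (x - c * r) = ∫ z in (x - c * s)..x, h z := by
      intro s
      rw [intervalIntegral.integral_const_mul, intervalIntegral.mul_integral_comp_sub_mul]
      simp
    simp only [e] at h1
    refine ⟨h1.1, ?_⟩
    rw [h1.2, charAvg, ← integral_const_mul]
    congr 1
    ext s
    simp only [hh, ← hc]; ring
  have hswap : IntegrableOn (fun s => Real.exp (-s) * ∫ z in (-(c * s))..(y - c * s), h z) (Ioi 0) ∧
      ∫ z in (0 : ℝ)..y, charAvg α ρ z ξ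
        = ∫ s in Ioi (0 : ℝ), Real.exp (-s) * ∫ z in (-(c * s))..(y - c * s), h z := by
    have e : ∀ s : ℝ, ∫ z in (0 : ℝ)..y, Real.exp (-s) * h (z - c * s)
        = Real.exp (-s) * ∫ z in (-(c * s))..(y - c * s), h z := by
      intro s
      rw [intervalIntegral.integral_const_mul, intervalIntegral.integral_comp_sub_right]
      simp
    have : IsFiniteMeasure (volume.restrict (uIoc 0 y)) :=
      isFiniteMeasure_restrict.2 (by simp [uIoc])
    have hmm : Measurable fun p : ℝ × ℝ => Real.exp (-p.2) * h (p.1 - c * p.2) :=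
      (Real.measurable_exp.comp measurable_snd.neg).mul
        (hm.comp (measurable_fst.sub (measurable_snd.const_mul c)))
    have hint : Integrable (Function.uncurry fun z s => Real.exp (-s) * h (z - c * s))
        ((volume.restrict (uIoc 0 y)).prod (volume.restrict (Ioi (0 : ℝ)))) := by
      refine (Integrable.mul_prod (integrable_const (1 : ℝ)) integrableOn_exp_neg).mono'
        hmm.aestronglyMeasurable (ae_of_all _ fun p => ?_)
      simp only [Function.uncurry, Real.norm_eq_abs, abs_mul, Real.abs_exp, one_mul]
      exact mul_le_of_le_one_right (Real.exp_pos _).le (hb _)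
    constructor
    · have h2 := hint.swap.integral_prod_left
      have h3 : IntegrableOn (fun s => ∫ z in (0 : ℝ)..y, Real.exp (-s) * h (z - c * s))
          (Ioi 0) := by
        simp only [intervalIntegral.intervalIntegral_eq_integral_uIoc, smul_eq_mul]
        exact Integrable.const_mul h2 (if (0 : ℝ) ≤ y then 1 else -1)
      simpa only [e] using h3
    · have := intervalIntegral_integral_swap hint
      simp only [e] at this
      rw [← this]
      rfl
  have hAm : IntervalIntegrable (fun z => charAvg α ρ z ξ) volume 0 y := by
    have hcm : Measurable fun z => charAvg α ρ z ξ :=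
      (measurable_charAvg (α := fun _ => c) measurable_const hρ).comp
        (measurable_prodMk_right (y := ξ))
    exact (intervalIntegrable_const (c := (1 : ℝ))).mono_fun' hcm.aestronglyMeasurable
      (ae_of_all _ fun z => by
        have := charAvg_mem (α := α) hρ z ξ
        simpa [abs_of_nonneg this.1] using this.2)
  rw [intervalIntegral.integral_sub (hi 0 y) hAm]
  have e1 : (∫ z in (0 : ℝ)..y, h z) = ∫ s in Ioi (0 : ℝ), Real.exp (-s) * ∫ z in (0 : ℝ)..y, h z := by
    rw [integral_mul_const, integral_exp_neg_Ioi]; simp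
  have i1 : IntegrableOn (fun s => Real.exp (-s) * ∫ z in (0 : ℝ)..y, h z) (Ioi 0) :=
    integrableOn_exp_neg.mul_const _
  rw [← sub_eq_zero]
  have e2 : c * charAvg α ρ y ξ - (c * charAvg α ρ 0 ξ + ((∫ z in (0 : ℝ)..y, h z)
      - ∫ z in (0 : ℝ)..y, charAvg α ρ z ξ)) =
      (c * charAvg α ρ y ξ + ∫ z in (0 : ℝ)..y, charAvg α ρ z ξ)
        - (c * charAvg α ρ 0 ξ + ∫ z in (0 : ℝ)..y, h z) := by ring
  rw [e2, (key y).2, (key 0).2, hswap.2, e1, ← integral_add (key y).1 hswap.1,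
    ← integral_add (key 0).1 i1, sub_eq_zero]
  congr 1
  ext s
  rw [← mul_add, ← mul_add, zero_sub, add_comm,
    intervalIntegral.integral_add_adjacent_intervals (hi _ _) (hi _ _),
    intervalIntegral.integral_add_adjacent_intervals (hi _ _) (hi _ _)]

end

/-! ### Existence for the half-space problem -/

theorem tendsto_equil_of_le {ι : Type*} {l : Filter ι} {u : ι → ℝ} {r : ℝ} (ξ : ℝ)
    (hu : Tendsto u l (𝓝 r)) (hle : ∀ i, r ≤ u i) :
    Tendsto (fun i => equil (u i) ξ) l (𝓝 (equil r ξ)) := by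
  rcases le_or_gt ξ r with h | h
  · have : (fun i => equil (u i) ξ) = fun _ => equil r ξ := by
      ext i; simp [equil, h, h.trans (hle i)]
    rw [this]; exact tendsto_const_nhds
  · refine tendsto_const_nhds.congr' ?_
    filter_upwards [hu.eventually (gt_mem_nhds h)] with i hi
    simp [equil, not_le.2 hi, not_le.2 h]

theorem tendsto_equil_of_ne {ι : Type*} {l : Filter ι} {u : ι → ℝ} {r ξ : ℝ}
    (hu : Tendsto u l (𝓝 r)) (hne : ξ ≠ r) :
    Tendsto (fun i => equil (u i) ξ) l (𝓝 (equil r ξ)) := by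
  refine tendsto_const_nhds.congr' ?_
  rcases lt_or_gt_of_ne hne with h | h
  · filter_upwards [hu.eventually (lt_mem_nhds h)] with i hi
    simp [equil, hi.le, h.le]
  · filter_upwards [hu.eventually (gt_mem_nhds h)] with i hi
    simp [equil, not_le.2 hi, not_le.2 h]

/-- Dominated convergence for characteristic averages. -/
theorem tendsto_charAvg {ι : Type*} {l : Filter ι} [l.IsCountablyGenerated] {ρ : ι → ℝ → ℝ}
    {y : ι → ℝ} {ξ : ℝ} {f : ℝ → ℝ} (hρ : ∀ i, Measurable (ρ i))
    (h : ∀ s, 0 < s → Tendsto (fun i => equil (ρ i (y i - α ξ * s)) ξ) l (𝓝 (f s))) :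
    Tendsto (fun i => charAvg α (ρ i) (y i) ξ) l (𝓝 (∫ s in Ioi (0 : ℝ), Real.exp (-s) * f s)) := by
  refine tendsto_integral_filter_of_dominated_convergence (fun s => Real.exp (-s))
    (Eventually.of_forall fun i => (integrableOn_charAvg (hρ i) (y i) ξ).aestronglyMeasurable)
    (Eventually.of_forall fun i => ae_of_all _ fun s => ?_) integrableOn_exp_neg ?_
  · rw [Real.norm_eq_abs, abs_mul, Real.abs_exp]
    exact mul_le_of_le_one_right (Real.exp_pos _).le (abs_equil_le _ _)
  · filter_upwards [ae_restrict_mem measurableSet_Ioi] with s hs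
    exact (h s hs).const_mul _

theorem tendsToEquil_charAvg (hα : IsVelocity a b α) {ρ : ℝ → ℝ} (hρ : Measurable ρ) {r : ℝ}
    (hr : Tendsto ρ atTop (𝓝 r)) : TendsToEquil a b (charAvg α ρ) atTop r := by
  have hm := measurable_charAvg hα.measurable hρ
  have h0 : (∫ ξ in Icc a b, (0 : ℝ)) = 0 := by simp
  rw [TendsToEquil, ← h0]
  refine tendsto_integral_filter_of_dominated_convergence (fun _ => 1)
    (Eventually.of_forall fun y => ?_) (Eventually.of_forall fun y => ae_of_all _ fun ξ => ?_)
    (integrable_const _) ?_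
  · exact (((hm.comp measurable_prodMk_left).sub (measurable_equil_right r)).abs).aestronglyMeasurable
  · rw [Real.norm_eq_abs, abs_abs]; exact sub_mem_Icc (charAvg_mem hρ y ξ) (equil_mem r ξ)
  · have hne : ∀ᵐ ξ ∂(volume.restrict (Icc a b)), ξ ≠ r :=
      ae_restrict_of_ae (Measure.ae_ne volume r)
    filter_upwards [hne] with ξ hξ
    have h1 := tendsto_charAvg (α := α) (l := atTop) (ρ := fun _ : ℝ => ρ) (y := fun y => y)
      (ξ := ξ) (f := fun _ => equil r ξ) (fun _ => hρ) (fun s _ => tendsto_equil_of_ne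
        (hr.comp (tendsto_atTop_add_const_right _ _ tendsto_id)) hξ)
    rw [integral_mul_const, integral_exp_neg_Ioi_zero, one_mul] at h1
    simpa using (h1.sub_const (equil r ξ)).abs

theorem integrable_of_mem {G : ℝ → ℝ → ℝ} (hm : Measurable (Function.uncurry G))
    (hr : ∀ y ξ, G y ξ ∈ Icc (0 : ℝ) 1) (y : ℝ) : Integrable (G y) (volume.restrict (Icc a b)) :=
  integrable_Icc_of_bounded (C := 1) (hm.comp measurable_prodMk_left) fun ξ => by
    rw [abs_of_nonneg (hr y ξ).1]; exact (hr y ξ).2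

theorem TendsToEquil.dens {G : ℝ → ℝ → ℝ} {l : Filter ℝ} {r : ℝ}
    (hi : ∀ y, Integrable (G y) (volume.restrict (Icc a b))) (hr : r ∈ Icc a b)
    (h : TendsToEquil a b G l r) : Tendsto (dens a b G) l (𝓝 r) := by
  rw [tendsto_iff_norm_sub_tendsto_zero]
  refine squeeze_zero (fun y => norm_nonneg _) (fun y => ?_) h
  have : BGKNetwork.dens a b G y - r = ∫ ξ in Icc a b, (G y ξ - equil r ξ) := by
    rw [integral_sub (hi y) (integrable_equil r), integral_equil hr]
    simp only [BGKNetwork.dens]; ring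
  rw [this]
  exact norm_integral_le_integral_norm _

theorem dens_mono {G G' : ℝ → ℝ → ℝ} {y y' : ℝ}
    (hi : Integrable (G y) (volume.restrict (Icc a b)))
    (hi' : Integrable (G' y') (volume.restrict (Icc a b))) (h : ∀ ξ, G y ξ ≤ G' y' ξ) :
    dens a b G y ≤ dens a b G' y' :=
  add_le_add_right (integral_mono hi hi' h) a

theorem dens_equil {r : ℝ} (hr : r ∈ Icc a b) (y : ℝ) : dens a b (fun _ => equil r) y = r := by
  simp only [dens, integral_equil hr]; ring

/-- Monotone density profiles on the line which equal `ρh` on `y ≤ 0` and lie below `ρb`. -/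
structure IsProfile (ρh ρb : ℝ) (ρ : ℝ → ℝ) : Prop where
  mono : Monotone ρ
  mem : ∀ y, ρ y ∈ Icc ρh ρb
  left : ∀ y, y ≤ 0 → ρ y = ρh

/-- One step of the monotone iteration: the density, on `y > 0`, of the characteristic average. -/
noncomputable def densStep (a b : ℝ) (α : ℝ → ℝ) (ρh : ℝ) (ρ : ℝ → ℝ) (y : ℝ) : ℝ :=
  if y ≤ 0 then ρh else dens a b (charAvg α ρ) y

section
variable {ρh ρb : ℝ}

theorem dens_charAvg_mono (hα : IsVelocity a b α) {ρ ρ' : ℝ → ℝ} (hρ : Measurable ρ)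
    (hρ' : Measurable ρ') {y y' : ℝ} (h : ∀ z, ρ (y + z) ≤ ρ' (y' + z)) :
    dens a b (charAvg α ρ) y ≤ dens a b (charAvg α ρ') y' :=
  dens_mono (integrable_of_mem (measurable_charAvg hα.measurable hρ) (charAvg_mem hρ) _)
    (integrable_of_mem (measurable_charAvg hα.measurable hρ') (charAvg_mem hρ') _)
    fun _ => charAvg_mono hρ hρ' fun _ _ => h _

theorem dens_charAvg_const {r : ℝ} (hr : r ∈ Icc a b) (y : ℝ) :
    dens a b (charAvg α fun _ => r) y = r := by
  have : charAvg α (fun _ => r) = fun _ => equil r := by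
    ext y ξ; exact charAvg_of_const fun _ _ => rfl
  rw [this, dens_equil hr]

theorem dens_charAvg_mem (hα : IsVelocity a b α) (hh : ρh ∈ Icc a b) (hb : ρb ∈ Icc a b)
    {ρ : ℝ → ℝ} (hρ : IsProfile ρh ρb ρ) (y : ℝ) :
    dens a b (charAvg α ρ) y ∈ Icc ρh ρb := by
  constructor
  · have := dens_charAvg_mono hα (y := y) (y' := y) measurable_const hρ.mono.measurable
      fun z => (hρ.mem (y + z)).1
    rwa [dens_charAvg_const hh] at this
  · have := dens_charAvg_mono hα (y := y) (y' := y) hρ.mono.measurable measurable_const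
      fun z => (hρ.mem (y + z)).2
    rwa [dens_charAvg_const hb] at this

theorem IsProfile.densStep (hα : IsVelocity a b α) (hh : ρh ∈ Icc a b) (hb : ρb ∈ Icc a b)
    (hle : ρh ≤ ρb) {ρ : ℝ → ℝ} (hρ : IsProfile ρh ρb ρ) :
    IsProfile ρh ρb (densStep a b α ρh ρ) where
  left y hy := by simp [BGKNetwork.densStep, hy]
  mem y := by
    unfold BGKNetwork.densStep
    split_ifs
    · exact ⟨le_rfl, hle⟩
    · exact dens_charAvg_mem hα hh hb hρ y
  mono y y' h := by
    unfold BGKNetwork.densStep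
    split_ifs with h1 h2 h2
    · exact le_rfl
    · exact (dens_charAvg_mem hα hh hb hρ y').1
    · exact absurd (h.trans h2) h1
    · exact dens_charAvg_mono hα hρ.mono.measurable hρ.mono.measurable
        fun z => hρ.mono (by linarith)

theorem densStep_mono (hα : IsVelocity a b α) {ρ ρ' : ℝ → ℝ} (hρ : IsProfile ρh ρb ρ)
    (hρ' : IsProfile ρh ρb ρ') (h : ∀ y, ρ y ≤ ρ' y) (y : ℝ) :
    densStep a b α ρh ρ y ≤ densStep a b α ρh ρ' y := by
  unfold densStep
  split_ifs
  · exact le_rfl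
  · exact dens_charAvg_mono hα hρ.mono.measurable hρ'.mono.measurable fun z => h _

/-- The half-space problem from a lower to a higher state. The solution is the limit of the
decreasing iteration which starts from the density `ρb`. The fluxes of the iterates are
nondecreasing in `y` with limit `Φ ρb`, hence the flux of the solution is at most `Φ ρb`. Since it
is the flux of the limit state at infinity, and `ρb` is the strict minimiser of the flux,
this limit state is `ρb`. -/
theorem exists_mild_of_lt (hα : IsVelocity a b α) (hh : ρh ∈ Icc a b) (hb : ρb ∈ Icc a b)
    (hlt : ρh < ρb)
    (hmin : ∀ k, ρh ≤ k → k < ρb → equilFlux a α ρb < equilFlux a α k) :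
    ∃ G, IsMild a b α G ∧ (∀ ξ, 0 < α ξ → G 0 ξ = equil ρh ξ) ∧ TendsToEquil a b G atTop ρb := by
  obtain ⟨A, hA⟩ := hα.bounded
  set r : ℕ → ℝ → ℝ := fun k => (densStep a b α ρh)^[k] (fun y => if y ≤ 0 then ρh else ρb) with hr
  have hsucc : ∀ k, r (k + 1) = densStep a b α ρh (r k) := fun k =>
    Function.iterate_succ_apply' _ _ _
  have hprof : ∀ k, IsProfile ρh ρb (r k) := by
    intro k
    induction k with
    | zero =>
      refine ⟨fun y y' h => ?_, fun y => ?_, fun y hy => ?_⟩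
      · simp only [hr, Function.iterate_zero, id]
        split_ifs with h1 h2 h2
        · exact le_rfl
        · exact hlt.le
        · exact absurd (h.trans h2) h1
        · exact le_rfl
      · simp only [hr, Function.iterate_zero, id]
        split_ifs
        · exact ⟨le_rfl, hlt.le⟩
        · exact ⟨hlt.le, le_rfl⟩
      · simp [hr, hy]
    | succ k ih => rw [hsucc]; exact ih.densStep hα hh hb hlt.le
  have hrm : ∀ k, Measurable (r k) := fun k => (hprof k).mono.measurable
  have hanti1 : ∀ k y, r (k + 1) y ≤ r k y := by
    intro k
    induction k with
    | zero =>
      intro y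
      rcases le_or_gt y 0 with hy | hy
      · rw [(hprof _).left y hy, (hprof _).left y hy]
      · have : r 0 y = ρb := by simp [hr, not_le.2 hy]
        rw [this]; exact ((hprof _).mem y).2
    | succ k ih =>
      intro y
      have := densStep_mono hα (hprof (k + 1)) (hprof k) ih y
      rwa [← hsucc, ← hsucc] at this
  have hanti : ∀ y, Antitone fun k => r k y := fun y => antitone_nat_of_succ_le fun k => hanti1 k y
  set R : ℝ → ℝ := fun y => ⨅ k, r k y with hR
  have hbdd : ∀ y, BddBelow (range fun k => r k y) := fun y =>
    ⟨ρh, by rintro _ ⟨k, rfl⟩; exact ((hprof k).mem y).1⟩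
  have hlim : ∀ y, Tendsto (fun k => r k y) atTop (𝓝 (R y)) := fun y =>
    tendsto_atTop_ciInf (hanti y) (hbdd y)
  have hRle : ∀ k y, R y ≤ r k y := fun k y => ciInf_le (hbdd y) k
  have hRprof : IsProfile ρh ρb R := by
    refine ⟨fun y y' h => ?_, fun y => ⟨?_, ?_⟩, fun y hy => ?_⟩
    · exact le_ciInf fun k => (hRle k y).trans ((hprof k).mono h)
    · exact le_ciInf fun k => ((hprof k).mem y).1
    · exact (hRle 0 y).trans ((hprof 0).mem y).2
    · simp [hR, fun k => (hprof k).left y hy]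
  have hRm : Measurable R := hRprof.mono.measurable
  have hGlim : ∀ y ξ, Tendsto (fun k => charAvg α (r k) y ξ) atTop (𝓝 (charAvg α R y ξ)) :=
    fun y ξ => tendsto_charAvg (y := fun _ => y) hrm fun s _ =>
      tendsto_equil_of_le ξ (hlim _) fun k => hRle k _
  have hGm : ∀ {ρ : ℝ → ℝ}, Measurable ρ → ∀ y, Measurable (charAvg α ρ y) := fun hρ y =>
    (measurable_charAvg hα.measurable hρ).comp measurable_prodMk_left
  have hGb : ∀ {ρ : ℝ → ℝ}, Measurable ρ → ∀ y ξ, |charAvg α ρ y ξ| ≤ 1 := fun hρ y ξ => by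
    rw [abs_of_nonneg (charAvg_mem hρ y ξ).1]; exact (charAvg_mem hρ y ξ).2
  -- the limit profile is a fixed point of the iteration
  have hfix : ∀ y, 0 < y → dens a b (charAvg α R) y = R y := by
    intro y hy
    have h1 : Tendsto (fun k => dens a b (charAvg α (r k)) y) atTop
        (𝓝 (dens a b (charAvg α R) y)) := by
      refine Tendsto.const_add a (tendsto_integral_of_dominated_convergence (fun _ => 1)
        (fun k => (hGm (hrm k) y).aestronglyMeasurable) (integrable_const _)
        (fun k => ae_of_all _ (hGb (hrm k) y)) (ae_of_all _ fun ξ => hGlim y ξ))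
    have h2 : Tendsto (fun k => r (k + 1) y) atTop (𝓝 (R y)) :=
      (hlim y).comp (tendsto_add_atTop_nat 1)
    refine tendsto_nhds_unique h1 (h2.congr fun k => ?_)
    rw [hsucc, densStep, if_neg (not_le.2 hy)]
  have hMild : IsMild a b α (charAvg α R) := by
    refine ⟨measurable_charAvg hα.measurable hRm, charAvg_mem hRm, ae_of_all _ fun ξ y hy => ?_⟩
    rw [charAvg_mild hRm y ξ]
    congr 1
    refine intervalIntegral.integral_congr_ae (ae_of_all _ fun z hz => ?_)
    rw [uIoc_of_le hy] at hz
    rw [hfix z hz.1]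
  -- the fluxes of the iterates increase towards `Φ ρb`, as the source of the flux is
  -- `r k - r (k + 1)`
  have hrlim : ∀ k, Tendsto (r k) atTop (𝓝 ρb) := by
    intro k
    induction k with
    | zero =>
      refine tendsto_const_nhds.congr' ?_
      filter_upwards [eventually_gt_atTop (0 : ℝ)] with y hy
      simp [hr, not_le.2 hy]
    | succ k ih =>
      have h1 := (tendsToEquil_charAvg hα (hrm k) ih).dens
        (integrable_of_mem (measurable_charAvg hα.measurable (hrm k)) (charAvg_mem (hrm k))) hb
      refine h1.congr' ?_
      filter_upwards [eventually_gt_atTop (0 : ℝ)] with y hy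
      rw [hsucc, densStep, if_neg (not_le.2 hy)]
  have hck : ∀ k, ∫ ξ in Icc a b, α ξ * charAvg α (r k) 0 ξ ≤ equilFlux a α ρb := by
    intro k
    have hG := measurable_charAvg hα.measurable (hrm k)
    refine ge_of_tendsto (tendsto_flux hα (integrable_of_mem hG (charAvg_mem (hrm k)))
      (fun y ξ => (charAvg_mem (hrm k) y ξ).1) hb (tendsToEquil_charAvg hα (hrm k) (hrlim k))) ?_
    filter_upwards [eventually_ge_atTop 0] with y hy
    have hhm : Measurable (Function.uncurry fun z ξ => equil (r k z) ξ) :=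
      measurable_equil.comp (((hrm k).comp measurable_fst).prodMk measurable_snd)
    have := flux_sub_eq (y := y) hα hG (charAvg_mem (hrm k)) hhm (fun z ξ => equil_mem _ _)
      (ae_of_all _ fun ξ => charAvg_mild (hrm k) y ξ)
    rw [this, le_add_iff_nonneg_right]
    refine intervalIntegral.integral_nonneg_of_ae_restrict hy ?_
    filter_upwards [ae_restrict_mem measurableSet_Icc,
      ae_restrict_of_ae (Measure.ae_ne volume (0 : ℝ))] with z hz hz0
    have hzpos : 0 < z := lt_of_le_of_ne hz.1 (Ne.symm hz0)
    have hmem : r k z ∈ Icc a b :=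
      ⟨hh.1.trans ((hprof k).mem z).1, ((hprof k).mem z).2.trans hb.2⟩
    have e1 : dens a b (fun z ξ => equil (r k z) ξ) z = r k z := by
      simp only [dens, integral_equil hmem]; ring
    have e2 : dens a b (charAvg α (r k)) z = r (k + 1) z := by
      rw [hsucc, densStep, if_neg (not_le.2 hzpos)]
    simp only [Pi.zero_apply, e1, e2]
    linarith [hanti1 k z]
  have hc : ∫ ξ in Icc a b, α ξ * charAvg α R 0 ξ ≤ equilFlux a α ρb := by
    refine le_of_tendsto (tendsto_integral_of_dominated_convergence (fun _ => A)
      (fun k => (hα.measurable.mul (hGm (hrm k) 0)).aestronglyMeasurable) (integrable_const _)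
      (fun k => ae_of_all _ fun ξ => ?_)
      (ae_of_all _ fun ξ => (hGlim 0 ξ).const_mul (α ξ))) (Eventually.of_forall hck)
    rw [Real.norm_eq_abs, Pi.mul_apply, abs_mul]
    exact (mul_le_of_le_one_right (abs_nonneg _) (hGb (hrm k) 0 ξ)).trans (hA ξ)
  -- the limit state at infinity; the flux of the solution excludes states below `ρb`
  have hRbdd : BddAbove (range R) := ⟨ρb, by rintro _ ⟨y, rfl⟩; exact (hRprof.mem y).2⟩
  have hRlim := tendsto_atTop_ciSup hRprof.mono hRbdd
  set s := ⨆ y, R y with hs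
  have hs1 : ρh ≤ s := (hRprof.mem 0).1.trans (le_ciSup hRbdd 0)
  have hs2 : s ≤ ρb := ciSup_le fun y => (hRprof.mem y).2
  have htend := tendsToEquil_charAvg hα hRm hRlim
  have hflux := mild_flux hα hMild le_rfl ⟨hh.1.trans hs1, hs2.trans hb.2⟩ htend
  have hsb : s = ρb := by
    by_contra hne
    have := hmin s hs1 (lt_of_le_of_ne hs2 hne)
    linarith
  refine ⟨charAvg α R, hMild, fun ξ hξ => ?_, hsb ▸ htend⟩
  exact charAvg_of_const fun t ht => hRprof.left _ (by nlinarith)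

end

/-! ### Reflection of the half-space problem -/

theorem measurePreserving_neg_Icc (a b : ℝ) : MeasurePreserving (fun ξ : ℝ => -ξ)
    (volume.restrict (Icc (-b) (-a))) (volume.restrict (Icc a b)) := by
  have := (Measure.measurePreserving_neg (volume : Measure ℝ)).restrict_preimage
    (measurableSet_Icc (a := a) (b := b))
  have e : Neg.neg ⁻¹' Icc a b = Icc (-b) (-a) := by simp
  rwa [e] at this

theorem setIntegral_Icc_neg (f : ℝ → ℝ) :
    ∫ ξ in Icc (-b) (-a), f (-ξ) = ∫ ξ in Icc a b, f ξ :=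
  (measurePreserving_neg_Icc a b).integral_comp (MeasurableEquiv.neg ℝ).measurableEmbedding f

theorem IsVelocity.reflect (hα : IsVelocity a b α) : IsVelocity (-b) (-a) fun ξ => α (-ξ) where
  lt := neg_lt_neg hα.lt
  measurable := hα.measurable.comp measurable_neg
  bounded := hα.bounded.imp fun _ hA ξ => hA (-ξ)
  ne_zero := (measurePreserving_neg_Icc a b).quasiMeasurePreserving.ae hα.ne_zero

theorem dens_reflect {G : ℝ → ℝ → ℝ} (hab : a ≤ b)
    (hi : ∀ y, Integrable (G y) (volume.restrict (Icc a b))) (y : ℝ) :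
    dens (-b) (-a) (fun y ξ => 1 - G y (-ξ)) y = -dens a b G y := by
  simp only [dens]
  rw [setIntegral_Icc_neg fun ξ => 1 - G y ξ, integral_sub (integrable_const _) (hi y)]
  simp [hab]
  ring

theorem equil_reflect {r ξ : ℝ} (h : -ξ ≠ r) : equil (-r) ξ = 1 - equil r (-ξ) := by
  rcases lt_or_gt_of_ne h with h | h
  · have : ¬ ξ ≤ -r := by linarith
    simp [equil, this, h.le]
  · have : ¬ -ξ ≤ r := by linarith
    have h' : ξ ≤ -r := by linarith
    simp [equil, this, h']

/-- The reflection `ξ ↦ -ξ` of a solution. -/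
theorem IsMild.reflect {G : ℝ → ℝ → ℝ} (hα : IsVelocity a b α) (hG : IsMild a b α G) :
    IsMild (-b) (-a) (fun ξ => α (-ξ)) fun y ξ => 1 - G y (-ξ) where
  measurable := measurable_const.sub
    (hG.measurable.comp (measurable_fst.prodMk measurable_snd.neg))
  range y ξ := by
    have := hG.range y (-ξ)
    constructor <;> linarith [this.1, this.2]
  mild := by
    have hd := dens_reflect hα.lt.le hG.integrable
    have hne : ∀ᵐ ξ ∂(volume.restrict (Icc (-b) (-a))), ∀ᵐ z ∂(volume : Measure ℝ),
        -ξ ≠ dens a b G z := by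
      have hmeas : MeasurableSet {p : ℝ × ℝ | -p.2 ≠ dens a b G p.1} :=
        (measurableSet_eq_fun measurable_snd.neg
          ((measurable_dens hG.measurable).comp measurable_fst)).compl
      rw [← Measure.ae_ae_comm hmeas]
      refine ae_of_all _ fun z => ae_restrict_of_ae ?_
      filter_upwards [Measure.ae_ne volume (-dens a b G z)] with ξ h h'
      exact h (by linarith)
    have h0 := (measurePreserving_neg_Icc a b).quasiMeasurePreserving.ae hG.mild
    filter_upwards [h0, hne] with ξ h hz y hy
    have e : (∫ z in (0 : ℝ)..y, (equil (dens (-b) (-a) (fun y ξ => 1 - G y (-ξ)) z) ξ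
        - (1 - G z (-ξ)))) = -∫ z in (0 : ℝ)..y, (equil (dens a b G z) (-ξ) - G z (-ξ)) := by
      rw [← intervalIntegral.integral_neg]
      refine intervalIntegral.integral_congr_ae ?_
      filter_upwards [hz] with z hz _
      rw [hd, equil_reflect hz]; ring
    rw [e]
    linear_combination -h y hy

theorem TendsToEquil.reflect {G : ℝ → ℝ → ℝ} {l : Filter ℝ} {r : ℝ}
    (h : TendsToEquil a b G l r) :
    TendsToEquil (-b) (-a) (fun y ξ => 1 - G y (-ξ)) l (-r) := by
  refine Tendsto.congr (fun y => ?_) h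
  rw [← setIntegral_Icc_neg]
  refine integral_congr_ae (ae_restrict_of_ae ?_)
  filter_upwards [Measure.ae_ne volume (-r)] with ξ hξ
  rw [equil_reflect (fun h => hξ (by linarith)), abs_sub_comm]
  congr 1; ring

theorem intervalIntegrable_velocity (hα : IsVelocity a b α) (u v : ℝ) :
    IntervalIntegrable α volume u v := by
  obtain ⟨A, hA⟩ := hα.bounded
  exact (intervalIntegrable_const (c := A)).mono_fun' hα.measurable.aestronglyMeasurable
    (ae_of_all _ hA)

theorem equilFlux_reflect (hα : IsVelocity a b α) (k : ℝ) :
    equilFlux (-b) (fun ξ => α (-ξ)) (-k) = equilFlux a α b - equilFlux a α k := by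
  simp only [equilFlux]
  rw [intervalIntegral.integral_comp_neg, neg_neg, neg_neg]
  exact (intervalIntegral.integral_interval_sub_left (intervalIntegrable_velocity hα _ _)
    (intervalIntegrable_velocity hα _ _)).symm

/-- The half-space problem is solvable for strictly compatible states. The case `ρb < ρh` is reduced
to `exists_mild_of_lt` by reflection. -/
theorem exists_mild (hα : IsVelocity a b α) {ρh ρb : ℝ} (hh : ρh ∈ Icc a b) (hb : ρb ∈ Icc a b)
    (hc : StrictlyCompatible (equilFlux a α) ρh ρb) :
    ∃ G, IsMild a b α G ∧
      (∀ᵐ ξ ∂(volume.restrict (Icc a b)), 0 < α ξ → G 0 ξ = equil ρh ξ) ∧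
      TendsToEquil a b G atTop ρb := by
  rcases lt_trichotomy ρh ρb with h | h | h
  · obtain ⟨G, h1, h2, h3⟩ := exists_mild_of_lt hα hh hb h hc.2
    exact ⟨G, h1, ae_of_all _ h2, h3⟩
  · subst h
    exact ⟨fun _ => equil ρh, isMild_equil hh, ae_of_all _ fun _ _ => rfl,
      tendsToEquil_equil _ _⟩
  · have hα' := hα.reflect
    obtain ⟨G, h1, h2, h3⟩ := exists_mild_of_lt (ρh := -ρh) (ρb := -ρb) hα'
      ⟨neg_le_neg hh.2, neg_le_neg hh.1⟩ ⟨neg_le_neg hb.2, neg_le_neg hb.1⟩ (neg_lt_neg h) (by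
        intro k hk1 hk2
        have := hc.1 (-k) (by linarith) (by linarith)
        have e := equilFlux_reflect hα (-k)
        rw [neg_neg] at e
        rw [e, equilFlux_reflect hα]
        linarith)
    have h1' := h1.reflect hα'
    have h3' := h3.reflect
    simp only [neg_neg] at h1' h3'
    refine ⟨_, h1', ?_, h3'⟩
    have hne : ∀ᵐ ξ ∂(volume.restrict (Icc a b)), ξ ≠ ρh := ae_restrict_of_ae (Measure.ae_ne volume ρh)
    filter_upwards [hne] with ξ hξ hpos
    rw [h2 (-ξ) (by simpa using hpos)]
    have := equil_reflect (r := ρh) (ξ := -ξ) (by simpa using hξ)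
    rw [this]; simp

end

/-! ### Fluxes of admissible roads -/

section
variable {r : Road}

/-- The velocity `τ f'`, extended from `K` to the line by its values at the end points. -/
noncomputable def Road.vel (r : Road) (τ ξ : ℝ) : ℝ := τ * r.df (max r.a (min r.b ξ))

theorem Road.vel_eq (r : Road) {τ ξ : ℝ} (hξ : ξ ∈ Icc r.a r.b) : r.vel τ ξ = τ * r.df ξ := by
  rw [Road.vel, min_eq_right hξ.2, max_eq_right hξ.1]

theorem Road.Admissible.antitone_vel_one (hr : r.Admissible) : Antitone (r.vel 1) := by
  intro x y h
  simp only [Road.vel, one_mul]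
  have hm : ∀ z, max r.a (min r.b z) ∈ r.K := fun z =>
    ⟨le_max_left _ _, max_le hr.lt.le (min_le_left _ _)⟩
  exact hr.antitone (hm x) (hm y) (max_le_max le_rfl (min_le_min le_rfl h))

theorem Road.vel_eq_mul (r : Road) (τ : ℝ) : r.vel τ = fun ξ => τ * r.vel 1 ξ := by
  ext ξ; simp [Road.vel]

theorem Road.Admissible.df_ne_zero (hr : r.Admissible) {x y : ℝ} (hx : x ∈ r.K) (hy : y ∈ r.K)
    (hxy : x < y) (h0 : r.df x = 0) : r.df y ≠ 0 := by
  intro h1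
  refine hr.nondegenerate x y hx.1 hxy hy.2 ⟨0, fun z hz => ?_⟩
  have hzK : z ∈ r.K := ⟨hx.1.trans hz.1.le, hz.2.le.trans hy.2⟩
  exact le_antisymm (h0 ▸ hr.antitone hx hzK hz.1.le) (h1 ▸ hr.antitone hzK hy hz.2.le)

theorem Road.Admissible.isVelocity (hr : r.Admissible) {τ : ℝ} (hτ : τ ≠ 0) :
    IsVelocity r.a r.b (r.vel τ) where
  lt := hr.lt
  measurable := by
    rw [Road.vel_eq_mul]; exact hr.antitone_vel_one.measurable.const_mul τ
  bounded := by
    refine ⟨|τ| * max |r.df r.a| |r.df r.b|, fun ξ => ?_⟩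
    rw [Road.vel, abs_mul]
    refine mul_le_mul_of_nonneg_left ?_ (abs_nonneg _)
    have hm : max r.a (min r.b ξ) ∈ r.K := ⟨le_max_left _ _, max_le hr.lt.le (min_le_left _ _)⟩
    rw [max_comm |r.df r.a|]
    exact abs_le_max_abs_abs (hr.antitone hm ⟨hr.lt.le, le_rfl⟩ hm.2)
      (hr.antitone ⟨le_rfl, hr.lt.le⟩ hm hm.1)
  ne_zero := by
    have hsub : ({ξ | ξ ∈ r.K ∧ r.df ξ = 0} : Set ℝ).Subsingleton := by
      intro x hx y hy
      by_contra hne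
      rcases lt_or_gt_of_ne hne with h | h
      · exact hr.df_ne_zero hx.1 hy.1 h hx.2 hy.2
      · exact hr.df_ne_zero hy.1 hx.1 h hy.2 hx.2
    have h0 : volume {ξ | ξ ∈ r.K ∧ r.df ξ = 0} = 0 := hsub.measure_zero _
    filter_upwards [ae_restrict_of_ae (measure_eq_zero_iff_ae_notMem.1 h0),
      ae_restrict_mem measurableSet_Icc] with ξ h1 h2 h3
    rw [Road.vel_eq r h2] at h3
    exact h1 ⟨h2, (mul_eq_zero.1 h3).resolve_left hτ⟩

theorem Road.Admissible.intervalIntegrable_vel (hr : r.Admissible) (u v : ℝ) :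
    IntervalIntegrable (r.vel 1) volume u v :=
  intervalIntegrable_velocity (hr.isVelocity one_ne_zero) u v

/-- The fundamental theorem of calculus for the flux. -/
theorem Road.Admissible.integral_vel (hr : r.Admissible) {x y : ℝ} (hx : x ∈ r.K) (hy : y ∈ r.K) :
    ∫ ξ in x..y, r.vel 1 ξ = r.f y - r.f x := by
  obtain ⟨L, hL⟩ := hr.lipschitz
  have hsub : uIcc x y ⊆ r.K := (convex_Icc r.a r.b).ordConnected.uIcc_subset hx hy
  have hac : AbsolutelyContinuousOnInterval r.f x y := (hL.mono hsub).absolutelyContinuousOnInterval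
  rw [← hac.integral_deriv_eq_sub]
  refine intervalIntegral.integral_congr_ae ?_
  have hd := (ae_restrict_iff' (measurableSet_Icc (a := r.a) (b := r.b))).1 hr.hasDeriv
  filter_upwards [hd] with ξ hξ hm
  have hK : ξ ∈ r.K := hsub (uIoc_subset_uIcc hm)
  rw [(hξ hK).deriv, Road.vel_eq r hK, one_mul]

theorem Road.Admissible.equilFlux_vel (hr : r.Admissible) {τ k : ℝ} (hk : k ∈ r.K) :
    equilFlux r.a (r.vel τ) k = τ * r.f k := by
  rw [equilFlux, Road.vel_eq_mul, intervalIntegral.integral_const_mul,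
    hr.integral_vel ⟨le_rfl, hr.lt.le⟩ hk, hr.f_a, sub_zero]

theorem Road.Admissible.strictlyCompatible_iff (hr : r.Admissible) {τ ρh ρb : ℝ} (hh : ρh ∈ r.K)
    (hb : ρb ∈ r.K) : StrictlyCompatible (equilFlux r.a (r.vel τ)) ρh ρb ↔
      StrictlyCompatible (fun k => τ * r.f k) ρh ρb := by
  unfold StrictlyCompatible
  rw [hr.equilFlux_vel hb]
  refine and_congr (forall_congr' fun k => forall_congr' fun h1 => forall_congr' fun h2 => ?_)
    (forall_congr' fun k => forall_congr' fun h1 => forall_congr' fun h2 => ?_)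
  · rw [hr.equilFlux_vel ⟨hb.1.trans h1.le, h2.trans hh.2⟩]
  · rw [hr.equilFlux_vel ⟨hh.1.trans h1, h2.le.trans hb.2⟩]

theorem Road.Admissible.exists_df_pos (hr : r.Admissible) {x y : ℝ} (hx : x ∈ r.K) (hy : y ∈ r.K)
    (hxy : x < y) (h : r.f x < r.f y) : ∃ ξ ∈ Ioo x y, 0 < r.df ξ := by
  by_contra hcon
  push Not at hcon
  have h1 := hr.integral_vel hx hy
  have h2 : ∫ ξ in x..y, r.vel 1 ξ ≤ ∫ ξ in x..y, (0 : ℝ) := by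
    refine intervalIntegral.integral_mono_on_of_le_Ioo hxy.le (hr.intervalIntegrable_vel _ _)
      (by simp) fun ξ hξ => ?_
    rw [Road.vel_eq r ⟨hx.1.trans hξ.1.le, hξ.2.le.trans hy.2⟩, one_mul]
    exact hcon ξ hξ
  simp only [intervalIntegral.integral_zero] at h2
  linarith

theorem Road.Admissible.exists_df_neg (hr : r.Admissible) {x y : ℝ} (hx : x ∈ r.K) (hy : y ∈ r.K)
    (hxy : x < y) (h : r.f y < r.f x) : ∃ ξ ∈ Ioo x y, r.df ξ < 0 := by
  by_contra hcon
  push Not at hcon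
  have h1 := hr.integral_vel hx hy
  have h2 : ∫ ξ in x..y, (0 : ℝ) ≤ ∫ ξ in x..y, r.vel 1 ξ := by
    refine intervalIntegral.integral_mono_on_of_le_Ioo hxy.le
      (by simp) (hr.intervalIntegrable_vel _ _) fun ξ hξ => ?_
    rw [Road.vel_eq r ⟨hx.1.trans hξ.1.le, hξ.2.le.trans hy.2⟩, one_mul]
    exact hcon ξ hξ
  simp only [intervalIntegral.integral_zero] at h2
  linarith

/-- A concave function which is at least `c` at two points and exceeds `c` at one of them exceeds `c`
in between. -/
theorem ConcaveOn.lt_of_mem_Ioo {s : Set ℝ} {f : ℝ → ℝ} (hf : ConcaveOn ℝ s f) {x k z c : ℝ}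
    (hx : x ∈ s) (hz : z ∈ s) (h1 : x < k) (h2 : k < z) (hcx : c ≤ f x) (hcz : c ≤ f z)
    (hne : c < f x ∨ c < f z) : c < f k := by
  have hd : 0 < z - x := by linarith
  have hs : 0 < (z - k) / (z - x) := div_pos (by linarith) hd
  have ht : 0 < (k - x) / (z - x) := div_pos (by linarith) hd
  have hst : (z - k) / (z - x) + (k - x) / (z - x) = 1 := by field_simp; ring
  have hcomb := hf.2 hx hz hs.le ht.le hst
  have e : (z - k) / (z - x) * x + (k - x) / (z - x) * z = k := by field_simp; ring
  simp only [smul_eq_mul, e] at hcomb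
  refine lt_of_lt_of_le ?_ hcomb
  have hc : c = (z - k) / (z - x) * c + (k - x) / (z - x) * c := by rw [← add_mul, hst, one_mul]
  rw [hc]
  rcases hne with h | h
  · exact add_lt_add_of_lt_of_le (mul_lt_mul_of_pos_left h hs) (mul_le_mul_of_nonneg_left hcz ht.le)
  · exact add_lt_add_of_le_of_lt (mul_le_mul_of_nonneg_left hcx hs.le) (mul_lt_mul_of_pos_left h ht)

/-- Strict concavity at equal values; this uses that `f'` is not constant on any interval. -/
theorem Road.Admissible.lt_of_eq (hr : r.Admissible) {x y z : ℝ} (hx : x ∈ r.K) (hy : y ∈ r.K)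
    (hz : z ∈ Ioo x y) (h : r.f x = r.f y) : r.f x < r.f z := by
  have hxy := hz.1.trans hz.2
  have hK : ∀ w ∈ Ioo x y, w ∈ r.K := fun w hw => ⟨hx.1.trans hw.1.le, hw.2.le.trans hy.2⟩
  have hge : ∀ w ∈ Ioo x y, r.f x ≤ r.f w := by
    intro w hw
    by_contra hcon
    push Not at hcon
    exact lt_irrefl _ (ConcaveOn.lt_of_mem_Ioo hr.concave hx hy hw.1 hw.2 hcon.le (h ▸ hcon.le)
      (Or.inl hcon))
  by_contra hcon
  push Not at hcon
  have hz' : r.f z = r.f x := le_antisymm hcon (hge z hz)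
  -- then the flux is constant on the interval, so that its derivative vanishes there
  have hconst : ∀ w ∈ Ioo x y, r.f w = r.f x := by
    intro w hw
    refine le_antisymm ?_ (hge w hw)
    by_contra hlt
    push Not at hlt
    rcases lt_trichotomy w z with hwz | hwz | hwz
    · have := ConcaveOn.lt_of_mem_Ioo hr.concave (hK w hw) hy hwz hz.2 hlt.le h.le (Or.inl hlt)
      linarith
    · rw [hwz] at hlt; linarith
    · have := ConcaveOn.lt_of_mem_Ioo hr.concave hx (hK w hw) hz.1 hwz le_rfl hlt.le (Or.inr hlt)
      linarith
  refine hr.nondegenerate x y hx.1 hxy hy.2 ⟨0, fun w hw => ?_⟩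
  rcases lt_trichotomy (r.df w) 0 with hn | hn | hn
  · exfalso
    have h2 : ∫ ξ in w..y, r.vel 1 ξ < 0 := by
      have : 0 < ∫ ξ in w..y, -r.vel 1 ξ := by
        refine intervalIntegral.intervalIntegral_pos_of_pos_on
          (hr.intervalIntegrable_vel _ _).neg (fun ξ hξ => ?_) hw.2
        have hξK : ξ ∈ r.K := ⟨(hK w hw).1.trans hξ.1.le, hξ.2.le.trans hy.2⟩
        rw [Road.vel_eq r hξK, one_mul]
        linarith [hr.antitone (hK w hw) hξK hξ.1.le]
      rw [intervalIntegral.integral_neg] at this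
      linarith
    rw [hr.integral_vel (hK w hw) hy, hconst w hw] at h2
    linarith
  · exact hn
  · exfalso
    have h2 : 0 < ∫ ξ in x..w, r.vel 1 ξ := by
      refine intervalIntegral.intervalIntegral_pos_of_pos_on
        (hr.intervalIntegrable_vel _ _) (fun ξ hξ => ?_) hw.1
      have hξK : ξ ∈ r.K := ⟨hx.1.trans hξ.1.le, hξ.2.le.trans (hK w hw).2⟩
      rw [Road.vel_eq r hξK, one_mul]
      linarith [hr.antitone hξK (hK w hw) hξ.2.le]
    rw [hr.integral_vel hx (hK w hw), hconst w hw] at h2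
    linarith

/-- The nonstrict version of `StrictlyCompatible`. -/
def Compatible (Φ : ℝ → ℝ) (ρh ρb : ℝ) : Prop :=
  (∀ k, ρb < k → k ≤ ρh → Φ k ≤ Φ ρb) ∧ (∀ k, ρh ≤ k → k < ρb → Φ ρb ≤ Φ k)

/-- Between two states with equal fluxes the flux rises at the left and falls at the right one. -/
theorem mem_closure_df_pos (hr : r.Admissible) {x y : ℝ} (hx : x ∈ r.K) (hy : y ∈ r.K)
    (hxy : x < y) (h : r.f x = r.f y) :
    x ∈ closure {ξ | ξ ∈ r.K ∧ 0 < r.df ξ} ∧ y ∉ closure {ξ | ξ ∈ r.K ∧ 0 < r.df ξ} := by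
  constructor
  · rw [Metric.mem_closure_iff]
    intro ε hε
    set z := min (x + ε) ((x + y) / 2) with hz
    have hz1 : x < z := lt_min (by linarith) (by linarith)
    have hz2 : z < y := lt_of_le_of_lt (min_le_right _ _) (by linarith)
    have hzK : z ∈ r.K := ⟨hx.1.trans hz1.le, hz2.le.trans hy.2⟩
    obtain ⟨ξ, hξ, hpos⟩ := hr.exists_df_pos hx hzK hz1 (hr.lt_of_eq hx hy ⟨hz1, hz2⟩ h)
    refine ⟨ξ, ⟨⟨hx.1.trans hξ.1.le, hξ.2.le.trans hzK.2⟩, hpos⟩, ?_⟩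
    rw [dist_comm, Real.dist_eq, abs_of_pos (by linarith [hξ.1])]
    have := min_le_left (x + ε) ((x + y) / 2)
    linarith [hξ.2]
  · intro hcl
    have hmK : (x + y) / 2 ∈ r.K := ⟨by linarith [hx.1], by linarith [hy.2]⟩
    obtain ⟨ξ, hξ, hneg⟩ := hr.exists_df_neg hmK hy (by linarith)
      (h ▸ hr.lt_of_eq hx hy ⟨by linarith, by linarith⟩ h)
    obtain ⟨w, hw, hwd⟩ := mem_closure_iff.1 hcl (Ioi ξ) isOpen_Ioi hξ.2
    have := hr.antitone ⟨hmK.1.trans hξ.1.le, hξ.2.le.trans hy.2⟩ hwd.1 (le_of_lt hw)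
    linarith [hwd.2]

theorem mem_closure_df_neg (hr : r.Admissible) {x y : ℝ} (hx : x ∈ r.K) (hy : y ∈ r.K)
    (hxy : x < y) (h : r.f x = r.f y) :
    y ∈ closure {ξ | ξ ∈ r.K ∧ r.df ξ < 0} ∧ x ∉ closure {ξ | ξ ∈ r.K ∧ r.df ξ < 0} := by
  constructor
  · rw [Metric.mem_closure_iff]
    intro ε hε
    set z := max (y - ε) ((x + y) / 2) with hz
    have hz1 : z < y := max_lt (by linarith) (by linarith)
    have hz2 : x < z := lt_of_lt_of_le (by linarith) (le_max_right _ _)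
    have hzK : z ∈ r.K := ⟨hx.1.trans hz2.le, hz1.le.trans hy.2⟩
    obtain ⟨ξ, hξ, hneg⟩ := hr.exists_df_neg hzK hy hz1 (h ▸ hr.lt_of_eq hx hy ⟨hz2, hz1⟩ h)
    refine ⟨ξ, ⟨⟨hzK.1.trans hξ.1.le, hξ.2.le.trans hy.2⟩, hneg⟩, ?_⟩
    rw [Real.dist_eq, abs_of_pos (by linarith [hξ.2])]
    have := le_max_left (y - ε) ((x + y) / 2)
    linarith [hξ.1]
  · intro hcl
    have hmK : (x + y) / 2 ∈ r.K := ⟨by linarith [hx.1], by linarith [hy.2]⟩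
    obtain ⟨ξ, hξ, hpos⟩ := hr.exists_df_pos hx hmK (by linarith)
      (hr.lt_of_eq hx hy ⟨by linarith, by linarith⟩ h)
    obtain ⟨w, hw, hwd⟩ := mem_closure_iff.1 hcl (Iio ξ) isOpen_Iio hξ.1
    have := hr.antitone hwd.1 ⟨hx.1.trans hξ.1.le, hξ.2.le.trans hmK.2⟩ (le_of_lt hw)
    linarith [hwd.2]

/-- By strict concavity the outgoing-state condition excludes exactly the standing shocks, which
are the only compatible but not strictly compatible pairs (outgoing roads). -/
theorem Compatible.strictly_outgoing (hr : r.Admissible) {ρh ρb : ℝ} (hh : ρh ∈ r.K)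
    (hb : ρb ∈ r.K) (hc : Compatible r.f ρh ρb)
    (hout : r.f ρb = r.f ρh → ρh ∈ closure {ξ | ξ ∈ r.K ∧ 0 < r.df ξ} →
      ρb ∈ closure {ξ | ξ ∈ r.K ∧ 0 < r.df ξ}) : StrictlyCompatible r.f ρh ρb := by
  constructor
  · intro k h1 h2
    refine lt_of_le_of_ne (hc.1 k h1 h2) fun he => ?_
    have hkK : k ∈ r.K := ⟨hb.1.trans h1.le, h2.trans hh.2⟩
    have := hr.lt_of_eq hb hkK (z := (ρb + k) / 2) ⟨by linarith, by linarith⟩ he.symm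
    linarith [hc.1 ((ρb + k) / 2) (by linarith) (by linarith)]
  · intro k h1 h2
    refine lt_of_le_of_ne (hc.2 k h1 h2) fun he => ?_
    have hkK : k ∈ r.K := ⟨hh.1.trans h1, h2.le.trans hb.2⟩
    rcases h1.eq_or_lt with h1 | h1
    · subst h1
      have := mem_closure_df_pos hr hh hb h2 he.symm
      exact this.2 (hout he this.1)
    · have hz := hr.lt_of_eq hkK hb (z := (k + ρb) / 2) ⟨by linarith, by linarith⟩ he.symm
      have hzK : (k + ρb) / 2 ∈ r.K := ⟨by linarith [hkK.1], by linarith [hb.2]⟩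
      have := ConcaveOn.lt_of_mem_Ioo hr.concave hh hzK (c := r.f k) h1 (by linarith)
        (he ▸ hc.2 ρh le_rfl (h1.trans h2)) hz.le (Or.inr hz)
      exact lt_irrefl _ this

/-- The analogue of `Compatible.strictly_outgoing` for incoming roads. -/
theorem Compatible.strictly_incoming (hr : r.Admissible) {ρh ρb : ℝ} (hh : ρh ∈ r.K)
    (hb : ρb ∈ r.K) (hc : Compatible (fun k => -r.f k) ρh ρb)
    (hout : r.f ρb = r.f ρh → ρh ∈ closure {ξ | ξ ∈ r.K ∧ r.df ξ < 0} →
      ρb ∈ closure {ξ | ξ ∈ r.K ∧ r.df ξ < 0}) : StrictlyCompatible (fun k => -r.f k) ρh ρb := by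
  constructor
  · intro k h1 h2
    refine lt_of_le_of_ne (hc.1 k h1 h2) fun he => ?_
    have he : r.f k = r.f ρb := neg_injective he
    have hkK : k ∈ r.K := ⟨hb.1.trans h1.le, h2.trans hh.2⟩
    rcases h2.eq_or_lt with h2 | h2
    · subst h2
      have := mem_closure_df_neg hr hb hh h1 he.symm
      exact this.2 (hout he.symm this.1)
    · have hz := hr.lt_of_eq hb hkK (z := (k + ρb) / 2) ⟨by linarith, by linarith⟩ he.symm
      have hzK : (k + ρb) / 2 ∈ r.K := ⟨by linarith [hb.1], by linarith [hkK.2]⟩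
      have h3 := neg_le_neg_iff.1 (hc.1 ρh (h1.trans h2) le_rfl)
      have := ConcaveOn.lt_of_mem_Ioo hr.concave hzK hh (c := r.f ρb) (by linarith) h2
        hz.le h3 (Or.inl hz)
      linarith
  · intro k h1 h2
    refine lt_of_le_of_ne (hc.2 k h1 h2) fun he => ?_
    have he : r.f ρb = r.f k := neg_injective he
    have hkK : k ∈ r.K := ⟨hh.1.trans h1, h2.le.trans hb.2⟩
    have := hr.lt_of_eq hkK hb (z := (k + ρb) / 2) ⟨by linarith, by linarith⟩ he.symm
    have h3 := neg_le_neg_iff.1 (hc.2 ((k + ρb) / 2) (by linarith) (by linarith))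
    linarith

end

/-! ### Test functions and the transport equation -/

section
variable {φ : ℝ × ℝ → ℝ}

theorem deriv_fst_eq (hφ : ContDiff ℝ ∞ φ) (p : ℝ × ℝ) :
    deriv (fun t => φ (t, p.2)) p.1 = fderiv ℝ φ p (1, 0) := by
  have h1 : HasFDerivAt φ (fderiv ℝ φ p) (p.1, p.2) :=
    (hφ.differentiable (by simp) p).hasFDerivAt
  exact (h1.comp_hasDerivAt p.1 ((hasDerivAt_id p.1).prodMk (hasDerivAt_const p.1 p.2))).deriv

theorem deriv_snd_eq (hφ : ContDiff ℝ ∞ φ) (p : ℝ × ℝ) :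
    deriv (fun x => φ (p.1, x)) p.2 = fderiv ℝ φ p (0, 1) := by
  have h1 : HasFDerivAt φ (fderiv ℝ φ p) (p.1, p.2) :=
    (hφ.differentiable (by simp) p).hasFDerivAt
  exact (h1.comp_hasDerivAt p.2 ((hasDerivAt_const p.2 p.1).prodMk (hasDerivAt_id p.2))).deriv

theorem integrable_fderiv (hφ : ContDiff ℝ ∞ φ) (hc : HasCompactSupport φ) (v : ℝ × ℝ) :
    Integrable fun p => fderiv ℝ φ p v :=
  ((hφ.continuous_fderiv (by simp)).clm_apply continuous_const).integrable_of_hasCompactSupport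
    (hc.fderiv_apply ℝ v)

theorem hasCompactSupport_slice_left (hc : HasCompactSupport φ) (x : ℝ) :
    HasCompactSupport fun t => φ (t, x) :=
  hc.comp_isClosedEmbedding (g := fun t => (t, x))
    (Topology.IsClosedEmbedding.of_continuous_injective_isClosedMap (by fun_prop)
      (fun _ _ h => (Prod.ext_iff.1 h).1) (isClosedMap_prodMk_right x))

theorem hasCompactSupport_slice_right (hc : HasCompactSupport φ) (t : ℝ) :
    HasCompactSupport fun x => φ (t, x) :=
  hc.comp_isClosedEmbedding (g := fun x => (t, x))
    (Topology.IsClosedEmbedding.of_continuous_injective_isClosedMap (by fun_prop)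
      (fun _ _ h => (Prod.ext_iff.1 h).2) (isClosedMap_prodMk_left t))

theorem contDiff_slice_left (hφ : ContDiff ℝ ∞ φ) (x : ℝ) : ContDiff ℝ ∞ fun t => φ (t, x) :=
  hφ.comp (contDiff_id.prodMk contDiff_const)

theorem contDiff_slice_right (hφ : ContDiff ℝ ∞ φ) (t : ℝ) : ContDiff ℝ ∞ fun x => φ (t, x) :=
  hφ.comp (contDiff_const.prodMk contDiff_id)

/-- The shear `(t, x) ↦ (t, x + c t)`. -/
def shear (c : ℝ) : ℝ × ℝ ≃ₜ ℝ × ℝ where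
  toFun p := (p.1, p.2 + c * p.1)
  invFun p := (p.1, p.2 - c * p.1)
  left_inv p := by simp
  right_inv p := by simp
  continuous_toFun := by fun_prop
  continuous_invFun := by fun_prop

/-- Bounded functions of `x - c t` are weak solutions of the transport equation with speed `c`. -/
theorem transport_identity (hφ : ContDiff ℝ ∞ φ) (hc : HasCompactSupport φ) {w : ℝ → ℝ} {C : ℝ}
    (hw : Measurable w) (hC : ∀ x, |w x| ≤ C) (c : ℝ) :
    (∫ p in Ioi (0 : ℝ) ×ˢ (univ : Set ℝ), w (p.2 - c * p.1) *
      (fderiv ℝ φ p (1, 0) + c * fderiv ℝ φ p (0, 1))) + ∫ x, w x * φ (0, x) = 0 := by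
  -- in sheared coordinates the transport derivative is the time derivative
  set ψ : ℝ × ℝ → ℝ := fun p => φ (shear c p) with hψ
  have hsd : ContDiff ℝ ∞ fun p : ℝ × ℝ => ((p.1, p.2 + c * p.1) : ℝ × ℝ) := by fun_prop
  have hψs : ContDiff ℝ ∞ ψ := hφ.comp hsd
  have hψc : HasCompactSupport ψ := hc.comp_homeomorph (shear c)
  have hF : ∀ p, fderiv ℝ φ p (1, 0) + c * fderiv ℝ φ p (0, 1) = fderiv ℝ φ p (1, c) := by
    intro p
    rw [← smul_eq_mul, ← map_smul, ← map_add]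
    simp
  have hψd : ∀ p, fderiv ℝ ψ p (1, 0) = fderiv ℝ φ (p.1, p.2 + c * p.1) (1, c) := by
    intro p
    rw [← deriv_fst_eq hψs p]
    have h1 : HasFDerivAt φ (fderiv ℝ φ (p.1, p.2 + c * p.1)) (p.1, p.2 + c * p.1) :=
      (hφ.differentiable (by simp) _).hasFDerivAt
    have h2 : HasDerivAt (fun t : ℝ => ((t, p.2 + c * t) : ℝ × ℝ)) (1, c) p.1 := by
      have := ((hasDerivAt_id p.1).const_mul c).const_add p.2
      simp only [id, mul_one] at this
      exact (hasDerivAt_id p.1).prodMk this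
    exact (h1.comp_hasDerivAt p.1 h2).deriv
  have bdd : ∀ {f : ℝ × ℝ → ℝ} {g : ℝ × ℝ → ℝ}, Measurable g → Integrable f →
      Integrable fun p => w (g p) * f p := fun hg hf =>
    hf.bdd_mul (hw.comp hg).aestronglyMeasurable (ae_of_all _ fun p => hC _)
  have i1 : Integrable fun p : ℝ × ℝ => w (p.2 - c * p.1) * fderiv ℝ φ p (1, c) :=
    bdd (by fun_prop) (integrable_fderiv hφ hc _)
  have i2 : Integrable fun p : ℝ × ℝ => w p.2 * fderiv ℝ ψ p (1, 0) :=
    bdd measurable_snd (integrable_fderiv hψs hψc _)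
  simp_rw [hF]
  rw [Measure.volume_eq_prod, setIntegral_prod _ i1.integrableOn]
  have e1 : ∀ t : ℝ, ∫ x in univ, w (x - c * t) * fderiv ℝ φ (t, x) (1, c)
      = ∫ y, w y * fderiv ℝ ψ (t, y) (1, 0) := by
    intro t
    rw [Measure.restrict_univ,
      ← integral_add_right_eq_self (fun x => w (x - c * t) * fderiv ℝ φ (t, x) (1, c)) (c * t)]
    congr 1
    ext y
    rw [hψd, add_sub_cancel_right]
  simp_rw [e1]
  have i2' : Integrable (Function.uncurry fun t y => w y * fderiv ℝ ψ (t, y) (1, 0))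
      ((volume.restrict (Ioi (0 : ℝ))).prod volume) := by
    have := i2.integrableOn (s := Ioi (0 : ℝ) ×ˢ (univ : Set ℝ))
    rw [IntegrableOn, Measure.volume_eq_prod, ← Measure.prod_restrict, Measure.restrict_univ] at this
    exact this
  have i3 : Integrable fun y => ∫ t in Ioi (0 : ℝ), w y * fderiv ℝ ψ (t, y) (1, 0) :=
    i2'.integral_prod_right
  rw [integral_integral_swap i2', ← integral_add i3]
  · refine integral_eq_zero_of_ae (ae_of_all _ fun y => ?_)
    have h1 := (hasCompactSupport_slice_left hψc y).integral_Ioi_deriv_eq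
      ((contDiff_slice_left hψs y).of_le (by simp)) 0
    have h2 : ∀ t, deriv (fun t => ψ (t, y)) t = fderiv ℝ ψ (t, y) (1, 0) := fun t =>
      deriv_fst_eq hψs (t, y)
    simp only [h2] at h1
    have h3 : ψ (0, y) = φ (0, y) := by simp [hψ, shear]
    simp only [integral_const_mul, h1, h3, Pi.zero_apply]
    ring
  · have : Integrable fun x => φ (0, x) :=
      (contDiff_slice_right hφ 0).continuous.integrable_of_hasCompactSupport
        (hasCompactSupport_slice_right hc 0)
    exact this.bdd_mul hw.aestronglyMeasurable (ae_of_all _ hC)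

theorem integral_fderiv_time (hφ : ContDiff ℝ ∞ φ) (hc : HasCompactSupport φ) :
    (∫ p in Ioi (0 : ℝ) ×ˢ (univ : Set ℝ), fderiv ℝ φ p (1, 0)) + ∫ x, φ (0, x) = 0 := by
  simpa using transport_identity hφ hc (w := fun _ => 1) (C := 1) measurable_const (by simp) 0

theorem integral_fderiv_space (hφ : ContDiff ℝ ∞ φ) (hc : HasCompactSupport φ) :
    ∫ p in Ioi (0 : ℝ) ×ˢ (univ : Set ℝ), fderiv ℝ φ p (0, 1) = 0 := by
  have h0 := integral_fderiv_time hφ hc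
  have h1 := transport_identity hφ hc (w := fun _ => 1) (C := 1) measurable_const (by simp) 1
  simp only [one_mul] at h1
  rw [integral_add (integrable_fderiv hφ hc _).integrableOn
    (integrable_fderiv hφ hc _).integrableOn] at h1
  linarith

end

/-! ### Explicit solutions of the Riemann problem -/

section
variable {r : Road}

theorem measurable_sign_sub (k : ℝ) : Measurable fun ξ => Real.sign (ξ - k) := by
  unfold Real.sign
  exact Measurable.ite (measurableSet_lt (by fun_prop) measurable_const) measurable_const
    (Measurable.ite (measurableSet_lt measurable_const (by fun_prop)) measurable_const
      measurable_const)

theorem abs_sign_le (x : ℝ) : |Real.sign x| ≤ 1 := by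
  rcases Real.sign_apply_eq x with h | h | h <;> simp [h]

/-- The primitive of the sign function against the derivative of `F`. -/
theorem integral_sign_mul {F d : ℝ → ℝ} {u v k : ℝ} (huv : u ≤ v)
    (hd : ∀ x y, IntervalIntegrable d volume x y) {A B : ℝ} (hu : A ≤ u) (hv : v ≤ B)
    (hk : k ∈ Icc A B)
    (hF : ∀ x y, x ∈ Icc A B → y ∈ Icc A B → ∫ ξ in x..y, d ξ = F y - F x) :
    ∫ ξ in u..v, Real.sign (ξ - k) * d ξ
      = Real.sign (v - k) * (F v - F k) - Real.sign (u - k) * (F u - F k) := by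
  have pos : ∀ x y, x ≤ y → k ≤ x → x ∈ Icc A B → y ∈ Icc A B →
      ∫ ξ in x..y, Real.sign (ξ - k) * d ξ = F y - F x := by
    intro x y hxy hkx hx hy
    rw [← hF x y hx hy]
    refine intervalIntegral.integral_congr_ae (ae_of_all _ fun ξ hξ => ?_)
    rw [uIoc_of_le hxy] at hξ
    rw [Real.sign_of_pos (by linarith [hξ.1]), one_mul]
  have neg : ∀ x y, x ≤ y → y ≤ k → x ∈ Icc A B → y ∈ Icc A B →
      ∫ ξ in x..y, Real.sign (ξ - k) * d ξ = -(F y - F x) := by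
    intro x y hxy hky hx hy
    rw [← hF x y hx hy, ← intervalIntegral.integral_neg]
    refine intervalIntegral.integral_congr_ae ?_
    filter_upwards [Measure.ae_ne volume k] with ξ hne hξ
    rw [uIoc_of_le hxy] at hξ
    have : ξ < k := lt_of_le_of_ne (hξ.2.trans hky) hne
    rw [Real.sign_of_neg (by linarith), neg_one_mul]
  have sp : ∀ x, k ≤ x → Real.sign (x - k) * (F x - F k) = F x - F k := by
    intro x hx
    rcases hx.eq_or_lt with h | h
    · simp [h]
    · rw [Real.sign_of_pos (by linarith), one_mul]
  have sn : ∀ x, x ≤ k → Real.sign (x - k) * (F x - F k) = -(F x - F k) := by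
    intro x hx
    rcases hx.eq_or_lt with h | h
    · simp [h]
    · rw [Real.sign_of_neg (by linarith), neg_one_mul]
  have hum : u ∈ Icc A B := ⟨hu, huv.trans hv⟩
  have hvm : v ∈ Icc A B := ⟨hu.trans huv, hv⟩
  rcases le_total k u with h1 | h1
  · rw [pos u v huv h1 hum hvm, sp u h1, sp v (h1.trans huv)]; ring
  · rcases le_total v k with h2 | h2
    · rw [neg u v huv h2 hum hvm, sn u h1, sn v h2]; ring
    · have hi : ∀ x y, x ≤ y → IntervalIntegrable (fun ξ => Real.sign (ξ - k) * d ξ) volume x y := by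
        intro x y _
        have hb : ∀ ξ, ‖Real.sign (ξ - k)‖ ≤ 1 := fun ξ => abs_sign_le _
        have hsm : AEStronglyMeasurable (fun ξ => Real.sign (ξ - k)) volume :=
          (measurable_sign_sub k).aestronglyMeasurable
        exact ⟨(hd x y).1.bdd_mul hsm.restrict (ae_of_all _ hb),
          (hd x y).2.bdd_mul hsm.restrict (ae_of_all _ hb)⟩
      rw [← intervalIntegral.integral_add_adjacent_intervals (hi u k h1) (hi k v h2),
        neg u k h1 le_rfl hum hk, pos k v h2 le_rfl hk hvm, sn u h1, sp v h2]
      ring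

theorem sign_mul_self (x : ℝ) : Real.sign x * x = |x| := by
  rcases lt_trichotomy x 0 with h | h | h
  · rw [Real.sign_of_neg h, abs_of_neg h]; ring
  · simp [h]
  · rw [Real.sign_of_pos h, abs_of_pos h]; ring

theorem integral_linear {X : Type*} [MeasurableSpace X] {μ : Measure X} {F₁ F₂ F₃ F₄ : X → ℝ}
    (h₁ : Integrable F₁ μ) (h₂ : Integrable F₂ μ) (h₃ : Integrable F₃ μ) (h₄ : Integrable F₄ μ)
    (A B D E : ℝ) : ∫ p, (A * F₁ p + (B * F₂ p + (D * F₃ p + E * F₄ p))) ∂μ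
      = A * ∫ p, F₁ p ∂μ + (B * ∫ p, F₂ p ∂μ + (D * ∫ p, F₃ p ∂μ + E * ∫ p, F₄ p ∂μ)) := by
  have j₃ : Integrable (fun p => D * F₃ p + E * F₄ p) μ := (h₃.const_mul D).add (h₄.const_mul E)
  have j₂ : Integrable (fun p => B * F₂ p + (D * F₃ p + E * F₄ p)) μ := (h₂.const_mul B).add j₃
  rw [integral_add (h₁.const_mul A) j₂, integral_add (h₂.const_mul B) j₃,
    integral_add (h₃.const_mul D) (h₄.const_mul E)]
  simp only [integral_const_mul]

/-- A shock between `uL ≤ uR` is an entropy solution. -/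
theorem isRiemannSolution_shock (hr : r.Admissible) {uL uR : ℝ} (hL : uL ∈ r.K) (hR : uR ∈ r.K)
    (hlt : uL < uR) : IsRiemannSolution r uL uR fun t x =>
      if x < (r.f uR - r.f uL) / (uR - uL) * t then uL else uR := by
  set c := (r.f uR - r.f uL) / (uR - uL) with hc
  have hcm : c * (uR - uL) = r.f uR - r.f uL := div_mul_cancel₀ _ (by linarith)
  have hms : MeasurableSet {p : ℝ × ℝ | p.2 < c * p.1} :=
    measurableSet_lt measurable_snd (measurable_fst.const_mul c)
  refine ⟨(Measurable.ite hms measurable_const measurable_const).aestronglyMeasurable,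
    ae_of_all _ fun p => by beta_reduce; split_ifs <;> assumption, fun k hk φ hφ hφc hφ0 => ?_⟩
  simp only [deriv_fst_eq hφ, deriv_snd_eq hφ]
  set w : ℝ → ℝ := fun x => if x < 0 then 1 else 0 with hw
  have hwm : Measurable w := Measurable.ite measurableSet_Iio measurable_const measurable_const
  have hwb : ∀ x, |w x| ≤ 1 := fun x => by simp only [hw]; split_ifs <;> simp
  set q : ℝ → ℝ := fun u => Real.sign (u - k) * (r.f u - r.f k) with hq
  -- entropy and entropy flux are affine in the indicator `w` of the left side of the shock; the
  -- transport part cancels against the initial data, and the defect of the jump condition remains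
  have e1 : ∀ p : ℝ × ℝ, |(if p.2 < c * p.1 then uL else uR) - k| * fderiv ℝ φ p (1, 0)
      + Real.sign ((if p.2 < c * p.1 then uL else uR) - k)
        * (r.f (if p.2 < c * p.1 then uL else uR) - r.f k) * fderiv ℝ φ p (0, 1)
      = (|uL - k| - |uR - k|) * (w (p.2 - c * p.1) *
          (fderiv ℝ φ p (1, 0) + c * fderiv ℝ φ p (0, 1)))
        + (|uR - k| * fderiv ℝ φ p (1, 0) + (q uR * fderiv ℝ φ p (0, 1)
        + (q uL - q uR - c * (|uL - k| - |uR - k|)) * (w (p.2 - c * p.1) * fderiv ℝ φ p (0, 1)))) := by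
    intro p
    by_cases h : p.2 < c * p.1
    · simp only [hw, h, if_true, sub_neg, hq]; ring
    · simp only [hw, h, if_false, sub_neg, hq]; ring
  have e2 : ∀ x : ℝ, |(if x < 0 then uL else uR) - k| * φ (0, x)
      = (|uL - k| - |uR - k|) * (w x * φ (0, x)) + |uR - k| * φ (0, x) := by
    intro x
    by_cases h : x < 0
    · simp only [hw, h, if_true]; ring
    · simp only [hw, h, if_false]; ring
  have iv : ∀ v, IntegrableOn (fun p => fderiv ℝ φ p v) (Ioi (0 : ℝ) ×ˢ (univ : Set ℝ)) := fun v =>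
    (integrable_fderiv hφ hφc v).integrableOn
  have hwc : AEStronglyMeasurable (fun p : ℝ × ℝ => w (p.2 - c * p.1))
      (volume.restrict (Ioi (0 : ℝ) ×ˢ (univ : Set ℝ))) :=
    (hwm.comp (by fun_prop : Measurable fun p : ℝ × ℝ => p.2 - c * p.1)).aestronglyMeasurable
  have iw : ∀ {F : ℝ × ℝ → ℝ}, IntegrableOn F (Ioi (0 : ℝ) ×ˢ (univ : Set ℝ)) →
      IntegrableOn (fun p => w (p.2 - c * p.1) * F p) (Ioi (0 : ℝ) ×ˢ (univ : Set ℝ)) := fun hF =>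
    hF.bdd_mul hwc (ae_of_all _ fun p => hwb _)
  have iφ : Integrable fun x => φ (0, x) :=
    (contDiff_slice_right hφ 0).continuous.integrable_of_hasCompactSupport
      (hasCompactSupport_slice_right hφc 0)
  have iwφ : Integrable fun x => w x * φ (0, x) :=
    iφ.bdd_mul hwm.aestronglyMeasurable (ae_of_all _ hwb)
  have j1 : IntegrableOn (fun p : ℝ × ℝ => w (p.2 - c * p.1) *
      (fderiv ℝ φ p (1, 0) + c * fderiv ℝ φ p (0, 1))) (Ioi (0 : ℝ) ×ˢ (univ : Set ℝ)) :=
    iw ((iv _).add ((iv _).const_mul c))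
  have j4 := iw (iv (0, 1))
  simp_rw [e1, e2]
  rw [integral_linear j1 (iv _) (iv _) j4, integral_add (iwφ.const_mul _) (iφ.const_mul _),
    integral_const_mul, integral_const_mul]
  have t1 := transport_identity hφ hφc hwm hwb c
  have t2 := integral_fderiv_time hφ hφc
  have t3 := integral_fderiv_space hφ hφc
  -- this integral is the one of `φ` along the shock
  have hnn : 0 ≤ ∫ p in Ioi (0 : ℝ) ×ˢ (univ : Set ℝ), w (p.2 - c * p.1) * fderiv ℝ φ p (0, 1) := by
    rw [Measure.volume_eq_prod, setIntegral_prod _ j4]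
    refine integral_nonneg fun t => ?_
    have h1 := (hasCompactSupport_slice_right hφc t).integral_Iic_deriv_eq
      ((contDiff_slice_right hφ t).of_le (by simp)) (c * t)
    have h2 : ∀ x, deriv (fun x => φ (t, x)) x = fderiv ℝ φ (t, x) (0, 1) := fun x =>
      deriv_snd_eq hφ (t, x)
    simp only [h2] at h1
    have h3 : (fun x => w (x - c * t) * fderiv ℝ φ (t, x) (0, 1))
        = (Iio (c * t)).indicator fun x => fderiv ℝ φ (t, x) (0, 1) := by
      ext x
      by_cases h : x < c * t <;> simp [hw, h]
    simp only [Pi.zero_apply]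
    rw [Measure.restrict_univ, h3, integral_indicator measurableSet_Iio,
      ← integral_Iic_eq_integral_Iio, h1]
    exact hφ0 _
  -- the jump condition; if `k` lies between the two states, it is the concavity of the flux
  have hjump : 0 ≤ q uL - q uR - c * (|uL - k| - |uR - k|) := by
    rcases le_or_gt k uL with h1 | h1
    · have e3 : ∀ x, k ≤ x → q x = r.f x - r.f k := fun x hx => by
        rcases hx.eq_or_lt with h | h
        · simp [hq, h]
        · simp only [hq]; rw [Real.sign_of_pos (by linarith), one_mul]
      rw [e3 uL h1, e3 uR (h1.trans hlt.le), abs_of_nonneg (by linarith), abs_of_nonneg (by linarith)]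
      linarith
    · rcases le_or_gt uR k with h2 | h2
      · have e3 : ∀ x, x ≤ k → q x = -(r.f x - r.f k) := fun x hx => by
          rcases hx.eq_or_lt with h | h
          · simp [hq, h]
          · simp only [hq]; rw [Real.sign_of_neg (by linarith), neg_one_mul]
        rw [e3 uL h1.le, e3 uR h2, abs_of_nonpos (by linarith), abs_of_nonpos (by linarith)]
        linarith
      · simp only [hq]
        rw [Real.sign_of_neg (by linarith : uL - k < 0), Real.sign_of_pos (by linarith : 0 < uR - k),
          abs_of_neg (by linarith : uL - k < 0), abs_of_pos (by linarith : 0 < uR - k)]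
        have hd : 0 < uR - uL := by linarith
        have ha : 0 ≤ (uR - k) / (uR - uL) := div_nonneg (by linarith) hd.le
        have hb : 0 ≤ (k - uL) / (uR - uL) := div_nonneg (by linarith) hd.le
        have hconc := hr.concave.2 hL hR ha hb (by field_simp; ring)
        have e4 : (uR - k) / (uR - uL) * uL + (k - uL) / (uR - uL) * uR = k := by field_simp; ring
        simp only [smul_eq_mul, e4] at hconc
        have e5 : (uR - k) / (uR - uL) * r.f uL + (k - uL) / (uR - uL) * r.f uR
            = r.f uL + c * (k - uL) := by rw [hc]; field_simp; ring
        rw [e5] at hconc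
        linarith
  have := mul_nonneg hjump hnn
  rw [t3]
  linear_combination this + (-(|uL - k| - |uR - k|)) * t1 - |uR - k| * t2

end

section
variable {r : Road}

/-- An initial segment of an interval, described by its length. -/
theorem integral_initial_segment {S : Set ℝ} (hS : MeasurableSet S) {u v : ℝ} (huv : u ≤ v)
    (hdown : ∀ ξ ∈ S, ∀ ζ ≤ ξ, ζ ∈ S) {z : ℝ}
    (hz : z = u + ∫ ξ in u..v, S.indicator (fun _ => (1 : ℝ)) ξ) :
    z ∈ Icc u v ∧ ∀ g : ℝ → ℝ, ∫ ξ in u..v, S.indicator g ξ = ∫ ξ in u..z, g ξ := by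
  have hint : ∀ g : ℝ → ℝ, ∫ ξ in u..v, S.indicator g ξ = ∫ ξ in Ioc u v ∩ S, g ξ := by
    intro g
    rw [intervalIntegral.integral_of_le huv, integral_indicator hS,
      Measure.restrict_restrict hS, inter_comm]
  have hvol : z - u = volume.real (Ioc u v ∩ S) := by
    rw [hz, hint]; simp
  have hfin : ∀ x y : ℝ, volume (Ioc x y) ≠ ⊤ := fun x y => by simp
  have hz1 : u ≤ z := by
    have : 0 ≤ volume.real (Ioc u v ∩ S) := measureReal_nonneg
    linarith
  have hz2 : z ≤ v := by
    have : volume.real (Ioc u v ∩ S) ≤ volume.real (Ioc u v) :=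
      measureReal_mono inter_subset_left (hfin _ _)
    rw [Real.volume_real_Ioc_of_le huv] at this
    linarith
  refine ⟨⟨hz1, hz2⟩, fun g => ?_⟩
  rw [hint, intervalIntegral.integral_of_le hz1]
  refine setIntegral_congr_set ?_
  filter_upwards [Measure.ae_ne volume z] with ξ hne
  refine propext ⟨fun hm => ?_, fun hm => ?_⟩
  · have hm' : ξ ∈ Ioc u v ∩ S := hm
    refine ⟨hm'.1.1, ?_⟩
    have hsub : Ioc u ξ ⊆ Ioc u v ∩ S := fun ζ hζ =>
      ⟨⟨hζ.1, hζ.2.trans hm'.1.2⟩, hdown ξ hm'.2 ζ hζ.2⟩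
    have : volume.real (Ioc u ξ) ≤ volume.real (Ioc u v ∩ S) :=
      measureReal_mono hsub (measure_ne_top_of_subset inter_subset_left (hfin _ _))
    rw [Real.volume_real_Ioc_of_le hm'.1.1.le] at this
    linarith
  · have hm' : ξ ∈ Ioc u z := hm
    have hlt : ξ < z := lt_of_le_of_ne hm'.2 hne
    refine (show ξ ∈ Ioc u v ∩ S from ⟨⟨hm'.1, hm'.2.trans hz2⟩, ?_⟩)
    by_contra hcon
    have hsub : Ioc u v ∩ S ⊆ Ioc u ξ := fun ζ hζ =>
      ⟨hζ.1.1, le_of_not_gt fun hgt => hcon (hdown ζ hζ.2 ξ hgt.le)⟩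
    have : volume.real (Ioc u v ∩ S) ≤ volume.real (Ioc u ξ) := measureReal_mono hsub (hfin _ _)
    rw [Real.volume_real_Ioc_of_le hm'.1.le] at this
    linarith

/-- The rarefaction wave between `uL` and `uR ≤ uL`: the level `ξ` moves with speed `f' ξ`. -/
noncomputable def rarefaction (r : Road) (uL uR t x : ℝ) : ℝ :=
  uR + ∫ ξ in uR..uL, {ξ | x < r.vel 1 ξ * t}.indicator (fun _ => (1 : ℝ)) ξ

/-- Rarefaction waves are entropy solutions: every entropy is a superposition of indicators of
levels, each of which is transported with its own characteristic speed. -/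
theorem isRiemannSolution_rarefaction (hr : r.Admissible) {uL uR : ℝ} (hL : uL ∈ r.K)
    (hR : uR ∈ r.K) (hle : uR ≤ uL) : IsRiemannSolution r uL uR (rarefaction r uL uR) := by
  set d := r.vel 1 with hd
  have hdm : Measurable d := hr.antitone_vel_one.measurable
  obtain ⟨A, hA⟩ := (hr.isVelocity one_ne_zero).bounded
  have hSm : ∀ t x : ℝ, MeasurableSet {ξ | x < d ξ * t} := fun t x =>
    measurableSet_lt measurable_const (hdm.mul_const t)
  have hseg : ∀ t x : ℝ, 0 < t → rarefaction r uL uR t x ∈ Icc uR uL ∧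
      ∀ g : ℝ → ℝ, ∫ ξ in uR..uL, {ξ | x < d ξ * t}.indicator g ξ
        = ∫ ξ in uR..rarefaction r uL uR t x, g ξ := fun t x ht =>
    integral_initial_segment (hSm t x) hle (fun ξ (hξ : x < d ξ * t) ζ hζ =>
      lt_of_lt_of_le hξ (mul_le_mul_of_nonneg_right (hr.antitone_vel_one hζ) ht.le)) rfl
  have hum : Measurable fun p : ℝ × ℝ => rarefaction r uL uR p.1 p.2 := by
    have hmm : Measurable fun q : (ℝ × ℝ) × ℝ =>
        {ξ | q.1.2 < d ξ * q.1.1}.indicator (fun _ => (1 : ℝ)) q.2 := by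
      have : MeasurableSet {q : (ℝ × ℝ) × ℝ | q.1.2 < d q.2 * q.1.1} :=
        measurableSet_lt (measurable_snd.comp measurable_fst)
          ((hdm.comp measurable_snd).mul (measurable_fst.comp measurable_fst))
      exact Measurable.ite this measurable_const measurable_const
    unfold rarefaction
    simp only [intervalIntegral]
    exact measurable_const.add
      ((hmm.stronglyMeasurable.integral_prod_right (ν := volume.restrict (Ioc uR uL))).measurable.sub
        (hmm.stronglyMeasurable.integral_prod_right
          (ν := volume.restrict (Ioc uL uR))).measurable)
  have hpos : ∀ᵐ p : ℝ × ℝ ∂(volume.restrict (Ioi (0 : ℝ) ×ˢ (univ : Set ℝ))), 0 < p.1 := by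
    filter_upwards [ae_restrict_mem (measurableSet_Ioi.prod MeasurableSet.univ)] with p hp
      using hp.1
  refine ⟨hum.aestronglyMeasurable, ?_, fun k hk φ hφ hφc hφ0 => le_of_eq ?_⟩
  · filter_upwards [hpos] with p hp
    have := (hseg p.1 p.2 hp).1
    exact ⟨hR.1.trans this.1, this.2.trans hL.2⟩
  simp only [deriv_fst_eq hφ, deriv_snd_eq hφ]
  set w : ℝ → ℝ := fun x => if x < 0 then 1 else 0 with hw
  have hwm : Measurable w := Measurable.ite measurableSet_Iio measurable_const measurable_const
  have hwb : ∀ x, |w x| ≤ 1 := fun x => by simp only [hw]; split_ifs <;> simp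
  set sg : ℝ → ℝ := fun ξ => Real.sign (ξ - k) with hsg
  set q : ℝ → ℝ := fun u => Real.sign (u - k) * (r.f u - r.f k) with hq
  set H : ℝ × ℝ → ℝ → ℝ := fun p ξ => sg ξ * (w (p.2 - d ξ * p.1) *
    (fderiv ℝ φ p (1, 0) + d ξ * fderiv ℝ φ p (0, 1))) with hH
  have hdi : ∀ x y, IntervalIntegrable d volume x y := hr.intervalIntegrable_vel
  -- entropy and entropy flux as superpositions over the levels `ξ`
  have heta : ∀ v ∈ Icc uR uL, |v - k| = |uR - k| + ∫ ξ in uR..v, sg ξ := by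
    intro v hv
    have := integral_sign_mul (F := fun x => x) (d := fun _ => 1) (u := uR) (v := v) (k := k) hv.1
      (fun x y => by simp) hR.1 (hv.2.trans hL.2) hk (fun x y _ _ => by simp)
    simp only [mul_one, sign_mul_self] at this
    rw [this]; ring
  have hqeq : ∀ v ∈ Icc uR uL, q v = q uR + ∫ ξ in uR..v, sg ξ * d ξ := by
    intro v hv
    have := integral_sign_mul (F := r.f) (d := d) (u := uR) (v := v) (k := k) hv.1
      hdi hR.1 (hv.2.trans hL.2) hk (fun x y hx hy => hr.integral_vel hx hy)
    rw [this]; ring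
  have hsgi : ∀ x y, IntervalIntegrable sg volume x y := fun x y =>
    (intervalIntegrable_const (c := (1 : ℝ))).mono_fun' (measurable_sign_sub k).aestronglyMeasurable
      (ae_of_all _ fun ξ => abs_sign_le _)
  have hA0 : 0 ≤ A := (abs_nonneg _).trans (hA 0)
  have hsgdi : ∀ x y, IntervalIntegrable (fun ξ => sg ξ * d ξ) volume x y := fun x y =>
    (intervalIntegrable_const (c := 1 * A)).mono_fun'
      ((measurable_sign_sub k).mul hdm).aestronglyMeasurable
      (ae_of_all _ fun ξ => by
        beta_reduce
        rw [Real.norm_eq_abs, abs_mul]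
        exact mul_le_mul (abs_sign_le _) (hA ξ) (abs_nonneg _) zero_le_one)
  have hwind : ∀ (t x ξ c : ℝ), w (x - d ξ * t) * c = {ξ | x < d ξ * t}.indicator (fun _ => c) ξ := by
    intro t x ξ c
    by_cases h : x < d ξ * t <;> simp [hw, h]
  have e1 : ∀ᵐ p : ℝ × ℝ ∂(volume.restrict (Ioi (0 : ℝ) ×ˢ (univ : Set ℝ))),
      |rarefaction r uL uR p.1 p.2 - k| * fderiv ℝ φ p (1, 0)
        + Real.sign (rarefaction r uL uR p.1 p.2 - k) * (r.f (rarefaction r uL uR p.1 p.2) - r.f k)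
          * fderiv ℝ φ p (0, 1)
      = (|uR - k| * fderiv ℝ φ p (1, 0) + q uR * fderiv ℝ φ p (0, 1))
        + ∫ ξ in uR..uL, H p ξ := by
    filter_upwards [hpos] with p hp
    have h1 := hseg p.1 p.2 hp
    have h2 : ∫ ξ in uR..uL, H p ξ = ∫ ξ in uR..rarefaction r uL uR p.1 p.2,
        (sg ξ * fderiv ℝ φ p (1, 0) + sg ξ * d ξ * fderiv ℝ φ p (0, 1)) := by
      rw [← h1.2]
      congr 1
      ext ξ
      simp only [hH, hwind]
      by_cases h : p.2 < d ξ * p.1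
      · simp [h]; ring
      · simp [h]
    rw [h2, intervalIntegral.integral_add ((hsgi _ _).mul_const _) ((hsgdi _ _).mul_const _),
      intervalIntegral.integral_mul_const, intervalIntegral.integral_mul_const, heta _ h1.1]
    have h3 := hqeq _ h1.1
    simp only [hq] at h3 ⊢
    rw [h3]; ring
  have e2 : ∀ x : ℝ, |(if x < 0 then uL else uR) - k| * φ (0, x)
      = (∫ ξ in uR..uL, sg ξ) * (w x * φ (0, x)) + |uR - k| * φ (0, x) := by
    intro x
    by_cases h : x < 0
    · simp only [hw, h, if_true, heta uL ⟨hle, le_rfl⟩]; ring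
    · simp only [hw, h, if_false]; ring
  have iφ : Integrable fun x => φ (0, x) :=
    (contDiff_slice_right hφ 0).continuous.integrable_of_hasCompactSupport
      (hasCompactSupport_slice_right hφc 0)
  have iwφ : Integrable fun x => w x * φ (0, x) :=
    iφ.bdd_mul hwm.aestronglyMeasurable (ae_of_all _ hwb)
  have iv : ∀ v, IntegrableOn (fun p => fderiv ℝ φ p v) (Ioi (0 : ℝ) ×ˢ (univ : Set ℝ)) := fun v =>
    (integrable_fderiv hφ hφc v).integrableOn
  have hHm : Measurable (Function.uncurry H) := by
    have f1 : ∀ v, Measurable fun q : (ℝ × ℝ) × ℝ => fderiv ℝ φ q.1 v := fun v =>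
      (((hφ.continuous_fderiv (by simp)).clm_apply continuous_const).measurable).comp measurable_fst
    have f2 : Measurable fun q : (ℝ × ℝ) × ℝ => d q.2 := hdm.comp measurable_snd
    have f3 : Measurable fun q : (ℝ × ℝ) × ℝ => w (q.1.2 - d q.2 * q.1.1) :=
      hwm.comp ((measurable_snd.comp measurable_fst).sub
        (f2.mul (measurable_fst.comp measurable_fst)))
    exact ((measurable_sign_sub k).comp measurable_snd).mul (f3.mul ((f1 _).add (f2.mul (f1 _))))
  have hHi : Integrable (Function.uncurry H)
      ((volume.restrict (Ioi (0 : ℝ) ×ˢ (univ : Set ℝ))).prod (volume.restrict (uIoc uR uL))) := by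
    have : IsFiniteMeasure (volume.restrict (uIoc uR uL)) :=
      isFiniteMeasure_restrict.2 (by simp [uIoc])
    refine ((((iv (1, 0)).abs.add ((iv (0, 1)).abs.const_mul A))).mul_prod
      (integrable_const (1 : ℝ))).mono' hHm.aestronglyMeasurable (ae_of_all _ fun p => ?_)
    simp only [Function.uncurry, hH, Real.norm_eq_abs, abs_mul, Pi.add_apply, mul_one]
    have h1 : |fderiv ℝ φ p.1 (1, 0) + d p.2 * fderiv ℝ φ p.1 (0, 1)|
        ≤ |fderiv ℝ φ p.1 (1, 0)| + A * |fderiv ℝ φ p.1 (0, 1)| := by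
      refine (abs_add_le _ _).trans (add_le_add_right ?_ _)
      rw [abs_mul]
      exact mul_le_mul_of_nonneg_right (hA _) (abs_nonneg _)
    calc |sg p.2| * (|w (p.1.2 - d p.2 * p.1.1)| * |fderiv ℝ φ p.1 (1, 0)
          + d p.2 * fderiv ℝ φ p.1 (0, 1)|)
        ≤ 1 * (1 * (|fderiv ℝ φ p.1 (1, 0)| + A * |fderiv ℝ φ p.1 (0, 1)|)) := by
          refine mul_le_mul (abs_sign_le _) (mul_le_mul (hwb _) h1 (abs_nonneg _) zero_le_one)
            (by positivity) zero_le_one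
      _ = _ := by ring
  have hswap : ∫ p in Ioi (0 : ℝ) ×ˢ (univ : Set ℝ), ∫ ξ in uR..uL, H p ξ
      = -((∫ ξ in uR..uL, sg ξ) * ∫ x, w x * φ (0, x)) := by
    rw [← intervalIntegral_integral_swap (f := fun ξ p => H p ξ) hHi.swap,
      ← intervalIntegral.integral_mul_const, ← intervalIntegral.integral_neg]
    congr 1
    ext ξ
    have := transport_identity hφ hφc hwm hwb (d ξ)
    simp only [hH]
    rw [integral_const_mul, eq_neg_of_add_eq_zero_left this]; ring
  have iH : IntegrableOn (fun p => ∫ ξ in uR..uL, H p ξ) (Ioi (0 : ℝ) ×ˢ (univ : Set ℝ)) := by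
    have := hHi.integral_prod_left
    rw [uIoc_of_le hle] at this
    simp only [intervalIntegral.integral_of_le hle]
    exact this
  have i12 : IntegrableOn (fun p => |uR - k| * fderiv ℝ φ p (1, 0) + q uR * fderiv ℝ φ p (0, 1))
      (Ioi (0 : ℝ) ×ˢ (univ : Set ℝ)) := ((iv _).const_mul _).add ((iv _).const_mul _)
  rw [integral_congr_ae e1, integral_add i12 iH,
    integral_add ((iv _).const_mul _) ((iv _).const_mul _), hswap]
  simp_rw [e2]
  rw [integral_add (iwφ.const_mul _) (iφ.const_mul _), integral_const_mul, integral_const_mul,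
    integral_const_mul, integral_const_mul]
  have t2 := integral_fderiv_time hφ hφc
  have t3 := integral_fderiv_space hφ hφc
  linear_combination (-|uR - k|) * t2 - q uR * t3

end

section
variable {n m : ℕ} {r : Road}

theorem hasTrace_of_eq {h : Fin n ⊕ Fin m} {u : ℝ → ℝ → ℝ} {c : ℝ}
    (hu : ∀ t x, 0 < t → x ∈ dom h → u t x = c) : HasTrace h u c := by
  intro T
  refine tendsto_const_nhds.congr' ?_
  have : ∀ᶠ x in 𝓝[dom h] (0 : ℝ) ⊓ ae volume, x ∈ dom h :=
    (eventually_mem_nhdsWithin (s := dom h)).filter_mono inf_le_left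
  filter_upwards [this] with x hx
  symm
  rw [setLIntegral_congr_fun (g := fun _ => 0) measurableSet_Ioo
    (fun t ht => by simp only [hu t x ht.1 hx, sub_self, enorm_zero]), lintegral_zero]

theorem Road.Admissible.lt_of_df_pos (hr : r.Admissible) {x ξ : ℝ} (hx : x ∈ r.K) (hξ : ξ ∈ r.K)
    (hlt : x < ξ) (h : 0 < r.df ξ) : r.f x < r.f ξ := by
  have : 0 < ∫ ζ in x..ξ, r.vel 1 ζ := by
    refine intervalIntegral.intervalIntegral_pos_of_pos_on
      (hr.intervalIntegrable_vel _ _) (fun ζ hζ => ?_) hlt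
    have hζK : ζ ∈ r.K := ⟨hx.1.trans hζ.1.le, hζ.2.le.trans hξ.2⟩
    rw [Road.vel_eq r hζK, one_mul]
    exact lt_of_lt_of_le h (hr.antitone hζK hξ hζ.2.le)
  rw [hr.integral_vel hx hξ] at this
  linarith

theorem Road.Admissible.lt_of_df_neg (hr : r.Admissible) {y ξ : ℝ} (hy : y ∈ r.K) (hξ : ξ ∈ r.K)
    (hlt : ξ < y) (h : r.df ξ < 0) : r.f y < r.f ξ := by
  have : 0 < ∫ ζ in ξ..y, -r.vel 1 ζ := by
    refine intervalIntegral.intervalIntegral_pos_of_pos_on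
      (hr.intervalIntegrable_vel _ _).neg (fun ζ hζ => ?_) hlt
    have hζK : ζ ∈ r.K := ⟨hξ.1.trans hζ.1.le, hζ.2.le.trans hy.2⟩
    rw [Road.vel_eq r hζK, one_mul]
    linarith [hr.antitone hξ hζK hζ.1.le]
  rw [intervalIntegral.integral_neg, hr.integral_vel hξ hy] at this
  linarith

/-- For strictly compatible states all waves of the Riemann problem leave the road. -/
theorem exists_riemannSolution (hr : r.Admissible) (h : Fin n ⊕ Fin m) {ρh ρb : ℝ}
    (hh : ρh ∈ r.K) (hb : ρb ∈ r.K)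
    (hc : StrictlyCompatible (fun k => -sgn h * r.f k) ρh ρb) :
    ∃ u, IsRiemannSolution r (leftState h ρb ρh) (rightState h ρb ρh) u ∧ HasTrace h u ρb := by
  rcases h with i | j
  · simp only [sgn, Sum.elim_inl, neg_mul, one_mul, StrictlyCompatible, neg_lt_neg_iff] at hc
    simp only [leftState, rightState, Sum.elim_inl]
    rcases lt_or_ge ρb ρh with hlt | hle
    · refine ⟨_, isRiemannSolution_shock hr hb hh hlt, hasTrace_of_eq fun t x ht hx => ?_⟩
      have hx' : x < 0 := by simpa [dom] using hx
      have hs : 0 < (r.f ρh - r.f ρb) / (ρh - ρb) :=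
        div_pos (by linarith [hc.1 ρh hlt le_rfl]) (by linarith)
      exact if_pos (hx'.trans (mul_pos hs ht))
    · refine ⟨_, isRiemannSolution_rarefaction hr hb hh hle, hasTrace_of_eq fun t x ht hx => ?_⟩
      have hx' : x < 0 := by simpa [dom] using hx
      have e : ∫ ξ in ρh..ρb, {ξ | x < r.vel 1 ξ * t}.indicator (fun _ => (1 : ℝ)) ξ
          = ∫ ξ in ρh..ρb, (1 : ℝ) := by
        refine intervalIntegral.integral_congr_ae ?_
        filter_upwards [Measure.ae_ne volume ρb] with ξ hne hξ
        rw [uIoc_of_le hle] at hξ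
        have hlt : ξ < ρb := lt_of_le_of_ne hξ.2 hne
        have hξK : ξ ∈ r.K := ⟨hh.1.trans hξ.1.le, hξ.2.trans hb.2⟩
        have hd : 0 ≤ r.vel 1 ξ := by
          rw [Road.vel_eq r hξK, one_mul]
          by_contra hneg
          have := hr.lt_of_df_neg hb hξK hlt (not_le.1 hneg)
          linarith [hc.2 ξ hξ.1.le hlt]
        have hm : ξ ∈ {ξ | x < r.vel 1 ξ * t} := lt_of_lt_of_le hx' (mul_nonneg hd ht.le)
        exact indicator_of_mem hm _
      rw [rarefaction, e]
      simp
  · simp only [sgn, Sum.elim_inr, neg_neg, one_mul, StrictlyCompatible] at hc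
    simp only [leftState, rightState, Sum.elim_inr]
    rcases lt_or_ge ρh ρb with hlt | hle
    · refine ⟨_, isRiemannSolution_shock hr hh hb hlt, hasTrace_of_eq fun t x ht hx => ?_⟩
      have hx' : 0 < x := by simpa [dom] using hx
      have hs : (r.f ρb - r.f ρh) / (ρb - ρh) < 0 :=
        div_neg_of_neg_of_pos (by linarith [hc.2 ρh le_rfl hlt]) (by linarith)
      exact if_neg (not_lt.2 ((mul_neg_of_neg_of_pos hs ht).trans hx').le)
    · refine ⟨_, isRiemannSolution_rarefaction hr hh hb hle, hasTrace_of_eq fun t x ht hx => ?_⟩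
      have hx' : 0 < x := by simpa [dom] using hx
      have e : ∫ ξ in ρb..ρh, {ξ | x < r.vel 1 ξ * t}.indicator (fun _ => (1 : ℝ)) ξ
          = ∫ ξ in ρb..ρh, (0 : ℝ) := by
        refine intervalIntegral.integral_congr_ae (ae_of_all _ fun ξ hξ => ?_)
        rw [uIoc_of_le hle] at hξ
        have hξK : ξ ∈ r.K := ⟨hb.1.trans hξ.1.le, hξ.2.trans hh.2⟩
        have hd : r.vel 1 ξ ≤ 0 := by
          rw [Road.vel_eq r hξK, one_mul]
          by_contra hpos
          have := hr.lt_of_df_pos hb hξK hξ.1 (not_le.1 hpos)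
          linarith [hc.1 ξ hξ.1 hξ.2]
        have hm : ξ ∉ {ξ | x < r.vel 1 ξ * t} :=
          not_lt.2 ((mul_nonpos_of_nonpos_of_nonneg hd ht.le).trans hx'.le)
        exact indicator_of_notMem hm _
      rw [rarefaction, e]
      simp

end

/-! ### Traces of entropy solutions -/

section
open Real (smoothTransition)

theorem contDiff_smoothTransition : ContDiff ℝ ∞ smoothTransition := Real.smoothTransition.contDiff

theorem hasDerivAt_smoothTransition (y : ℝ) :
    HasDerivAt smoothTransition (deriv smoothTransition y) y :=
  (contDiff_smoothTransition.differentiable (by simp) y).hasDerivAt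

theorem deriv_smoothTransition_nonneg (y : ℝ) : 0 ≤ deriv smoothTransition y :=
  Real.smoothTransition.monotone.deriv_nonneg

theorem deriv_smoothTransition_of_neg {y : ℝ} (hy : y < 0) : deriv smoothTransition y = 0 := by
  have : smoothTransition =ᶠ[𝓝 y] fun _ => 0 := by
    filter_upwards [gt_mem_nhds hy] with z hz
    exact Real.smoothTransition.zero_of_nonpos hz.le
  rw [this.deriv_eq, deriv_const]

theorem deriv_smoothTransition_of_one_lt {y : ℝ} (hy : 1 < y) : deriv smoothTransition y = 0 := by
  have : smoothTransition =ᶠ[𝓝 y] fun _ => 1 := by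
    filter_upwards [lt_mem_nhds hy] with z hz
    exact Real.smoothTransition.one_of_one_le hz.le
  rw [this.deriv_eq, deriv_const]

theorem continuous_deriv_smoothTransition : Continuous (deriv smoothTransition) :=
  contDiff_smoothTransition.continuous_deriv (by simp)

theorem hasCompactSupport_deriv_smoothTransition : HasCompactSupport (deriv smoothTransition) := by
  refine HasCompactSupport.intro (isCompact_Icc (a := (0 : ℝ)) (b := 1)) fun y hy => ?_
  rw [mem_Icc, not_and_or, not_le, not_le] at hy
  exact hy.elim deriv_smoothTransition_of_neg deriv_smoothTransition_of_one_lt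

theorem integral_deriv_smoothTransition : ∫ y, deriv smoothTransition y = 1 := by
  rw [integral_of_hasDerivAt_of_tendsto (m := 0) (n := 1) hasDerivAt_smoothTransition
    (continuous_deriv_smoothTransition.integrable_of_hasCompactSupport
      hasCompactSupport_deriv_smoothTransition)]
  · simp
  · refine tendsto_const_nhds.congr' ?_
    filter_upwards [eventually_le_atBot 0] with y hy
    exact (Real.smoothTransition.zero_of_nonpos hy).symm
  · refine tendsto_const_nhds.congr' ?_
    filter_upwards [eventually_ge_atTop 1] with y hy
    exact (Real.smoothTransition.one_of_one_le hy).symm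

/-- The mass of the derivative of the cutoff `x ↦ smoothTransition (2 - τ x / δ)`. -/
theorem integral_cutoff_deriv {τ δ : ℝ} (hτ : |τ| = 1) (hδ : 0 < δ) :
    ∫ x, deriv smoothTransition (2 - τ * x / δ) / δ = 1 := by
  have e : ∀ x, deriv smoothTransition (2 - τ * x / δ) / δ
      = δ⁻¹ * (fun y => deriv smoothTransition (2 - y)) (τ / δ * x) := by
    intro x
    have : τ * x / δ = τ / δ * x := by ring
    simp only [this]; ring
  simp_rw [e]
  rw [integral_const_mul, Measure.integral_comp_mul_left (fun y => deriv smoothTransition (2 - y)),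
    integral_sub_left_eq_self (deriv smoothTransition) volume 2, integral_deriv_smoothTransition,
    inv_div, abs_div, hτ, abs_of_pos hδ]
  simp only [div_one, smul_eq_mul, mul_one]
  exact inv_mul_cancel₀ hδ.ne'

/-- The test function in the proof of `flux_nonpos_of_trace`: a weight which for `t ≥ 0` is supported
in `A t + x² ≤ 2` and decreases in time, cut off between `τ x = δ` and `τ x = 2 δ`. The second
factor equals one for `t ≥ 0` and makes the support compact. -/
noncomputable def coneTest (A τ δ : ℝ) (p : ℝ × ℝ) : ℝ :=
  smoothTransition (2 - A * p.1 - p.2 ^ 2) * smoothTransition (p.1 + 1)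
    * smoothTransition (2 - τ * p.2 / δ)

theorem contDiff_coneTest (A τ δ : ℝ) : ContDiff ℝ ∞ (coneTest A τ δ) := by
  unfold coneTest
  refine ContDiff.mul (ContDiff.mul ?_ ?_) ?_ <;>
    exact contDiff_smoothTransition.comp (by fun_prop)

theorem hasCompactSupport_cone {A : ℝ} (hA : 0 < A) : HasCompactSupport fun p : ℝ × ℝ =>
    smoothTransition (2 - A * p.1 - p.2 ^ 2) * smoothTransition (p.1 + 1) := by
  refine HasCompactSupport.intro ((isCompact_Icc (a := (-1 : ℝ)) (b := 2 / A)).prod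
    (isCompact_Icc (a := -(2 + A)) (b := 2 + A))) fun p hp => ?_
  by_contra hne
  rw [mul_eq_zero, not_or, Real.smoothTransition.zero_iff_nonpos,
    Real.smoothTransition.zero_iff_nonpos, not_le, not_le] at hne
  refine hp ⟨⟨by linarith, ?_⟩, ?_, ?_⟩
  · rw [le_div_iff₀ hA]; nlinarith [sq_nonneg p.2]
  · nlinarith
  · nlinarith

theorem hasCompactSupport_coneTest {A : ℝ} (hA : 0 < A) (τ δ : ℝ) :
    HasCompactSupport (coneTest A τ δ) :=
  (hasCompactSupport_cone hA).mul_right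

theorem coneTest_nonneg (A τ δ : ℝ) (p : ℝ × ℝ) : 0 ≤ coneTest A τ δ p :=
  mul_nonneg (mul_nonneg (Real.smoothTransition.nonneg _) (Real.smoothTransition.nonneg _))
    (Real.smoothTransition.nonneg _)

theorem coneTest_fst {A τ δ : ℝ} {p : ℝ × ℝ} (hp : 0 < p.1) :
    fderiv ℝ (coneTest A τ δ) p (1, 0) = -A * deriv smoothTransition (2 - A * p.1 - p.2 ^ 2)
      * smoothTransition (2 - τ * p.2 / δ) := by
  rw [← deriv_fst_eq (contDiff_coneTest A τ δ)]
  have : (fun t => coneTest A τ δ (t, p.2)) =ᶠ[𝓝 p.1] fun t =>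
      smoothTransition (2 - A * t - p.2 ^ 2) * smoothTransition (2 - τ * p.2 / δ) := by
    filter_upwards [lt_mem_nhds hp] with t ht
    rw [coneTest, Real.smoothTransition.one_of_one_le (x := t + 1) (by linarith), mul_one]
  rw [this.deriv_eq]
  have h1 : HasDerivAt (fun t => 2 - A * t - p.2 ^ 2) (-A) p.1 := by
    simpa using (((hasDerivAt_id p.1).const_mul A).const_sub 2).sub_const (p.2 ^ 2)
  have h2 := ((hasDerivAt_smoothTransition (2 - A * p.1 - p.2 ^ 2)).comp p.1 h1).mul_const
    (smoothTransition (2 - τ * p.2 / δ))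
  exact h2.deriv.trans (by ring)

theorem coneTest_snd {A τ δ : ℝ} {p : ℝ × ℝ} (hp : 0 < p.1) :
    fderiv ℝ (coneTest A τ δ) p (0, 1) = -2 * p.2 * deriv smoothTransition (2 - A * p.1 - p.2 ^ 2)
      * smoothTransition (2 - τ * p.2 / δ)
      - smoothTransition (2 - A * p.1 - p.2 ^ 2)
        * (τ * (deriv smoothTransition (2 - τ * p.2 / δ) / δ)) := by
  rw [← deriv_snd_eq (contDiff_coneTest A τ δ)]
  have : (fun x => coneTest A τ δ (p.1, x)) = fun x =>
      smoothTransition (2 - A * p.1 - x ^ 2) * smoothTransition (2 - τ * x / δ) := by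
    ext x
    rw [coneTest, Real.smoothTransition.one_of_one_le (x := p.1 + 1) (by linarith), mul_one]
  rw [this]
  have h1 : HasDerivAt (fun x => 2 - A * p.1 - x ^ 2) (-(2 * p.2)) p.2 := by
    simpa using (hasDerivAt_pow 2 p.2).const_sub (2 - A * p.1)
  have h2 : HasDerivAt (fun x => 2 - τ * x / δ) (-(τ / δ)) p.2 := by
    simpa using (((hasDerivAt_id p.2).const_mul τ).div_const δ).const_sub 2
  have h3 := ((hasDerivAt_smoothTransition (2 - A * p.1 - p.2 ^ 2)).comp p.2 h1).mul
    ((hasDerivAt_smoothTransition (2 - τ * p.2 / δ)).comp p.2 h2)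
  refine h3.deriv.trans ?_
  simp only [Function.comp]
  ring

/-- Let `e` be a nonnegative entropy with flux `w` and finite speed of propagation `|w| ≤ L e` which
vanishes initially on the side `τ x < 0` of the junction. Then `w` cannot flow out of that side: the
trace of `τ w` from the other side is not positive. Indeed, if the weight decreases sufficiently fast
in time, testing with `coneTest` leaves the flux near `τ x = δ` with a negative sign, and the initial
values contribute only `O(δ)`. -/
theorem flux_nonpos_of_trace {τ C L Q : ℝ} {e w : ℝ × ℝ → ℝ} {E : ℝ → ℝ} (hτ : |τ| = 1)
    (hL : 0 ≤ L) (hC : 0 ≤ C)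
    (hem : AEStronglyMeasurable e (volume.restrict (Ioi 0 ×ˢ univ)))
    (hwm : AEStronglyMeasurable w (volume.restrict (Ioi 0 ×ˢ univ)))
    (he : ∀ᵐ p ∂(volume.restrict (Ioi 0 ×ˢ univ)), 0 ≤ e p ∧ e p ≤ C)
    (hwe : ∀ᵐ p ∂(volume.restrict (Ioi 0 ×ˢ univ)), |w p| ≤ L * e p)
    (hE0 : ∀ x, τ * x < 0 → E x = 0) (hE : ∀ x, |E x| ≤ C)
    (ineq : ∀ φ : ℝ × ℝ → ℝ, ContDiff ℝ ∞ φ → HasCompactSupport φ → (∀ p, 0 ≤ φ p) →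
      0 ≤ (∫ p in Ioi (0 : ℝ) ×ˢ (univ : Set ℝ),
        (e p * fderiv ℝ φ p (1, 0) + w p * fderiv ℝ φ p (0, 1))) + ∫ x, E x * φ (0, x))
    (htr : ∀ T : ℝ, Tendsto (fun x => ∫⁻ t in Ioo 0 T, ‖w (t, x) - Q‖ₑ)
      (𝓝[{x | 0 < τ * x}] 0 ⊓ ae volume) (𝓝 0)) : τ * Q ≤ 0 := by
  by_contra hQ
  push Not at hQ
  -- on the support of the derivative of the weight `|2 x| ≤ 3`, so that this `A` dominates the
  -- spatial derivative of the weight by the time derivative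
  set A : ℝ := 3 * L + 1 with hA
  have hA0 : 0 < A := by positivity
  set s := smoothTransition with hs
  set c₀ : ℝ := τ * Q / (4 * A) with hc₀
  have hc₀p : 0 < c₀ := by positivity
  set μ : Measure (ℝ × ℝ) := volume.restrict (Ioi 0 ×ˢ univ) with hμ
  have hμp : μ = (volume.restrict (Ioi (0 : ℝ))).prod (volume : Measure ℝ) := by
    rw [hμ, Measure.volume_eq_prod, ← Measure.prod_restrict, Measure.restrict_univ]
  have hpos : ∀ᵐ p ∂μ, 0 < p.1 := by
    filter_upwards [ae_restrict_mem (measurableSet_Ioi.prod MeasurableSet.univ)] with p hp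
    exact hp.1
  set T : ℝ := 2 / A with hT
  have hτ2 : τ * τ = 1 := by rw [← abs_mul_abs_self, hτ, one_mul]
  -- on almost every slice near the junction, the weighted time integral of `τ w` is at least `c₀`
  have hwC : ∀ᵐ p ∂μ, ‖w p‖ ≤ L * C := by
    filter_upwards [he, hwe] with p h1 h2
    exact h2.trans (mul_le_mul_of_nonneg_left h1.2 hL)
  have hw0i : Integrable (fun p : ℝ × ℝ => w p * (s (2 - A * p.1 - p.2 ^ 2) * s (p.1 + 1))) μ := by
    refine Integrable.bdd_mul ?_ hwm hwC
    refine (Continuous.integrable_of_hasCompactSupport ?_ (hasCompactSupport_cone hA0)).mono_measure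
      Measure.restrict_le_self
    exact (Real.smoothTransition.continuous.comp (by fun_prop)).mul
      (Real.smoothTransition.continuous.comp (by fun_prop))
  set I : ℝ → ℝ := fun x => ∫ t in Ioi 0, w (t, x) * (s (2 - A * t - x ^ 2) * s (t + 1)) with hI
  have hslice : ∀ᵐ x : ℝ, AEStronglyMeasurable (fun t => w (t, x)) (volume.restrict (Ioi 0)) ∧
      (∀ᵐ t ∂(volume.restrict (Ioi (0 : ℝ))), ‖w (t, x)‖ ≤ L * C) := by
    rw [hμp] at hwm hwC
    have h1 := hwm.prod_swap.prodMk_left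
    have h2 := Measure.ae_ae_of_ae_prod (Measure.measurePreserving_swap.quasiMeasurePreserving.ae hwC)
    filter_upwards [h1, h2] with x h1 h2
    exact ⟨h1, h2⟩
  have hlow : ∀ᶠ x in 𝓝[{x | 0 < τ * x}] 0 ⊓ ae volume, c₀ ≤ τ * I x := by
    have ht1 := (htr T).eventually (gt_mem_nhds (ENNReal.ofReal_pos.2 hc₀p))
    have ht2 : ∀ᶠ x : ℝ in 𝓝[{x | 0 < τ * x}] 0 ⊓ ae volume, |x| < 1 / 2 := by
      refine Filter.Eventually.filter_mono inf_le_left (mem_nhdsWithin_of_mem_nhds ?_)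
      filter_upwards [Metric.ball_mem_nhds (0 : ℝ) (ε := 1 / 2) (by norm_num)] with x hx
      simpa using hx
    have ht3 := hslice.filter_mono (inf_le_right (a := 𝓝[{x | 0 < τ * x}] (0 : ℝ)))
    filter_upwards [ht1, ht2, ht3] with x hx1 hx2 hx3
    have hx2' : x ^ 2 ≤ 1 / 4 := by
      rw [← sq_abs]; nlinarith [abs_nonneg x]
    set θ : ℝ → ℝ := fun t => s (2 - A * t - x ^ 2) * s (t + 1) with hθ
    have hθc : Continuous θ := (Real.smoothTransition.continuous.comp (by fun_prop)).mul
      (Real.smoothTransition.continuous.comp (by fun_prop))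
    have hθ0 : ∀ t, 0 ≤ θ t := fun t =>
      mul_nonneg (Real.smoothTransition.nonneg _) (Real.smoothTransition.nonneg _)
    have hθ1 : ∀ t, θ t ≤ 1 := fun t =>
      mul_le_one₀ (Real.smoothTransition.le_one _) (Real.smoothTransition.nonneg _)
        (Real.smoothTransition.le_one _)
    have hθT : ∀ t, T ≤ t → θ t = 0 := by
      intro t ht
      have : 2 ≤ A * t := by rw [hT, div_le_iff₀ hA0] at ht; linarith
      rw [hθ]
      simp only [hs]
      rw [Real.smoothTransition.zero_of_nonpos (by nlinarith [sq_nonneg x]), zero_mul]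
    have hIeq : I x = ∫ t in Ioo 0 T, w (t, x) * θ t := by
      refine setIntegral_eq_of_subset_of_forall_sdiff_eq_zero measurableSet_Ioi Ioo_subset_Ioi_self
        fun t ht => ?_
      have : T ≤ t := by
        by_contra h
        exact ht.2 ⟨ht.1, not_le.1 h⟩
      change w (t, x) * θ t = 0
      rw [hθT t this, mul_zero]
    have hwi : Integrable (fun t => w (t, x)) (volume.restrict (Ioo 0 T)) := by
      have hsub : volume.restrict (Ioo 0 T) ≤ volume.restrict (Ioi (0 : ℝ)) :=
        Measure.restrict_mono Ioo_subset_Ioi_self le_rfl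
      exact Integrable.of_bound (hx3.1.mono_measure hsub) (L * C)
        (hx3.2.filter_mono (ae_mono hsub))
    have hθi : Integrable θ (volume.restrict (Ioo 0 T)) :=
      Integrable.of_bound hθc.aestronglyMeasurable 1 (ae_of_all _ fun t => by
        rw [Real.norm_eq_abs, abs_of_nonneg (hθ0 t)]; exact hθ1 t)
    have hdi : Integrable (fun t => w (t, x) - Q) (volume.restrict (Ioo 0 T)) :=
      hwi.sub (integrable_const Q)
    have hdn : ∫ t in Ioo 0 T, |w (t, x) - Q| ≤ c₀ := by
      have := integral_norm_eq_lintegral_enorm hdi.1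
      simp only [Real.norm_eq_abs] at this
      rw [this]
      exact ENNReal.toReal_le_of_le_ofReal hc₀p.le hx1.le
    have hprod : Integrable (fun t => (w (t, x) - Q) * θ t) (volume.restrict (Ioo 0 T)) := by
      refine hdi.mono (hdi.1.mul hθc.aestronglyMeasurable) (ae_of_all _ fun t => ?_)
      rw [norm_mul, Real.norm_eq_abs (θ t), abs_of_nonneg (hθ0 t)]
      exact mul_le_of_le_one_right (norm_nonneg _) (hθ1 t)
    have hsplit : τ * I x = τ * Q * (∫ t in Ioo 0 T, θ t) + τ * ∫ t in Ioo 0 T, (w (t, x) - Q) * θ t := by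
      rw [hIeq, mul_assoc, ← mul_add, ← integral_const_mul Q, ← integral_add (hθi.const_mul Q) hprod]
      congr 1
      refine integral_congr_ae (ae_of_all _ fun t => ?_)
      ring
    have h1 : 1 / (2 * A) ≤ ∫ t in Ioo 0 T, θ t := by
      have hle : 1 / (2 * A) ≤ T := by
        rw [hT, div_le_div_iff₀ (by positivity) hA0]; linarith
      have : ∫ t in Ioo 0 (1 / (2 * A)), (1 : ℝ) = 1 / (2 * A) := by
        simp [hA0.le]
      rw [← this]
      refine (setIntegral_congr_fun measurableSet_Ioo fun t ht => ?_).trans_le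
        (setIntegral_mono_set hθi (ae_of_all _ hθ0)
          (Ioo_subset_Ioo_right hle).eventuallyLE)
      have hAt : A * t ≤ 1 / 2 := by
        have := ht.2.le
        rw [le_div_iff₀ (by positivity)] at this
        linarith
      simp only [hθ, hs]
      rw [Real.smoothTransition.one_of_one_le (by linarith),
        Real.smoothTransition.one_of_one_le (by linarith [ht.1]), one_mul]
    have h2 : |τ * ∫ t in Ioo 0 T, (w (t, x) - Q) * θ t| ≤ c₀ := by
      rw [abs_mul, hτ, one_mul]
      refine le_trans ?_ hdn
      refine norm_integral_le_of_norm_le (f := fun t => (w (t, x) - Q) * θ t) hdi.norm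
        (ae_of_all _ fun t => ?_)
      rw [norm_mul, Real.norm_eq_abs (θ t), abs_of_nonneg (hθ0 t)]
      exact mul_le_of_le_one_right (norm_nonneg _) (hθ1 t)
    have h3 : 2 * c₀ ≤ τ * Q * ∫ t in Ioo 0 T, θ t := by
      have : 2 * c₀ = τ * Q * (1 / (2 * A)) := by rw [hc₀]; field_simp; ring
      rw [this]
      exact mul_le_mul_of_nonneg_left h1 hQ.le
    rw [hsplit]
    linarith [neg_abs_le (τ * ∫ t in Ioo 0 T, (w (t, x) - Q) * θ t)]
  obtain ⟨η, hη, hlow'⟩ : ∃ η > 0, ∀ᵐ x : ℝ, 0 < τ * x → |x| < η → c₀ ≤ τ * I x := by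
    obtain ⟨S, hS, S', hS', hsub⟩ := Filter.eventually_inf.1 hlow
    obtain ⟨η, hη, hball⟩ := Metric.mem_nhdsWithin_iff.1 hS
    refine ⟨η, hη, ?_⟩
    filter_upwards [hS'] with x hx h1 h2
    exact hsub x ⟨hball ⟨by simpa using h2, h1⟩, hx⟩
  -- the cutoff lies in the region of these slices, and the initial values contribute less than `c₀`
  set δ : ℝ := min (η / 3) (c₀ / (8 * (C + 1))) with hδ
  have hδ0 : 0 < δ := by positivity
  have hδη : 2 * δ < η := by linarith [min_le_left (η / 3) (c₀ / (8 * (C + 1)))]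
  have hδC : 4 * δ * C < c₀ := by
    have h1 : δ ≤ c₀ / (8 * (C + 1)) := min_le_right _ _
    rw [le_div_iff₀ (by positivity)] at h1
    nlinarith
  -- the derivative of the cutoff, a probability density on `δ ≤ τ x ≤ 2 δ`
  set b : ℝ → ℝ := fun x => deriv s (2 - τ * x / δ) / δ with hb
  have hb0 : ∀ x, 0 ≤ b x := fun x => div_nonneg (deriv_smoothTransition_nonneg _) hδ0.le
  have hbc : Continuous b := (continuous_deriv_smoothTransition.comp (by fun_prop)).div_const δ
  obtain ⟨B, hB⟩ := hasCompactSupport_deriv_smoothTransition.exists_bound_of_continuous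
    continuous_deriv_smoothTransition
  have hbi : Integrable b := by
    by_contra h
    have := integral_cutoff_deriv hτ hδ0
    rw [integral_undef h] at this
    exact zero_ne_one this
  have hbabs : ∀ x, |x| = |τ * x| := fun x => by rw [abs_mul, hτ, one_mul]
  set W : ℝ × ℝ → ℝ := fun p => τ * b p.2 * (w p * (s (2 - A * p.1 - p.2 ^ 2) * s (p.1 + 1)))
    with hW
  have hWi : Integrable W μ := by
    refine hw0i.bdd_mul (c := B / δ) (by fun_prop) (ae_of_all _ fun p => ?_)
    rw [norm_mul, Real.norm_eq_abs, hτ, one_mul, hb, norm_div, Real.norm_of_nonneg hδ0.le]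
    gcongr
    exact hB _
  have hflux : c₀ ≤ ∫ p, W p ∂μ := by
    rw [hμp] at hWi ⊢
    rw [integral_prod_symm _ hWi]
    have h1 : ∫ x, b x * c₀ = c₀ := by
      rw [integral_mul_const, integral_cutoff_deriv hτ hδ0, one_mul]
    refine h1.symm.le.trans (integral_mono_ae (hbi.mul_const _) hWi.integral_prod_right ?_)
    filter_upwards [hlow'] with x hx
    simp only [hW]
    rw [integral_const_mul, mul_comm τ, mul_assoc]
    by_cases hbx : b x = 0
    · simp [hbx]
    have hy : deriv s (2 - τ * x / δ) ≠ 0 := fun h => hbx (by simp [hb, h])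
    have hy1 : 0 ≤ 2 - τ * x / δ := by
      by_contra h
      exact hy (deriv_smoothTransition_of_neg (not_le.1 h))
    have hy2 : 2 - τ * x / δ ≤ 1 := by
      by_contra h
      exact hy (deriv_smoothTransition_of_one_lt (not_le.1 h))
    have hx1 : δ ≤ τ * x := by
      have : 1 ≤ τ * x / δ := by linarith
      rwa [le_div_iff₀ hδ0, one_mul] at this
    have hx2 : τ * x ≤ 2 * δ := by
      have : τ * x / δ ≤ 2 := by linarith
      rwa [div_le_iff₀ hδ0] at this
    refine mul_le_mul_of_nonneg_left (hx (by linarith) ?_) (hb0 x)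
    rw [hbabs, abs_of_pos (by linarith)]
    linarith
  have hφ := ineq (coneTest A τ δ) (contDiff_coneTest A τ δ) (hasCompactSupport_coneTest hA0 τ δ)
    (coneTest_nonneg A τ δ)
  -- apart from the derivative of the cutoff, all terms have a sign
  have hmain : ∫ p, (e p * fderiv ℝ (coneTest A τ δ) p (1, 0)
      + w p * fderiv ℝ (coneTest A τ δ) p (0, 1)) ∂μ ≤ ∫ p, -W p ∂μ := by
    have hd := fun v => (integrable_fderiv (contDiff_coneTest A τ δ)
      (hasCompactSupport_coneTest hA0 τ δ) v).mono_measure (Measure.restrict_le_self (s := Ioi 0 ×ˢ univ))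
    refine integral_mono_ae (((hd (1, 0)).bdd_mul (c := C) hem ?_).add
      ((hd (0, 1)).bdd_mul hwm hwC)) hWi.neg ?_
    · filter_upwards [he] with p hp
      rw [Real.norm_of_nonneg hp.1]; exact hp.2
    · filter_upwards [hpos, he, hwe] with p hp h1 h2
      rw [coneTest_fst hp, coneTest_snd hp]
      simp only [hW, hb, ← hs]
      rw [hs, Real.smoothTransition.one_of_one_le (x := p.1 + 1) (by linarith), ← hs, mul_one]
      have key : deriv s (2 - A * p.1 - p.2 ^ 2) * s (2 - τ * p.2 / δ)
          * (A * e p + 2 * p.2 * w p) ≥ 0 := by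
        by_cases h0 : 2 - A * p.1 - p.2 ^ 2 < 0
        · rw [hs, deriv_smoothTransition_of_neg h0]; simp
        have hp2 : |p.2| ≤ 3 / 2 := by
          refine abs_le_of_sq_le_sq ?_ (by norm_num)
          nlinarith [mul_pos hA0 hp]
        refine mul_nonneg (mul_nonneg (deriv_smoothTransition_nonneg _)
          (Real.smoothTransition.nonneg _)) ?_
        have h3 : |2 * p.2 * w p| ≤ 3 * (L * e p) := by
          rw [abs_mul, abs_mul, abs_two]
          have := abs_nonneg (w p)
          nlinarith [abs_nonneg p.2]
        have := neg_abs_le (2 * p.2 * w p)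
        nlinarith [h1.1]
      linarith
  -- only the initial values on `0 ≤ τ x ≤ 2 δ` contribute
  have hEb : |∫ x, E x * coneTest A τ δ (0, x)| ≤ 4 * δ * C := by
    have h1 : ∫ x in Icc (-(2 * δ)) (2 * δ), C = 4 * δ * C := by
      rw [setIntegral_const, smul_eq_mul, Measure.real, Real.volume_Icc,
        ENNReal.toReal_ofReal (by linarith)]
      ring
    rw [← h1, ← integral_indicator measurableSet_Icc]
    refine norm_integral_le_of_norm_le (f := fun x => E x * coneTest A τ δ (0, x)) ?_
      (ae_of_all _ fun x => ?_)
    · exact (integrable_indicator_iff measurableSet_Icc).2 (by simp [IntegrableOn])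
    by_cases hx : x ∈ Icc (-(2 * δ)) (2 * δ)
    · rw [indicator_of_mem hx, norm_mul, Real.norm_of_nonneg (coneTest_nonneg _ _ _ _)]
      refine (mul_le_of_le_one_right (norm_nonneg _) ?_).trans (hE x)
      exact mul_le_one₀ (mul_le_one₀ (Real.smoothTransition.le_one _)
        (Real.smoothTransition.nonneg _) (Real.smoothTransition.le_one _))
        (Real.smoothTransition.nonneg _) (Real.smoothTransition.le_one _)
    · rw [indicator_of_notMem hx, norm_le_zero_iff]
      rcases lt_or_ge (τ * x) 0 with h0 | h0
      · rw [hE0 x h0, zero_mul]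
      · have : 2 * δ < τ * x := by
          by_contra h
          refine hx (abs_le.1 ?_)
          rw [hbabs, abs_of_nonneg h0]
          exact not_lt.1 h
        rw [coneTest, Real.smoothTransition.zero_of_nonpos (x := 2 - τ * x / δ), mul_zero, mul_zero]
        rw [sub_nonpos, le_div_iff₀ hδ0]
        exact this.le
  rw [integral_neg] at hmain
  linarith [le_abs_self (∫ x, E x * coneTest A τ δ (0, x))]

end

section
variable {n m : ℕ} {r : Road}

theorem Road.Admissible.continuous_clamp (hr : r.Admissible) {w : ℝ → ℝ}
    (hw : ContinuousOn w r.K) : Continuous fun v => w (max r.a (min r.b v)) :=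
  hw.comp_continuous (by fun_prop) fun v => ⟨le_max_left _ _, max_le hr.lt.le (min_le_left _ _)⟩

/-- Values in `K` are not changed by the projection to `K`, so that a function which is continuous
on `K` may be composed with a measurable function with values in `K`. -/
theorem Road.Admissible.aestronglyMeasurable_comp {X : Type*} [MeasurableSpace X] {μ : Measure X}
    (hr : r.Admissible) {w : ℝ → ℝ} (hw : ContinuousOn w r.K) {v : X → ℝ}
    (hv : AEStronglyMeasurable v μ) (hK : ∀ᵐ p ∂μ, v p ∈ r.K) :
    AEStronglyMeasurable (fun p => w (v p)) μ := by
  refine ((hr.continuous_clamp hw).comp_aestronglyMeasurable hv).congr ?_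
  filter_upwards [hK] with p hp
  rw [min_eq_right hp.2, max_eq_right hp.1]

/-- The sum of the Kruzkov inequalities with the constants `k` and `k₀`, for the entropy pair
`(e, w)` whose double is the sum of the two Kruzkov pairs up to additive constants. -/
theorem IsRiemannSolution.entropy_inequality (hr : r.Admissible) {uL uR : ℝ} {u : ℝ → ℝ → ℝ}
    (hL : uL ∈ r.K) (hR : uR ∈ r.K)
    (hu : IsRiemannSolution r uL uR u) {k k₀ c d : ℝ} (hk : k ∈ r.K) (hk₀ : k₀ ∈ r.K)
    {e w : ℝ → ℝ} (he : ∀ v ∈ r.K, |v - k| + |v - k₀| = 2 * e v + c)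
    (hw : ∀ v ∈ r.K, Real.sign (v - k) * (r.f v - r.f k) + Real.sign (v - k₀) * (r.f v - r.f k₀)
      = 2 * w v + d) {φ : ℝ × ℝ → ℝ}
    (hφ : ContDiff ℝ ∞ φ) (hc : HasCompactSupport φ) (h0 : ∀ p, 0 ≤ φ p) :
    0 ≤ (∫ p in Ioi (0 : ℝ) ×ˢ (univ : Set ℝ),
        (e (u p.1 p.2) * fderiv ℝ φ p (1, 0) + w (u p.1 p.2) * fderiv ℝ φ p (0, 1)))
      + ∫ x, e (if x < 0 then uL else uR) * φ (0, x) := by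
  obtain ⟨hum, huK, hent⟩ := hu
  have hd := fun v => (integrable_fderiv hφ hc v).mono_measure
    (Measure.restrict_le_self (s := Ioi 0 ×ˢ univ))
  obtain ⟨Lf, hLf⟩ := hr.lipschitz
  have hfc : ContinuousOn r.f r.K := hLf.continuousOn
  obtain ⟨B, hB⟩ := (isCompact_Icc (a := r.a) (b := r.b)).exists_bound_of_continuousOn hfc
  have hfm := hr.aestronglyMeasurable_comp hfc hum huK
  have int : ∀ κ ∈ r.K, Integrable (fun p : ℝ × ℝ => |u p.1 p.2 - κ| * fderiv ℝ φ p (1, 0)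
      + Real.sign (u p.1 p.2 - κ) * (r.f (u p.1 p.2) - r.f κ) * fderiv ℝ φ p (0, 1))
      (volume.restrict (Ioi 0 ×ˢ univ)) := by
    intro κ hκ
    refine ((hd _).bdd_mul (c := r.b - r.a)
      (continuous_abs.comp_aestronglyMeasurable (hum.sub aestronglyMeasurable_const)) ?_).add
      ((hd _).bdd_mul (c := 1 * (B + B)) ?_ ?_)
    · filter_upwards [huK] with p hp
      rw [Real.norm_eq_abs, abs_abs]
      exact abs_sub_le_iff.2 ⟨by linarith [hp.2, hκ.1], by linarith [hp.1, hκ.2]⟩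
    · exact ((measurable_sign_sub κ).comp_aemeasurable hum.aemeasurable).aestronglyMeasurable.mul
        (hfm.sub aestronglyMeasurable_const)
    · filter_upwards [huK] with p hp
      rw [norm_mul]
      refine mul_le_mul (abs_sign_le _) ((norm_sub_le _ _).trans (add_le_add (hB _ hp) (hB _ hκ)))
        (norm_nonneg _) zero_le_one
  have h1 := hent k hk φ hφ hc h0
  have h2 := hent k₀ hk₀ φ hφ hc h0
  simp only [deriv_fst_eq hφ, deriv_snd_eq hφ] at h1 h2
  have hφ0 : Integrable fun x => φ (0, x) :=
    (contDiff_slice_right hφ 0).continuous.integrable_of_hasCompactSupport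
      (hasCompactSupport_slice_right hc 0)
  have hu0 : ∀ x : ℝ, (if x < 0 then uL else uR) ∈ r.K := fun x => by split_ifs <;> assumption
  have hu0m : Measurable fun x : ℝ => if x < 0 then uL else uR :=
    Measurable.ite measurableSet_Iio measurable_const measurable_const
  have int0 : ∀ κ ∈ r.K, Integrable fun x : ℝ => |(if x < 0 then uL else uR) - κ| * φ (0, x) := by
    intro κ hκ
    refine hφ0.bdd_mul (c := r.b - r.a) (hu0m.sub_const κ).abs.aestronglyMeasurable
      (ae_of_all _ fun x => ?_)
    rw [Real.norm_eq_abs, abs_abs]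
    exact abs_sub_le_iff.2 ⟨by linarith [(hu0 x).2, hκ.1], by linarith [(hu0 x).1, hκ.2]⟩
  have e1 : (∫ p in Ioi (0 : ℝ) ×ˢ (univ : Set ℝ), (e (u p.1 p.2) * fderiv ℝ φ p (1, 0)
        + w (u p.1 p.2) * fderiv ℝ φ p (0, 1)))
      = ∫ p in Ioi (0 : ℝ) ×ˢ (univ : Set ℝ),
        (1 / 2 * (|u p.1 p.2 - k| * fderiv ℝ φ p (1, 0)
          + Real.sign (u p.1 p.2 - k) * (r.f (u p.1 p.2) - r.f k) * fderiv ℝ φ p (0, 1))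
        + (1 / 2 * (|u p.1 p.2 - k₀| * fderiv ℝ φ p (1, 0)
          + Real.sign (u p.1 p.2 - k₀) * (r.f (u p.1 p.2) - r.f k₀) * fderiv ℝ φ p (0, 1))
        + (-c / 2 * fderiv ℝ φ p (1, 0) + -d / 2 * fderiv ℝ φ p (0, 1)))) := by
    refine integral_congr_ae ?_
    filter_upwards [huK] with p hp
    linear_combination (-1 / 2) * fderiv ℝ φ p (1, 0) * he _ hp
      + (-1 / 2) * fderiv ℝ φ p (0, 1) * hw _ hp
  have e2 : (∫ x : ℝ, e (if x < 0 then uL else uR) * φ (0, x))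
      = ∫ x : ℝ, (1 / 2 * (|(if x < 0 then uL else uR) - k| * φ (0, x))
        + (1 / 2 * (|(if x < 0 then uL else uR) - k₀| * φ (0, x))
        + (-c / 2 * φ (0, x) + 0 * φ (0, x)))) := by
    refine integral_congr_ae (ae_of_all _ fun x => ?_)
    linear_combination (-1 / 2) * φ (0, x) * he _ (hu0 x)
  rw [e1, e2, integral_linear (int k hk) (int k₀ hk₀) (hd _) (hd _),
    integral_linear (int0 k hk) (int0 k₀ hk₀) hφ0 hφ0,
    integral_fderiv_space hφ hc]
  have h3 := integral_fderiv_time hφ hc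
  linear_combination (1 / 2) * h1 + (1 / 2) * h2 + (c / 2) * h3

/-- The entropy pair `(e, w)` vanishes at the state beyond the junction; then its flux does not
enter the road at the trace. -/
theorem flux_trace_nonpos (hr : r.Admissible) {h : Fin n ⊕ Fin m} {ρh ρb : ℝ} {u : ℝ → ℝ → ℝ}
    (hh : ρh ∈ r.K) (hb : ρb ∈ r.K)
    (hu : IsRiemannSolution r (leftState h ρb ρh) (rightState h ρb ρh) u) (htr : HasTrace h u ρb)
    {k k₀ c d L : ℝ} (hk : k ∈ r.K) (hk₀ : k₀ ∈ r.K) {e w : ℝ → ℝ} (hL : 0 ≤ L)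
    (he : ∀ v ∈ r.K, |v - k| + |v - k₀| = 2 * e v + c)
    (hw : ∀ v ∈ r.K, Real.sign (v - k) * (r.f v - r.f k) + Real.sign (v - k₀) * (r.f v - r.f k₀)
      = 2 * w v + d)
    (hec : ContinuousOn e r.K) (hwL : ∀ v ∈ r.K, ∀ v' ∈ r.K, |w v - w v'| ≤ L * |v - v'|)
    (he0 : ∀ v ∈ r.K, 0 ≤ e v) (hwe : ∀ v ∈ r.K, |w v| ≤ L * e v) (hz : e ρh = 0) :
    -sgn h * w ρb ≤ 0 := by
  obtain ⟨C, hC⟩ := (isCompact_Icc (a := r.a) (b := r.b)).exists_bound_of_continuousOn hec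
  have hC0 : 0 ≤ C := (norm_nonneg _).trans (hC _ hh)
  have hlr : leftState h ρb ρh ∈ r.K ∧ rightState h ρb ρh ∈ r.K := by
    rcases h with i | j <;> simp [leftState, rightState, hh, hb]
  have hwc : ContinuousOn w r.K := by
    refine (LipschitzOnWith.of_dist_le_mul (K := ⟨L, hL⟩) fun v hv v' hv' => ?_).continuousOn
    exact hwL v hv v' hv'
  have hu0 : ∀ x : ℝ, (if x < 0 then leftState h ρb ρh else rightState h ρb ρh) ∈ r.K :=
    fun x => by split_ifs; exacts [hlr.1, hlr.2]
  have hdom : {x : ℝ | 0 < -sgn h * x} = dom h := by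
    rcases h with i | j <;> ext x <;> simp [sgn, dom]
  refine flux_nonpos_of_trace (C := C) (L := L) (e := fun p => e (u p.1 p.2))
    (w := fun p => w (u p.1 p.2))
    (E := fun x => e (if x < 0 then leftState h ρb ρh else rightState h ρb ρh)) ?_ hL hC0
    (hr.aestronglyMeasurable_comp hec hu.1 hu.2.1) (hr.aestronglyMeasurable_comp hwc hu.1 hu.2.1)
    ?_ ?_ ?_ (fun x => hC _ (hu0 x))
    (fun φ hφ hc h0 => hu.entropy_inequality hr hlr.1 hlr.2 hk hk₀ he hw hφ hc h0) ?_
  · rcases h with i | j <;> simp [sgn]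
  · filter_upwards [hu.2.1] with p hp
    exact ⟨he0 _ hp, (le_abs_self _).trans (hC _ hp)⟩
  · filter_upwards [hu.2.1] with p hp using hwe _ hp
  · intro x hx
    rcases h with i | j
    · have : ¬ x < 0 := by simp [sgn] at hx; linarith
      simp [this, rightState, hz]
    · have : x < 0 := by simpa [sgn] using hx
      simp [this, leftState, hz]
  · intro T
    rw [hdom]
    have h1 := ENNReal.Tendsto.const_mul (a := ENNReal.ofReal L) (htr T)
      (Or.inr ENNReal.ofReal_ne_top)
    rw [mul_zero] at h1
    refine tendsto_of_tendsto_of_tendsto_of_le_of_le' tendsto_const_nhds h1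
      (Eventually.of_forall fun _ => bot_le) ?_
    have h2 : ∀ᵐ x : ℝ, ∀ᵐ t ∂(volume.restrict (Ioi (0 : ℝ))), u t x ∈ r.K := by
      have h3 := hu.2.1
      rw [Measure.volume_eq_prod, ← Measure.prod_restrict, Measure.restrict_univ] at h3
      exact Measure.ae_ae_of_ae_prod (Measure.measurePreserving_swap.quasiMeasurePreserving.ae h3)
    filter_upwards [h2.filter_mono inf_le_right] with x hx
    rw [← lintegral_const_mul' _ _ ENNReal.ofReal_ne_top]
    refine lintegral_mono_ae ?_
    filter_upwards [hx.filter_mono (ae_mono (Measure.restrict_mono Ioo_subset_Ioi_self le_rfl))]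
      with t ht
    rw [← ofReal_norm, ← ofReal_norm, ← ENNReal.ofReal_mul hL]
    exact ENNReal.ofReal_le_ofReal (hwL _ ht _ hb)

/-- If the Riemann problem between `ρb` on the road and `ρh` beyond it has the trace `ρb`, then
`ρh` and `ρb` satisfy the entropy condition at the junction. -/
theorem compatible_of_trace (hr : r.Admissible) {h : Fin n ⊕ Fin m} {ρh ρb : ℝ} {u : ℝ → ℝ → ℝ}
    (hh : ρh ∈ r.K) (hb : ρb ∈ r.K)
    (hu : IsRiemannSolution r (leftState h ρb ρh) (rightState h ρb ρh) u)
    (htr : HasTrace h u ρb) : Compatible (fun k => -sgn h * r.f k) ρh ρb := by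
  obtain ⟨L, hL⟩ := hr.lipschitz
  have hLip : ∀ v ∈ r.K, ∀ v' ∈ r.K, |r.f v - r.f v'| ≤ L * |v - v'| :=
    fun v hv v' hv' => hL.dist_le_mul v hv v' hv'
  constructor
  · intro k h1 h2
    have hk : k ∈ r.K := ⟨hb.1.trans h1.le, h2.trans hh.2⟩
    have hmin : ∀ v ∈ r.K, min v k ∈ r.K := fun v hv => ⟨le_min hv.1 hk.1, min_le_of_left_le hv.2⟩
    -- the entropy `(k - v)⁺`, which vanishes at `ρh`; on `K` it is half the sum of the Kruzkov entropies
    -- with the constants `k` and `r.b`, up to a constant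
    have := flux_trace_nonpos hr hh hb hu htr (k := k) (k₀ := r.b) (c := r.b - k) (d := -r.f k)
      (e := fun v => k - min v k) (w := fun v => r.f k - r.f (min v k)) hk ⟨hr.lt.le, le_rfl⟩
      L.2 ?_ ?_ (by fun_prop) ?_ (fun v _ => sub_nonneg.2 (min_le_right _ _)) ?_ (by simp [h2])
    · simp only [min_eq_left h1.le] at this
      linarith
    · intro v hv
      rw [abs_of_nonpos (sub_nonpos.2 hv.2)]
      rcases le_total v k with hvk | hvk
      · rw [abs_of_nonpos (sub_nonpos.2 hvk), min_eq_left hvk]; ring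
      · rw [abs_of_nonneg (sub_nonneg.2 hvk), min_eq_right hvk]; ring
    · intro v hv
      have hb' : Real.sign (v - r.b) * (r.f v - r.f r.b) = -r.f v := by
        rcases hv.2.lt_or_eq with hlt | rfl
        · rw [Real.sign_of_neg (sub_neg.2 hlt), hr.f_b]; ring
        · rw [hr.f_b]; simp
      rw [hb']
      rcases lt_trichotomy v k with hvk | rfl | hvk
      · rw [Real.sign_of_neg (sub_neg.2 hvk), min_eq_left hvk.le]; ring
      · simp
      · rw [Real.sign_of_pos (sub_pos.2 hvk), min_eq_right hvk.le]; ring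
    · intro v hv v' hv'
      rw [sub_sub_sub_cancel_left, abs_sub_comm]
      refine (hLip _ (hmin v hv) _ (hmin v' hv')).trans (mul_le_mul_of_nonneg_left ?_ L.2)
      exact (abs_min_sub_min_le_max _ _ _ _).trans (by simp)
    · intro v hv
      refine (hLip _ hk _ (hmin v hv)).trans_eq ?_
      rw [abs_of_nonneg (sub_nonneg.2 (min_le_right _ _))]
      rfl
  · intro k h1 h2
    have hk : k ∈ r.K := ⟨hh.1.trans h1, h2.le.trans hb.2⟩
    have hmax : ∀ v ∈ r.K, max v k ∈ r.K := fun v hv => ⟨le_max_of_le_left hv.1, max_le hv.2 hk.2⟩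
    -- the entropy `(v - k)⁺`, which vanishes at `ρh`
    have := flux_trace_nonpos hr hh hb hu htr (k := k) (k₀ := r.a) (c := k - r.a) (d := r.f k)
      (e := fun v => max v k - k) (w := fun v => r.f (max v k) - r.f k) hk ⟨le_rfl, hr.lt.le⟩
      L.2 ?_ ?_ (by fun_prop) ?_ (fun v _ => sub_nonneg.2 (le_max_right _ _)) ?_ (by simp [h1])
    · simp only [max_eq_left h2.le] at this
      linarith
    · intro v hv
      rw [abs_of_nonneg (sub_nonneg.2 hv.1)]
      rcases le_total v k with hvk | hvk
      · rw [abs_of_nonpos (sub_nonpos.2 hvk), max_eq_right hvk]; ring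
      · rw [abs_of_nonneg (sub_nonneg.2 hvk), max_eq_left hvk]; ring
    · intro v hv
      have ha' : Real.sign (v - r.a) * (r.f v - r.f r.a) = r.f v := by
        rcases hv.1.lt_or_eq with hlt | heq
        · rw [Real.sign_of_pos (sub_pos.2 hlt), hr.f_a]; ring
        · rw [← heq, hr.f_a]; simp
      rw [ha']
      rcases lt_trichotomy v k with hvk | rfl | hvk
      · rw [Real.sign_of_neg (sub_neg.2 hvk), max_eq_right hvk.le]; ring
      · simp
      · rw [Real.sign_of_pos (sub_pos.2 hvk), max_eq_left hvk.le]; ring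
    · intro v hv v' hv'
      rw [sub_sub_sub_cancel_right]
      refine (hLip _ (hmax v hv) _ (hmax v' hv')).trans (mul_le_mul_of_nonneg_left ?_ L.2)
      exact abs_max_sub_max_le_abs _ _ _
    · intro v hv
      refine (hLip _ (hmax v hv) _ hk).trans_eq ?_
      rw [abs_of_nonneg (sub_nonneg.2 (le_max_right _ _))]
      rfl

end

/-! ### Junction states, velocities and the coupling condition -/

section
variable {n m : ℕ} {R : Fin n ⊕ Fin m → Road} {ρb ρh : Fin n ⊕ Fin m → ℝ}

theorem IsPriorityState.mem_K (hp : IsPriorityState R ρh) (h : Fin n ⊕ Fin m) :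
    ρh h ∈ (R h).K := by
  obtain ⟨M, z, hz, hp⟩ := hp
  exact (hp h).1.1

/-- Junction states satisfy the strict entropy condition at the junction: the solution of the
Riemann problem gives the condition with `≤`, and the condition on `ΓOut` excludes equality. -/
theorem IsKState.strictlyCompatible (hR : ∀ h, (R h).Admissible) (hb : ∀ h, ρb h ∈ (R h).K)
    (hK : IsKState R ρb ρh) (h : Fin n ⊕ Fin m) :
    StrictlyCompatible (fun k => -sgn h * (R h).f k) (ρh h) (ρb h) := by
  obtain ⟨⟨hp, hu, -⟩, hout⟩ := hK
  obtain ⟨u, hu, htr⟩ := hu h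
  have hc := compatible_of_trace (hR h) (hp.mem_K h) (hb h) hu htr
  have ho := hout h
  rcases h with i | j
  · simp only [sgn, Sum.elim_inl, neg_mul, one_mul, ΓOut] at hc ho ⊢
    exact hc.strictly_incoming (hR _) (hp.mem_K _) (hb _) ho
  · simp only [sgn, Sum.elim_inr, neg_neg, one_mul, ΓOut, neg_mul, neg_lt_zero] at hc ho ⊢
    exact hc.strictly_outgoing (hR _) (hp.mem_K _) (hb _) ho

/-- Conversely, priority states which satisfy the strict entropy condition are junction states. -/
theorem isKState_of_strictlyCompatible (hR : ∀ h, (R h).Admissible) (hb : ∀ h, ρb h ∈ (R h).K)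
    (hp : IsPriorityState R ρh) (hsum : ∑ h, sgn h * (R h).f (ρb h) = 0)
    (hc : ∀ h, StrictlyCompatible (fun k => -sgn h * (R h).f k) (ρh h) (ρb h)) :
    IsKState R ρb ρh := by
  refine ⟨⟨hp, fun h => exists_riemannSolution (hR h) h (hp.mem_K h) (hb h) (hc h), hsum⟩, ?_⟩
  intro h he hmem
  rcases lt_trichotomy (ρb h) (ρh h) with hlt | heq | hlt
  · have := (hc h).1 _ hlt le_rfl
    simp only [he, lt_irrefl] at this
  · rwa [heq]
  · have := (hc h).2 _ le_rfl hlt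
    simp only [he, lt_irrefl] at this

theorem sgn_mul_self (h : Fin n ⊕ Fin m) : sgn h * sgn h = 1 := by
  rcases h with i | j <;> simp [sgn]

theorem sgn_ne_zero (h : Fin n ⊕ Fin m) : sgn h ≠ 0 := by
  rcases h with i | j <;> simp [sgn]

/-- The velocity on the road `h` in the coordinate `y = |x|`, which points away from the
junction. -/
noncomputable def velocity (R : Fin n ⊕ Fin m → Road) (h : Fin n ⊕ Fin m) : ℝ → ℝ :=
  (R h).vel (-sgn h)

theorem isVelocity_velocity (hR : ∀ h, (R h).Admissible) (h : Fin n ⊕ Fin m) :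
    IsVelocity (R h).a (R h).b (velocity R h) :=
  (hR h).isVelocity (neg_ne_zero.2 (sgn_ne_zero h))

theorem velocity_eq {h : Fin n ⊕ Fin m} {ξ : ℝ} (hξ : ξ ∈ (R h).K) :
    velocity R h ξ = -sgn h * (R h).df ξ := Road.vel_eq _ hξ

theorem df_eq {h : Fin n ⊕ Fin m} {ξ : ℝ} (hξ : ξ ∈ (R h).K) :
    (R h).df ξ = -sgn h * velocity R h ξ := by
  rw [velocity_eq hξ, ← mul_assoc, neg_mul_neg, sgn_mul_self, one_mul]

theorem ΓOut_eq (R : Fin n ⊕ Fin m → Road) (h : Fin n ⊕ Fin m) :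
    ΓOut R h = closure {ξ | ξ ∈ (R h).K ∧ 0 < velocity R h ξ} := by
  unfold ΓOut
  congr 1
  ext ξ
  refine and_congr_right fun hξ => ?_
  rw [velocity_eq hξ, neg_mul, neg_pos]

theorem ΓOut_subset (R : Fin n ⊕ Fin m → Road) (h : Fin n ⊕ Fin m) : ΓOut R h ⊆ (R h).K :=
  closure_minimal (fun _ hξ => hξ.1) isClosed_Icc

/-- `ΓIn` and `ΓOut` form a partition of `K`. -/
theorem ΓIn_eq (R : Fin n ⊕ Fin m → Road) (h : Fin n ⊕ Fin m) : ΓIn R h = (R h).K \ ΓOut R h := by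
  have e : ({ρ : (R h).K | 0 ≤ sgn h * (R h).df ρ} : Set (R h).K)
      = {ρ : (R h).K | sgn h * (R h).df ρ < 0}ᶜ := by
    ext ρ; simp
  have e2 : Subtype.val '' {ρ : (R h).K | sgn h * (R h).df ρ < 0}
      = {ρ : ℝ | ρ ∈ (R h).K ∧ sgn h * (R h).df ρ < 0} := by
    ext ρ; simp [and_comm]
  rw [ΓIn, e, interior_compl]
  ext ξ
  simp only [mem_image, mem_compl_iff, closure_subtype, e2, Subtype.exists, Set.mem_sdiff]
  constructor
  · rintro ⟨x, hx, h1, rfl⟩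
    exact ⟨hx, h1⟩
  · rintro ⟨hx, h1⟩
    exact ⟨ξ, hx, h1, rfl⟩

/-- The set of states with positive velocity is an interval, since `f'` is monotone. -/
theorem convex_pos_velocity (hR : ∀ h, (R h).Admissible) (h : Fin n ⊕ Fin m) :
    Convex ℝ {ξ | ξ ∈ (R h).K ∧ 0 < velocity R h ξ} := by
  refine (ordConnected_of_Ioo fun x hx y hy hxy z hz => ?_).convex
  have hzK : z ∈ (R h).K := ⟨hx.1.1.trans hz.1.le, hz.2.le.trans hy.1.2⟩
  refine ⟨hzK, ?_⟩
  have h1 := hx.2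
  have h2 := hy.2
  rw [velocity_eq hzK]
  rw [velocity_eq hx.1] at h1
  rw [velocity_eq hy.1] at h2
  rcases h with i | j
  · simp only [sgn, Sum.elim_inl] at h1 h2 ⊢
    linarith [(hR (Sum.inl i)).antitone hx.1 hzK hz.1.le]
  · simp only [sgn, Sum.elim_inr] at h1 h2 ⊢
    linarith [(hR (Sum.inr j)).antitone hzK hy.1 hz.2.le]

/-- Up to a null set, `ΓOut` is the set of states with positive velocity. -/
theorem ae_ΓOut_iff (hR : ∀ h, (R h).Admissible) (h : Fin n ⊕ Fin m) {p : ℝ → Prop} :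
    (∀ᵐ ξ ∂(volume.restrict (ΓOut R h)), p ξ)
      ↔ ∀ᵐ ξ ∂(volume.restrict (R h).K), 0 < velocity R h ξ → p ξ := by
  have hm : MeasurableSet (ΓOut R h) := isClosed_closure.measurableSet
  have hmK : MeasurableSet (R h).K := measurableSet_Icc
  have hfr : volume (frontier {ξ | ξ ∈ (R h).K ∧ 0 < velocity R h ξ}) = 0 :=
    (convex_pos_velocity hR h).addHaar_frontier _
  have hae : ∀ᵐ ξ : ℝ, ξ ∈ ΓOut R h → 0 < velocity R h ξ := by
    filter_upwards [measure_eq_zero_iff_ae_notMem.1 hfr] with ξ hξ hmem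
    rw [ΓOut_eq] at hmem
    by_contra hcon
    exact hξ ⟨hmem, fun hi => hcon (interior_subset hi).2⟩
  rw [ae_restrict_iff' hm, ae_restrict_iff' hmK]
  constructor
  · intro hp
    filter_upwards [hp] with ξ hξ hK hpos
    refine hξ ?_
    rw [ΓOut_eq]
    exact subset_closure ⟨hK, hpos⟩
  · intro hp
    filter_upwards [hp, hae] with ξ hξ h1 hmem
    exact hξ (ΓOut_subset R h hmem) (h1 hmem)

/-- If the outgoing values of `γ` are equilibria, then the terms of the coupling condition sum up
to the flux of `γ`. -/
theorem coupling_flux (h : Fin n ⊕ Fin m) {γ : ℝ → ℝ} {ρ : ℝ}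
    (hi : Integrable (fun ξ => (R h).df ξ * γ ξ) (volume.restrict (R h).K))
    (hγ : ∀ᵐ ξ ∂(volume.restrict (ΓOut R h)), γ ξ = chi ρ ξ) :
    (∫ ξ in ΓOut R h, (R h).df ξ * chi ρ ξ) + ∫ ξ in ΓIn R h, (R h).df ξ * γ ξ
      = ∫ ξ in (R h).K, (R h).df ξ * γ ξ := by
  have hm : MeasurableSet (ΓOut R h) := isClosed_closure.measurableSet
  rw [ΓIn_eq, ← integral_inter_add_sdiff hm hi, inter_eq_right.2 (ΓOut_subset R h)]
  congr 1
  exact integral_congr_ae (hγ.mono fun ξ hξ => by simp only [hξ])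

end

/-! ### Weak and integrated form of the stationary equation -/

section
variable {a b : ℝ}

/-- The measure on `{y > 0} × [a, b]`. -/
noncomputable def halfStrip (a b : ℝ) : Measure (ℝ × ℝ) :=
  (volume.restrict (Ioi 0)).prod (volume.restrict (Icc a b))

theorem halfStrip_eq_restrict : halfStrip a b = volume.restrict (Ioi 0 ×ˢ Icc a b) := by
  rw [halfStrip, Measure.prod_restrict, Measure.volume_eq_prod]

theorem halfStrip_le : halfStrip a b ≤ volume := by
  rw [halfStrip_eq_restrict]; exact Measure.restrict_le_self

theorem intervalIntegrable_of_bounded {k : ℝ → ℝ} {C : ℝ} (hk : Measurable k)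
    (hC : ∀ z, |k z| ≤ C) (u v : ℝ) : IntervalIntegrable k volume u v :=
  (intervalIntegrable_const (c := C)).mono_fun' hk.aestronglyMeasurable (ae_of_all _ hC)

/-- Integration by parts on the half-line for the primitive of a bounded function. -/
theorem integral_primitive_mul_deriv {k ψ : ℝ → ℝ} {C : ℝ} (hk : Measurable k)
    (hC : ∀ z, |k z| ≤ C) (c : ℝ) (hψ : ContDiff ℝ ∞ ψ) (hc : HasCompactSupport ψ) :
    ∫ y in Ioi 0, ((c + ∫ z in (0 : ℝ)..y, k z) * deriv ψ y + k y * ψ y) = -(c * ψ 0) := by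
  obtain ⟨T, hT0, hT⟩ : ∃ T > 0, tsupport ψ ⊆ Iio T := by
    obtain ⟨T, hT⟩ := hc.isCompact.bddAbove
    exact ⟨max T 0 + 1, by positivity, fun y hy =>
      lt_of_le_of_lt (hT hy) (lt_of_le_of_lt (le_max_left T 0) (lt_add_one _))⟩
  have hψT : ∀ y, T ≤ y → ψ y = 0 := fun y hy =>
    image_eq_zero_of_notMem_tsupport fun h => absurd (hT h) (not_lt.2 hy)
  have hψT' : ∀ y, T ≤ y → deriv ψ y = 0 := fun y hy =>
    image_eq_zero_of_notMem_tsupport fun h =>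
      absurd (hT (tsupport_deriv_subset h)) (not_lt.2 hy)
  have hki := intervalIntegrable_of_bounded hk hC
  have hkL : LocallyIntegrable k volume := by
    have hC0 : 0 ≤ C := (abs_nonneg _).trans (hC 0)
    refine (locallyIntegrable_const C).mono hk.aestronglyMeasurable (ae_of_all _ fun z => ?_)
    rw [Real.norm_eq_abs, Real.norm_eq_abs, abs_of_nonneg hC0]; exact hC z
  set A : ℝ → ℝ := fun y => c + ∫ z in (0 : ℝ)..y, k z with hA
  have hAac : AbsolutelyContinuousOnInterval A 0 T := by
    have h1 : AbsolutelyContinuousOnInterval (fun _ : ℝ => c) 0 T :=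
      ((LipschitzWith.const c).lipschitzOnWith (s := uIcc 0 T)).absolutelyContinuousOnInterval
    exact h1.fun_add ((hki 0 T).absolutelyContinuousOnInterval_intervalIntegral (by simp))
  have hψac : AbsolutelyContinuousOnInterval ψ 0 T := by
    obtain ⟨L, hL⟩ := ContDiff.lipschitzWith_of_hasCompactSupport hc hψ (by simp)
    exact (hL.lipschitzOnWith (s := uIcc 0 T)).absolutelyContinuousOnInterval
  have h1 := hAac.integral_deriv_mul_eq_sub hψac
  rw [hψT T le_rfl, mul_zero, zero_sub] at h1
  have hA0 : A 0 = c := by simp [hA]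
  rw [hA0] at h1
  rw [← h1, intervalIntegral.integral_of_le hT0.le]
  have h2 : ∫ y in Ioi 0, (A y * deriv ψ y + k y * ψ y)
      = ∫ y in Ioc 0 T, (A y * deriv ψ y + k y * ψ y) := by
    refine setIntegral_eq_of_subset_of_forall_sdiff_eq_zero measurableSet_Ioi
      Ioc_subset_Ioi_self fun y hy => ?_
    have : T ≤ y := by
      by_contra h
      exact hy.2 ⟨hy.1, (not_le.1 h).le⟩
    rw [hψT y this, hψT' y this]; simp
  rw [h2]
  refine setIntegral_congr_ae measurableSet_Ioc ?_
  filter_upwards [LocallyIntegrable.ae_hasDerivAt_integral hkL] with y hy _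
  have : HasDerivAt A (k y) y := (hy 0).const_add _
  rw [this.deriv]; ring

/-- Joint measurability of a primitive; the substitution `z = y s` makes the interval constant. -/
theorem measurable_primitive {k : ℝ → ℝ → ℝ} (hk : Measurable (Function.uncurry k)) :
    Measurable fun p : ℝ × ℝ => ∫ z in (0 : ℝ)..p.1, k z p.2 := by
  have e : (fun p : ℝ × ℝ => ∫ z in (0 : ℝ)..p.1, k z p.2)
      = fun p : ℝ × ℝ => p.1 * ∫ s in Ioc (0 : ℝ) 1, k (p.1 * s) p.2 := by
    ext p
    rw [← intervalIntegral.integral_of_le zero_le_one,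
      intervalIntegral.mul_integral_comp_mul_left (f := fun z => k z p.2)]
    simp
  rw [e]
  refine measurable_fst.mul ?_
  have hm : Measurable (Function.uncurry fun (p : ℝ × ℝ) (s : ℝ) => k (p.1 * s) p.2) :=
    hk.comp (((measurable_fst.comp measurable_fst).mul measurable_snd).prodMk
      (measurable_snd.comp measurable_fst))
  exact (hm.stronglyMeasurable.integral_prod_right (ν := volume.restrict (Ioc 0 1))).measurable

theorem abs_primitive_le {k : ℝ → ℝ} {C : ℝ} (hC : ∀ z, |k z| ≤ C) (y : ℝ) :
    |∫ z in (0 : ℝ)..y, k z| ≤ C * |y| := by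
  have := intervalIntegral.norm_integral_le_of_norm_le_const (a := 0) (b := y) (f := k) (C := C)
    fun z _ => hC z
  simpa using this

/-- The weak form of `∂_y A = k`, `A(0) = A₀`, for the primitive of a bounded function. -/
theorem integral_weak_primitive {A₀ : ℝ → ℝ} {k : ℝ → ℝ → ℝ} {B C : ℝ}
    (hA : Measurable A₀) (hB : ∀ ξ, |A₀ ξ| ≤ B) (hk : Measurable (Function.uncurry k))
    (hC : ∀ z ξ, |k z ξ| ≤ C) {Φ : ℝ × ℝ → ℝ} (hΦ : ContDiff ℝ ∞ Φ) (hc : HasCompactSupport Φ) :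
    Integrable (fun p => (A₀ p.2 + ∫ z in (0 : ℝ)..p.1, k z p.2) * fderiv ℝ Φ p (1, 0)
      + k p.1 p.2 * Φ p) (halfStrip a b) ∧
    ∫ p, ((A₀ p.2 + ∫ z in (0 : ℝ)..p.1, k z p.2) * fderiv ℝ Φ p (1, 0)
      + k p.1 p.2 * Φ p) ∂(halfStrip a b) = -∫ ξ in Icc a b, A₀ ξ * Φ (0, ξ) := by
  have hle : halfStrip a b ≤ volume := halfStrip_le
  have hd : Continuous fun p : ℝ × ℝ => fderiv ℝ Φ p (1, 0) :=
    (hΦ.continuous_fderiv (by simp)).clm_apply continuous_const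
  have hdc : HasCompactSupport fun p : ℝ × ℝ => fderiv ℝ Φ p (1, 0) := hc.fderiv_apply ℝ _
  have i1 : Integrable (fun p : ℝ × ℝ => (A₀ p.2 + ∫ z in (0 : ℝ)..p.1, k z p.2)
      * fderiv ℝ Φ p (1, 0)) (halfStrip a b) := by
    have hi : Integrable (fun p : ℝ × ℝ => (B + C * |p.1|) * |fderiv ℝ Φ p (1, 0)|) volume :=
      Continuous.integrable_of_hasCompactSupport (by fun_prop) (hdc.abs.mul_left)
    refine (hi.mono_measure hle).mono' ?_ (ae_of_all _ fun p => ?_)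
    · exact (((hA.comp measurable_snd).add (measurable_primitive hk)).mul
        hd.measurable).aestronglyMeasurable
    · rw [norm_mul, Real.norm_eq_abs, Real.norm_eq_abs]
      refine mul_le_mul_of_nonneg_right ((abs_add_le _ _).trans (add_le_add (hB _) ?_))
        (abs_nonneg _)
      exact abs_primitive_le (fun z => hC z _) _
  have i2 : Integrable (fun p : ℝ × ℝ => k p.1 p.2 * Φ p) (halfStrip a b) :=
    ((hΦ.continuous.integrable_of_hasCompactSupport hc).mono_measure hle).bdd_mul
      (c := C) (hk.aestronglyMeasurable) (ae_of_all _ fun p => hC _ _)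
  have hi : Integrable (fun p => (A₀ p.2 + ∫ z in (0 : ℝ)..p.1, k z p.2) * fderiv ℝ Φ p (1, 0)
      + k p.1 p.2 * Φ p) (halfStrip a b) := i1.add i2
  refine ⟨hi, ?_⟩
  rw [halfStrip] at hi ⊢
  rw [integral_prod_symm _ hi, ← integral_neg]
  refine integral_congr_ae (ae_of_all _ fun ξ => ?_)
  have h1 := integral_primitive_mul_deriv (k := fun z => k z ξ) (ψ := fun y => Φ (y, ξ)) (C := C)
    (hk.comp measurable_prodMk_right) (fun z => hC z ξ) (A₀ ξ) (contDiff_slice_left hΦ ξ)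
    (hasCompactSupport_slice_left hc ξ)
  have h2 : ∀ y, deriv (fun y => Φ (y, ξ)) y = fderiv ℝ Φ (y, ξ) (1, 0) := fun y =>
    deriv_fst_eq hΦ (y, ξ)
  simp only [h2] at h1
  exact h1

/-- Every test function is, on `{y > 0}`, the `y`-derivative of a test function, which need not vanish
at `y = 0`. The primitive is `-∫ ψ` over `[y, y + T]`, a convolution of `ψ` with a measure on a
segment, which gives its smoothness; for `y > 0` the upper end lies outside the support of `ψ`. -/
theorem exists_test_primitive {ψ : ℝ × ℝ → ℝ} (hψ : ContDiff ℝ ∞ ψ) (hc : HasCompactSupport ψ) :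
    ∃ Φ : ℝ × ℝ → ℝ, ContDiff ℝ ∞ Φ ∧ HasCompactSupport Φ ∧
      ∀ p : ℝ × ℝ, 0 < p.1 → fderiv ℝ Φ p (1, 0) = ψ p := by
  obtain ⟨T, hT0, hT⟩ : ∃ T > 0, ∀ p : ℝ × ℝ, T < ‖p‖ → ψ p = 0 := by
    obtain ⟨T, hT⟩ := hc.isCompact.isBounded.exists_norm_le
    refine ⟨max T 0 + 1, by positivity, fun p hp => image_eq_zero_of_notMem_tsupport fun h => ?_⟩
    linarith [hT p h, le_max_left T 0]
  set μ : Measure (ℝ × ℝ) := (volume.restrict (Ioc (-T) 0)).map fun s => ((s, 0) : ℝ × ℝ) with hμ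
  have hμf : IsFiniteMeasure μ := by
    have : IsFiniteMeasure (volume.restrict (Ioc (-T) (0 : ℝ))) :=
      isFiniteMeasure_restrict.2 (by simp)
    exact Measure.isFiniteMeasure_map _ _
  have hms : Measurable fun s : ℝ => ((s, 0) : ℝ × ℝ) := by fun_prop
  set Ψ : ℝ × ℝ → ℝ := (fun _ => (1 : ℝ)) ⋆[ContinuousLinearMap.mul ℝ ℝ, μ] ψ with hΨ
  have hΨs : ContDiff ℝ ∞ Ψ :=
    hc.contDiff_convolution_right _ (locallyIntegrable_const 1) hψ
  have hΨe : ∀ y ξ, Ψ (y, ξ) = ∫ z in y..(y + T), ψ (z, ξ) := by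
    intro y ξ
    have h1 : Ψ (y, ξ) = ∫ q, ψ ((y, ξ) - q) ∂μ := by
      simp [hΨ, convolution]
    have hcont : Continuous fun q : ℝ × ℝ => ψ ((y, ξ) - q) := hψ.continuous.comp (by fun_prop)
    rw [h1, hμ, integral_map hms.aemeasurable hcont.aestronglyMeasurable,
      ← intervalIntegral.integral_of_le (by linarith)]
    have := intervalIntegral.integral_comp_sub_left (a := -T) (b := 0) (fun z => ψ (z, ξ)) y
    simpa using this
  refine ⟨fun p => -Ψ p, hΨs.neg, ?_, fun p hp => ?_⟩
  · refine HasCompactSupport.intro (isCompact_closedBall (0 : ℝ × ℝ) (2 * T)) fun p hp => ?_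
    rw [mem_closedBall_zero_iff, not_le] at hp
    have : Ψ (p.1, p.2) = 0 := by
      rw [hΨe, intervalIntegral.integral_zero_ae]
      refine ae_of_all _ fun z hz => hT _ ?_
      rw [uIoc_of_le (by linarith)] at hz
      rw [Prod.norm_def, lt_sup_iff] at hp ⊢
      rcases hp with h | h
      · left
        rw [Real.norm_eq_abs, lt_abs] at h ⊢
        rcases h with h | h
        · left; simp only; linarith [hz.1]
        · right; simp only; linarith [hz.2]
      · right; simp only; linarith
    simpa using this
  · rw [← deriv_fst_eq hΨs.neg]
    have hcont : Continuous fun z => ψ (z, p.2) := hψ.continuous.comp (by fun_prop)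
    have hii : ∀ u v, IntervalIntegrable (fun z => ψ (z, p.2)) volume u v := fun u v =>
      hcont.intervalIntegrable u v
    have e : (fun y => -Ψ (y, p.2)) = fun y =>
        (∫ z in (0 : ℝ)..y, ψ (z, p.2)) - ∫ z in (0 : ℝ)..(y + T), ψ (z, p.2) := by
      ext y
      rw [hΨe, ← intervalIntegral.integral_interval_sub_left (hii 0 (y + T)) (hii 0 y)]
      ring
    rw [e]
    have d1 : ∀ y, HasDerivAt (fun y => ∫ z in (0 : ℝ)..y, ψ (z, p.2)) (ψ (y, p.2)) y := fun y =>
      intervalIntegral.integral_hasDerivAt_right (hii _ _)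
        (hcont.stronglyMeasurableAtFilter _ _) hcont.continuousAt
    have d2 : HasDerivAt (fun y => ∫ z in (0 : ℝ)..(y + T), ψ (z, p.2)) (ψ (p.1 + T, p.2)) p.1 :=
      (d1 (p.1 + T)).comp_add_const p.1 T
    refine ((d1 p.1).sub d2).deriv.trans ?_
    rw [hT (p.1 + T, p.2), sub_zero]
    rw [Prod.norm_def, lt_sup_iff]
    left
    rw [Real.norm_eq_abs, abs_of_pos (by linarith)]
    simp only; linarith

/-- A function on the half-strip whose weak `y`-derivative, with zero boundary values, vanishes is
zero. -/
theorem ae_eq_zero_of_weak_deriv {H : ℝ × ℝ → ℝ} (hH : LocallyIntegrable H (halfStrip a b))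
    (h : ∀ Φ : ℝ × ℝ → ℝ, ContDiff ℝ ∞ Φ → HasCompactSupport Φ →
      ∫ p, H p * fderiv ℝ Φ p (1, 0) ∂(halfStrip a b) = 0) :
    ∀ᵐ p ∂(halfStrip a b), H p = 0 := by
  refine ae_eq_zero_of_integral_contDiff_smul_eq_zero hH fun ψ hψ hc => ?_
  obtain ⟨Φ, hΦ, hΦc, hd⟩ := exists_test_primitive hψ hc
  rw [← h Φ hΦ hΦc]
  refine integral_congr_ae ?_
  have : ∀ᵐ p ∂(halfStrip a b), 0 < p.1 := by
    rw [halfStrip_eq_restrict]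
    filter_upwards [ae_restrict_mem (measurableSet_Ioi.prod measurableSet_Icc)] with p hp
    exact hp.1
  filter_upwards [this] with p hp
  rw [hd p hp, smul_eq_mul, mul_comm]

end

section
variable {a b : ℝ} {α : ℝ → ℝ}

theorem ae_halfStrip {p : ℝ × ℝ → Prop} (h : ∀ᵐ q ∂(halfStrip a b), p q) :
    (∀ᵐ y ∂(volume.restrict (Ioi (0 : ℝ))), ∀ᵐ ξ ∂(volume.restrict (Icc a b)), p (y, ξ)) ∧
    ∀ᵐ ξ ∂(volume.restrict (Icc a b)), ∀ᵐ y ∂(volume.restrict (Ioi (0 : ℝ))), p (y, ξ) := by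
  rw [halfStrip] at h
  exact ⟨Measure.ae_ae_of_ae_prod h,
    Measure.ae_ae_of_ae_prod (Measure.measurePreserving_swap.quasiMeasurePreserving.ae h)⟩

/-- A weak solution agrees almost everywhere with a solution of the integrated equation. -/
theorem exists_isMild_of_weak (hα : IsVelocity a b α) {G : ℝ → ℝ → ℝ}
    (hm : Measurable (Function.uncurry G)) (hr : ∀ y ξ, G y ξ ∈ Icc (0 : ℝ) 1) {γ : ℝ → ℝ}
    (hγm : Measurable γ) (hγr : ∀ ξ, γ ξ ∈ Icc (0 : ℝ) 1)
    (hw : ∀ Φ : ℝ × ℝ → ℝ, ContDiff ℝ ∞ Φ → HasCompactSupport Φ →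
      ∫ p, (α p.2 * G p.1 p.2 * fderiv ℝ Φ p (1, 0)
        + (equil (dens a b G p.1) p.2 - G p.1 p.2) * Φ p) ∂(halfStrip a b)
      = -∫ ξ in Icc a b, α ξ * γ ξ * Φ (0, ξ)) :
    ∃ G', IsMild a b α G' ∧ (∀ᵐ p ∂(halfStrip a b), G' p.1 p.2 = G p.1 p.2) ∧
      ∀ᵐ ξ ∂(volume.restrict (Icc a b)), G' 0 ξ = γ ξ := by
  obtain ⟨B, hB⟩ := hα.bounded
  have hle : halfStrip a b ≤ volume := halfStrip_le
  set k : ℝ → ℝ → ℝ := fun z ξ => equil (dens a b G z) ξ - G z ξ with hk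
  have hkm : Measurable (Function.uncurry k) := (measurable_equil_dens hm).sub hm
  have hkC : ∀ z ξ, |k z ξ| ≤ 1 := fun z ξ => sub_mem_Icc (equil_mem _ _) (hr z ξ)
  have hA₀m : Measurable fun ξ => α ξ * γ ξ := hα.measurable.mul hγm
  have hbd : ∀ {v : ℝ} ξ, v ∈ Icc (0 : ℝ) 1 → |α ξ * v| ≤ B := fun ξ hv => by
    rw [abs_mul, abs_of_nonneg hv.1]
    exact (mul_le_of_le_one_right (abs_nonneg _) hv.2).trans (hB ξ)
  have hA₀B : ∀ ξ, |α ξ * γ ξ| ≤ B := fun ξ => hbd ξ (hγr ξ)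
  have hαG : Measurable fun p : ℝ × ℝ => α p.2 * G p.1 p.2 :=
    (hα.measurable.comp measurable_snd).mul hm
  -- `A` and `α G` have the same weak derivative and the same boundary values
  set A : ℝ → ℝ → ℝ := fun y ξ => α ξ * γ ξ + ∫ z in (0 : ℝ)..y, k z ξ with hA
  have hAm : Measurable fun p : ℝ × ℝ => A p.1 p.2 :=
    (hA₀m.comp measurable_snd).add (measurable_primitive hkm)
  have hH : ∀ᵐ p ∂(halfStrip a b), α p.2 * G p.1 p.2 - A p.1 p.2 = 0 := by
    refine ae_eq_zero_of_weak_deriv ?_ fun Φ hΦ hc => ?_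
    · have hl : LocallyIntegrable (fun p : ℝ × ℝ => B + (B + 1 * |p.1|)) (halfStrip a b) := by
        rw [halfStrip_eq_restrict]
        exact Continuous.locallyIntegrable (by fun_prop)
      refine hl.mono (hαG.sub hAm).aestronglyMeasurable (ae_of_all _ fun p => ?_)
      refine le_trans ?_ (le_abs_self _)
      refine (norm_sub_le _ _).trans (add_le_add (hbd _ (hr _ _)) ?_)
      exact (abs_add_le _ _).trans (add_le_add (hA₀B _) (abs_primitive_le (fun z => hkC z _) _))
    · obtain ⟨i1, e1⟩ := integral_weak_primitive (a := a) (b := b) hA₀m hA₀B hkm hkC hΦ hc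
      have i2 : Integrable (fun p : ℝ × ℝ => α p.2 * G p.1 p.2 * fderiv ℝ Φ p (1, 0)
          + k p.1 p.2 * Φ p) (halfStrip a b) :=
        (((integrable_fderiv hΦ hc _).mono_measure hle).bdd_mul hαG.aestronglyMeasurable
          (ae_of_all _ fun p => hbd _ (hr _ _))).add
        (((hΦ.continuous.integrable_of_hasCompactSupport hc).mono_measure hle).bdd_mul
          hkm.aestronglyMeasurable (ae_of_all _ fun p => hkC _ _))
      have e2 := hw Φ hΦ hc
      rw [← e1, ← sub_eq_zero] at e2
      rw [← integral_sub i2 i1] at e2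
      refine (integral_congr_ae (ae_of_all _ fun p => ?_)).trans e2
      simp only [hA]; ring
  -- the truncation is only active on a null set and keeps the values in `[0, 1]` everywhere
  set G' : ℝ → ℝ → ℝ := fun y ξ => max 0 (min 1 ((α ξ)⁻¹ * A y ξ)) with hG'
  have hG'm : Measurable (Function.uncurry G') :=
    measurable_const.max (measurable_const.min ((hα.measurable.comp measurable_snd).inv.mul hAm))
  have hG'r : ∀ y ξ, G' y ξ ∈ Icc (0 : ℝ) 1 := fun y ξ =>
    ⟨le_max_left _ _, max_le zero_le_one (min_le_left _ _)⟩
  have clamp : ∀ {y ξ : ℝ}, (α ξ)⁻¹ * A y ξ ∈ Icc (0 : ℝ) 1 → G' y ξ = (α ξ)⁻¹ * A y ξ :=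
    fun h => by simp only [hG']; rw [min_eq_right h.2, max_eq_right h.1]
  have hne : ∀ᵐ p ∂(halfStrip a b), α p.2 ≠ 0 := by
    rw [halfStrip]
    exact Measure.quasiMeasurePreserving_snd.ae hα.ne_zero
  have heq : ∀ᵐ p ∂(halfStrip a b), G' p.1 p.2 = G p.1 p.2 := by
    filter_upwards [hH, hne] with p h1 h2
    have h3 : (α p.2)⁻¹ * A p.1 p.2 = G p.1 p.2 := by
      rw [← sub_eq_zero.1 h1, inv_mul_cancel_left₀ h2]
    rw [clamp (h3 ▸ hr _ _), h3]
  have h0 : ∀ ξ, α ξ ≠ 0 → (α ξ)⁻¹ * A 0 ξ = γ ξ := fun ξ h => by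
    simp [hA, h]
  have hG'0 : ∀ ξ, α ξ ≠ 0 → G' 0 ξ = γ ξ := fun ξ h => by
    rw [clamp (h0 ξ h ▸ hγr ξ), h0 ξ h]
  refine ⟨G', ⟨hG'm, hG'r, ?_⟩, heq, hα.ne_zero.mono hG'0⟩
  have hdens : ∀ᵐ z ∂(volume.restrict (Ioi (0 : ℝ))), dens a b G' z = dens a b G z := by
    filter_upwards [(ae_halfStrip heq).1] with z hz
    rw [dens, dens, integral_congr_ae hz]
  filter_upwards [hα.ne_zero, (ae_halfStrip hH).2, (ae_halfStrip heq).2] with ξ h1 h2 h3 y hy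
  have hAc : Continuous fun y => (α ξ)⁻¹ * A y ξ := by
    have := intervalIntegral.continuous_primitive (fun u v =>
      intervalIntegrable_of_bounded (hkm.comp (measurable_prodMk_right (y := ξ)))
        (fun z => hkC z ξ) u v) 0
    exact continuous_const.mul (continuous_const.add this)
  -- by continuity in `y` the bounds hold for all `y`, not only for almost all
  have hin : ∀ y, 0 < y → (α ξ)⁻¹ * A y ξ ∈ Icc (0 : ℝ) 1 := by
    have hopen : IsOpen (Ioi (0 : ℝ) ∩ (fun y => (α ξ)⁻¹ * A y ξ) ⁻¹' (Icc 0 1)ᶜ) :=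
      isOpen_Ioi.inter (isClosed_Icc.isOpen_compl.preimage hAc)
    have hnull : volume (Ioi (0 : ℝ) ∩ (fun y => (α ξ)⁻¹ * A y ξ) ⁻¹' (Icc 0 1)ᶜ) = 0 := by
      refine measure_eq_zero_iff_ae_notMem.2 ?_
      filter_upwards [(ae_restrict_iff' measurableSet_Ioi).1 h2] with y hy hmem
      refine hmem.2 ?_
      change (α ξ)⁻¹ * A y ξ ∈ Icc 0 1
      rw [← sub_eq_zero.1 (hy hmem.1), inv_mul_cancel_left₀ h1]
      exact hr _ _
    intro y hy
    by_contra hcon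
    have : y ∈ (∅ : Set ℝ) := (hopen.measure_eq_zero_iff volume).1 hnull ▸ ⟨hy, hcon⟩
    exact this
  have hval : α ξ * G' y ξ = A y ξ := by
    rcases hy.eq_or_lt with rfl | hy
    · rw [hG'0 ξ h1]; simp [hA]
    · rw [clamp (hin y hy), mul_inv_cancel_left₀ h1]
  rw [hval, hG'0 ξ h1, hA]
  simp only [add_right_inj]
  refine intervalIntegral.integral_congr_ae ?_
  filter_upwards [(ae_restrict_iff' measurableSet_Ioi).1 hdens,
    (ae_restrict_iff' measurableSet_Ioi).1 h3] with z hz1 hz2 hz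
  rw [uIoc_of_le hy] at hz
  simp only [hk]
  rw [hz1 hz.1, hz2 hz.1]

end

/-! ### From kinetic densities to shifted kinetic densities -/

section
variable {n m : ℕ} {a b : ℝ} {α : ℝ → ℝ}

/-- The shift by `1_{ξ ≤ 0}` turns the constraint `g ∈ D ξ` into `0 ≤ G ≤ 1`. -/
theorem mem_D_iff {g ξ : ℝ} (hξ : ξ ≠ 0) : g ∈ D ξ ↔ g + equil 0 ξ ∈ Icc (0 : ℝ) 1 := by
  rw [D, mem_ofPred_eq, mem_Icc]
  rcases lt_or_gt_of_ne hξ with h | h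
  · rw [Real.sign_of_neg h, equil, if_pos h.le]
    constructor
    · rintro ⟨h1, h2⟩
      have := abs_nonneg g
      constructor <;> linarith
    · rintro ⟨h1, h2⟩
      rw [abs_of_nonpos (by linarith)]
      constructor <;> linarith
  · rw [Real.sign_of_pos h, equil, if_neg (not_le.2 h)]
    constructor
    · rintro ⟨h1, h2⟩
      have := abs_nonneg g
      constructor <;> linarith
    · rintro ⟨h1, h2⟩
      rw [abs_of_nonneg (by linarith)]
      constructor <;> linarith

theorem chi_add_equil {ρ ξ : ℝ} (h0 : ξ ≠ 0) (hρ : ξ ≠ ρ) :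
    chi ρ ξ + equil 0 ξ = equil ρ ξ := by
  unfold chi equil
  rcases lt_or_gt_of_ne h0 with h | h <;> rcases lt_or_gt_of_ne hρ with h' | h' <;>
    simp [h, h', h.le, h'.le, h.not_gt, h'.not_gt, h.not_ge, h'.not_ge]

theorem ae_chi_add_equil (ρ : ℝ) (s : Set ℝ) :
    ∀ᵐ ξ ∂(volume.restrict s), chi ρ ξ + equil 0 ξ = equil ρ ξ := by
  filter_upwards [ae_restrict_of_ae (Measure.ae_ne volume 0),
    ae_restrict_of_ae (Measure.ae_ne volume ρ)] with ξ h0 hρ using chi_add_equil h0 hρ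

theorem integral_add_equil_zero (h0 : (0 : ℝ) ∈ Icc a b) {f : ℝ → ℝ}
    (hf : Integrable f (volume.restrict (Icc a b))) :
    a + ∫ ξ in Icc a b, (f ξ + equil 0 ξ) = ∫ ξ in Icc a b, f ξ := by
  rw [integral_add hf (integrable_equil 0), integral_equil h0]; ring

instance : SFinite (halfStrip a b) := by
  unfold halfStrip; infer_instance

theorem ae_halfStrip_fst {p : ℝ → Prop} (h : ∀ᵐ y ∂(volume.restrict (Ioi (0 : ℝ))), p y) :
    ∀ᵐ q ∂(halfStrip a b), p q.1 := by
  rw [halfStrip]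
  exact Measure.quasiMeasurePreserving_fst.ae h

theorem ae_halfStrip_snd {p : ℝ → Prop} (h : ∀ᵐ ξ ∂(volume.restrict (Icc a b)), p ξ) :
    ∀ᵐ q ∂(halfStrip a b), p q.2 := by
  rw [halfStrip]
  exact Measure.quasiMeasurePreserving_snd.ae h

/-- The reflection `y ↦ x` which maps the half-line `y > 0` to the road. -/
theorem measurePreserving_road (h : Fin n ⊕ Fin m) :
    MeasurePreserving (fun y => -sgn h * y) (volume.restrict (Ioi (0 : ℝ)))
      (volume.restrict (dom h)) := by
  rcases h with i | j
  · have := (Measure.measurePreserving_neg (volume : Measure ℝ)).restrict_preimage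
      (s := Iio (0 : ℝ)) measurableSet_Iio
    simpa [sgn, dom] using this
  · have := MeasurePreserving.id (volume.restrict (Ioi (0 : ℝ)))
    simpa [sgn, dom, Function.id_def] using this

theorem involutive_road (h : Fin n ⊕ Fin m) (y : ℝ) : -sgn h * (-sgn h * y) = y := by
  rw [← mul_assoc, neg_mul_neg, sgn_mul_self, one_mul]

/-- The reflection `y ↦ x` as a homeomorphism of the line. -/
noncomputable def roadHomeo (h : Fin n ⊕ Fin m) : ℝ ≃ₜ ℝ where
  toFun y := -sgn h * y
  invFun x := -sgn h * x
  left_inv := involutive_road h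
  right_inv := involutive_road h
  continuous_toFun := by fun_prop
  continuous_invFun := by fun_prop

theorem measurePreserving_strip (h : Fin n ⊕ Fin m) :
    MeasurePreserving (fun p : ℝ × ℝ => ((-sgn h * p.1, p.2) : ℝ × ℝ)) (halfStrip a b)
      (volume.restrict (dom h ×ˢ Icc a b)) := by
  rw [Measure.volume_eq_prod, ← Measure.prod_restrict]
  exact (measurePreserving_road h).prod (MeasurePreserving.id (volume.restrict (Icc a b)))

theorem measurableEmbedding_strip (h : Fin n ⊕ Fin m) :
    MeasurableEmbedding fun p : ℝ × ℝ => ((-sgn h * p.1, p.2) : ℝ × ℝ) :=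
  ((roadHomeo h).prodCongr (Homeomorph.refl ℝ)).measurableEmbedding

theorem measurePreserving_time_strip (h : Fin n ⊕ Fin m) :
    MeasurePreserving (fun p : ℝ × ℝ × ℝ => ((p.1, -sgn h * p.2.1, p.2.2) : ℝ × ℝ × ℝ))
      ((volume.restrict (Ioi 0)).prod (halfStrip a b))
      (volume.restrict (Ioi 0 ×ˢ dom h ×ˢ Icc a b)) := by
  rw [Measure.volume_eq_prod, ← Measure.prod_restrict]
  exact (MeasurePreserving.id (volume.restrict (Ioi (0 : ℝ)))).prod
    (measurePreserving_strip (a := a) (b := b) h)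

theorem measurableEmbedding_time_strip (h : Fin n ⊕ Fin m) :
    MeasurableEmbedding fun p : ℝ × ℝ × ℝ => ((p.1, -sgn h * p.2.1, p.2.2) : ℝ × ℝ × ℝ) :=
  ((Homeomorph.refl ℝ).prodCongr
    ((roadHomeo h).prodCongr (Homeomorph.refl ℝ))).measurableEmbedding

/-- The relaxation term in terms of the shifted kinetic density. -/
theorem ae_source_eq (h0 : (0 : ℝ) ∈ Icc a b) {G g : ℝ → ℝ → ℝ}
    (hm : Measurable (Function.uncurry G)) (hr : ∀ y ξ, G y ξ ∈ Icc (0 : ℝ) 1)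
    (hg : ∀ᵐ p ∂(halfStrip a b), G p.1 p.2 = g p.1 p.2 + equil 0 p.2) :
    ∀ᵐ p ∂(halfStrip a b), chi (∫ ξ in Icc a b, g p.1 ξ) p.2 - g p.1 p.2
      = equil (dens a b G p.1) p.2 - G p.1 p.2 := by
  have h1 : ∀ᵐ y ∂(volume.restrict (Ioi (0 : ℝ))), ∫ ξ in Icc a b, g y ξ = dens a b G y := by
    filter_upwards [(ae_halfStrip hg).1] with y hy
    have hGi : Integrable (G y) (volume.restrict (Icc a b)) :=
      integrable_Icc_of_bounded (C := 1) (hm.comp measurable_prodMk_left) fun ξ => by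
        rw [abs_of_nonneg (hr y ξ).1]; exact (hr y ξ).2
    have hgi : Integrable (g y) (volume.restrict (Icc a b)) := by
      refine (hGi.sub (integrable_equil 0)).congr ?_
      filter_upwards [hy] with ξ hξ
      simp [hξ]
    rw [← integral_add_equil_zero h0 hgi, dens]
    congr 1
    exact integral_congr_ae (hy.mono fun ξ hξ => hξ.symm)
  have h2 : ∀ᵐ p ∂(halfStrip a b), ∫ ξ in Icc a b, g p.1 ξ = dens a b G p.1 :=
    ae_halfStrip_fst h1
  have h3 : ∀ᵐ p ∂(halfStrip a b), p.2 ≠ 0 :=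
    ae_halfStrip_snd (ae_restrict_of_ae (Measure.ae_ne volume 0))
  have h4 : ∀ᵐ p ∂(halfStrip a b), p.2 ≠ dens a b G p.1 := by
    have hms : MeasurableSet {p : ℝ × ℝ | p.2 ≠ dens a b G p.1} :=
      (measurableSet_eq_fun measurable_snd ((measurable_dens hm).comp measurable_fst)).compl
    rw [halfStrip, Measure.ae_prod_iff_ae_ae hms]
    exact ae_of_all _ fun y => ae_restrict_of_ae (Measure.ae_ne volume (dens a b G y))
  filter_upwards [hg, h2, h3, h4] with p e1 e2 e3 e4
  rw [e2, e1, ← chi_add_equil e3 e4]; ring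

/-- Solutions of the integrated equation are weak solutions. -/
theorem IsMild.integral_weak {ε : ℝ} (hε : ε ≠ 0) (hα : IsVelocity a b α) {G : ℝ → ℝ → ℝ}
    (hG : IsMild a b (fun ξ => ε * α ξ) G) {Φ : ℝ × ℝ → ℝ} (hΦ : ContDiff ℝ ∞ Φ)
    (hc : HasCompactSupport Φ) :
    ∫ p, (α p.2 * (G p.1 p.2 - equil 0 p.2) * fderiv ℝ Φ p (1, 0)
        + (equil (dens a b G p.1) p.2 - G p.1 p.2) / ε * Φ p) ∂(halfStrip a b)
      = -∫ ξ in Icc a b, α ξ * (G 0 ξ - equil 0 ξ) * Φ (0, ξ) := by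
  obtain ⟨B, hB⟩ := hα.bounded
  set k : ℝ → ℝ → ℝ := fun z ξ => (equil (dens a b G z) ξ - G z ξ) / ε with hk
  have hkm : Measurable (Function.uncurry k) :=
    ((measurable_equil_dens hG.measurable).sub hG.measurable).div_const ε
  have hkC : ∀ z ξ, |k z ξ| ≤ 1 / |ε| := fun z ξ => by
    rw [hk, abs_div]
    gcongr
    exact sub_mem_Icc (equil_mem _ _) (hG.range z ξ)
  have hA₀m : Measurable fun ξ => α ξ * (G 0 ξ - equil 0 ξ) :=
    hα.measurable.mul ((hG.measurable.comp measurable_prodMk_left).sub (measurable_equil_right 0))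
  have hA₀B : ∀ ξ, |α ξ * (G 0 ξ - equil 0 ξ)| ≤ B := fun ξ => by
    rw [abs_mul]
    exact (mul_le_of_le_one_right (abs_nonneg _)
      (sub_mem_Icc (hG.range 0 ξ) (equil_mem 0 ξ))).trans (hB ξ)
  rw [← (integral_weak_primitive hA₀m hA₀B hkm hkC hΦ hc).2]
  refine integral_congr_ae ?_
  have hpos : ∀ᵐ p ∂(halfStrip a b), 0 < p.1 :=
    ae_halfStrip_fst (ae_restrict_mem measurableSet_Ioi)
  filter_upwards [hpos, ae_halfStrip_snd hG.mild] with p hp hm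
  have h1 := hm p.1 hp.le
  have h2 : ∫ z in (0 : ℝ)..p.1, k z p.2
      = (∫ z in (0 : ℝ)..p.1, (equil (dens a b G z) p.2 - G z p.2)) / ε :=
    intervalIntegral.integral_div _ _
  have h3 : ∫ z in (0 : ℝ)..p.1, k z p.2 = α p.2 * G p.1 p.2 - α p.2 * G 0 p.2 := by
    rw [h2, div_eq_iff hε]; linear_combination -h1
  rw [h3]
  simp only [hk]
  ring

end

/-! ### Solutions of the half-space problem solve the BGK model -/

section
variable {n m : ℕ} {R : Fin n ⊕ Fin m → Road} {φ : ℝ × ℝ × ℝ → ℝ}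

theorem deriv_time_eq (hφ : ContDiff ℝ ∞ φ) (t : ℝ) (q : ℝ × ℝ) :
    deriv (fun t => φ (t, q)) t = fderiv ℝ φ (t, q) (1, 0) := by
  have h1 : HasFDerivAt φ (fderiv ℝ φ (t, q)) (t, q) :=
    (hφ.differentiable (by simp) _).hasFDerivAt
  exact (h1.comp_hasDerivAt t ((hasDerivAt_id t).prodMk (hasDerivAt_const t q))).deriv

theorem fderiv_slice_eq (hφ : ContDiff ℝ ∞ φ) (t : ℝ) (q v : ℝ × ℝ) :
    fderiv ℝ (fun q => φ (t, q)) q v = fderiv ℝ φ (t, q) (0, v) := by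
  have h1 : HasFDerivAt φ (fderiv ℝ φ (t, q)) (t, q) :=
    (hφ.differentiable (by simp) _).hasFDerivAt
  have h2 : HasFDerivAt (fun q : ℝ × ℝ => ((t, q) : ℝ × ℝ × ℝ))
      (ContinuousLinearMap.inr ℝ ℝ (ℝ × ℝ)) q := hasFDerivAt_prodMk_right t q
  exact (congrArg (fun l : ℝ × ℝ →L[ℝ] ℝ => l v) (h1.comp q h2).fderiv).trans (by simp)

theorem hasCompactSupport_slice_time (hc : HasCompactSupport φ) (t : ℝ) :
    HasCompactSupport fun q : ℝ × ℝ => φ (t, q) :=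
  hc.comp_isClosedEmbedding (g := fun q => (t, q))
    (Topology.IsClosedEmbedding.of_continuous_injective_isClosedMap (by fun_prop)
      (fun _ _ h => (Prod.ext_iff.1 h).2) (isClosedMap_prodMk_left t))

theorem hasCompactSupport_slice_state (hc : HasCompactSupport φ) (q : ℝ × ℝ) :
    HasCompactSupport fun t : ℝ => φ (t, q) :=
  hc.comp_isClosedEmbedding (g := fun t => (t, q))
    (Topology.IsClosedEmbedding.of_continuous_injective_isClosedMap (by fun_prop)
      (fun _ _ h => (Prod.ext_iff.1 h).1) (isClosedMap_prodMk_right q))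

theorem integral_deriv_Ioi {ψ : ℝ → ℝ} (hψ : ContDiff ℝ ∞ ψ) (hc : HasCompactSupport ψ) :
    ∫ t in Ioi 0, deriv ψ t = -ψ 0 := by
  have := integral_primitive_mul_deriv (k := fun _ => 0) (C := 0) measurable_const (by simp) 1
    hψ hc
  simpa using this

/-- A solution of the half-space problem, written in the coordinates of the road, satisfies the
weak form of the time-dependent BGK equation. -/
theorem IsMild.equation (hR : ∀ h, (R h).Admissible) {ε : ℝ} (hε : ε ≠ 0) {h : Fin n ⊕ Fin m}
    {G : ℝ → ℝ → ℝ} (hG : IsMild (R h).a (R h).b (fun ξ => ε * velocity R h ξ) G)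
    (hφ : ContDiff ℝ ∞ φ) (hc : HasCompactSupport φ) {g : ℝ → ℝ → ℝ} {γ : ℝ → ℝ}
    (hg : ∀ x ξ, g x ξ = G (-sgn h * x) ξ - equil 0 ξ) (hγ : ∀ ξ, γ ξ = G 0 ξ - equil 0 ξ) :
    (∫ p in Ioi (0 : ℝ) ×ˢ dom h ×ˢ (R h).K,
      (g p.2.1 p.2.2 * (deriv (fun t => φ (t, p.2.1, p.2.2)) p.1
          + (R h).df p.2.2 * deriv (fun x => φ (p.1, x, p.2.2)) p.2.1)
        + (chi (∫ ξ in (R h).K, g p.2.1 ξ) p.2.2 - g p.2.1 p.2.2) / ε * φ p))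
      + (∫ p in dom h ×ˢ (R h).K, g p.1 p.2 * φ (0, p.1, p.2))
    = sgn h * ∫ p in Ioi (0 : ℝ) ×ˢ (R h).K, (R h).df p.2 * γ p.2 * φ (p.1, 0, p.2) := by
  have hα := isVelocity_velocity hR h
  obtain ⟨B, hB⟩ := hα.bounded
  have h0 : (0 : ℝ) ∈ Icc (R h).a (R h).b := (hR h).zero_mem
  set a := (R h).a with ha
  set b := (R h).b with hb
  set τ : ℝ := -sgn h with hτ
  have hττ : ∀ y, τ * (τ * y) = y := involutive_road h
  have hgτ : ∀ y ξ, g (τ * y) ξ = G y ξ - equil 0 ξ := fun y ξ => by rw [hg, hττ]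
  -- the test function in the coordinate `y = |x|`
  set χ : ℝ × ℝ × ℝ → ℝ := fun p => φ (p.1, τ * p.2.1, p.2.2) with hχ
  have hχs : ContDiff ℝ ∞ χ := hφ.comp (by fun_prop)
  have hχc : HasCompactSupport χ := hc.comp_homeomorph
    ((Homeomorph.refl ℝ).prodCongr ((roadHomeo h).prodCongr (Homeomorph.refl ℝ)))
  set μ : Measure (ℝ × ℝ × ℝ) := (volume.restrict (Ioi 0)).prod (halfStrip a b) with hμ
  have hμle : μ ≤ volume := by
    rw [hμ, halfStrip_eq_restrict, Measure.prod_restrict, ← Measure.volume_eq_prod]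
    exact Measure.restrict_le_self
  have hd : ∀ v, Integrable (fun p => fderiv ℝ χ p v) μ := fun v =>
    (((hχs.continuous_fderiv (by simp)).clm_apply
      continuous_const).integrable_of_hasCompactSupport (hχc.fderiv_apply ℝ v)).mono_measure hμle
  have hGm : Measurable fun p : ℝ × ℝ => G p.1 p.2 - equil 0 p.2 :=
    hG.measurable.sub ((measurable_equil_right 0).comp measurable_snd)
  have hGb : ∀ y ξ, |G y ξ - equil 0 ξ| ≤ 1 := fun y ξ =>
    sub_mem_Icc (hG.range y ξ) (equil_mem 0 ξ)
  have hvG : ∀ y ξ, |velocity R h ξ * (G y ξ - equil 0 ξ)| ≤ B := fun y ξ => by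
    rw [abs_mul]
    exact (mul_le_of_le_one_right (abs_nonneg _) (hGb y ξ)).trans (hB ξ)
  have hvGm : Measurable fun p : ℝ × ℝ => velocity R h p.2 * (G p.1 p.2 - equil 0 p.2) :=
    (hα.measurable.comp measurable_snd).mul hGm
  set k : ℝ → ℝ → ℝ := fun y ξ => (equil (dens a b G y) ξ - G y ξ) / ε with hk
  have hkm : Measurable (Function.uncurry k) :=
    ((measurable_equil_dens hG.measurable).sub hG.measurable).div_const ε
  have hkC : ∀ z ξ, |k z ξ| ≤ 1 / |ε| := fun z ξ => by
    rw [hk, abs_div]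
    gcongr
    exact sub_mem_Icc (equil_mem _ _) (hG.range z ξ)
  set F₁ : ℝ × ℝ × ℝ → ℝ := fun p => (G p.2.1 p.2.2 - equil 0 p.2.2) * fderiv ℝ χ p (1, 0)
    with hF₁
  set F₂ : ℝ × ℝ × ℝ → ℝ := fun p => velocity R h p.2.2 * (G p.2.1 p.2.2 - equil 0 p.2.2)
    * fderiv ℝ χ p (0, 1, 0) + k p.2.1 p.2.2 * χ p with hF₂
  have iF₁ : Integrable F₁ μ := (hd _).bdd_mul (c := 1)
    (hGm.comp measurable_snd).aestronglyMeasurable (ae_of_all _ fun p => hGb _ _)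
  have iF₂ : Integrable F₂ μ := ((hd _).bdd_mul (hvGm.comp measurable_snd).aestronglyMeasurable
    (ae_of_all _ fun p => hvG _ _)).add
    (((hχs.continuous.integrable_of_hasCompactSupport hχc).mono_measure hμle).bdd_mul
      (hkm.comp measurable_snd).aestronglyMeasurable (ae_of_all _ fun p => hkC _ _))
  have hsrc : ∀ᵐ p ∂μ, chi (∫ ξ in Icc a b, g (τ * p.2.1) ξ) p.2.2 - g (τ * p.2.1) p.2.2
      = equil (dens a b G p.2.1) p.2.2 - G p.2.1 p.2.2 :=
    Measure.quasiMeasurePreserving_snd.ae (ae_source_eq h0 hG.measurable hG.range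
      (g := fun y => g (τ * y)) (ae_of_all _ fun p => by rw [hgτ]; ring))
  have hK : ∀ᵐ p ∂μ, p.2.2 ∈ (R h).K :=
    Measure.quasiMeasurePreserving_snd.ae (ae_halfStrip_snd (ae_restrict_mem measurableSet_Icc))
  have e1 : ∫ p in Ioi (0 : ℝ) ×ˢ dom h ×ˢ (R h).K,
      (g p.2.1 p.2.2 * (deriv (fun t => φ (t, p.2.1, p.2.2)) p.1
          + (R h).df p.2.2 * deriv (fun x => φ (p.1, x, p.2.2)) p.2.1)
        + (chi (∫ ξ in (R h).K, g p.2.1 ξ) p.2.2 - g p.2.1 p.2.2) / ε * φ p)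
      = (∫ p, F₁ p ∂μ) + ∫ p, F₂ p ∂μ := by
    rw [← integral_add iF₁ iF₂]
    refine ((measurePreserving_time_strip h).integral_comp
      (measurableEmbedding_time_strip h) _).symm.trans (integral_congr_ae ?_)
    filter_upwards [hsrc, hK] with p hp hpK
    have d1 : deriv (fun t => φ (t, τ * p.2.1, p.2.2)) p.1 = fderiv ℝ χ p (1, 0) :=
      deriv_time_eq hχs p.1 p.2
    have d2 : fderiv ℝ χ p (0, 1, 0) = τ * deriv (fun x => φ (p.1, x, p.2.2)) (τ * p.2.1) := by
      have hs : ContDiff ℝ ∞ fun q => χ (p.1, q) := hχs.comp (by fun_prop)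
      rw [← smul_eq_mul]
      refine Eq.trans ?_ (deriv_comp_mul_left τ (fun x => φ (p.1, x, p.2.2)) p.2.1)
      exact (fderiv_slice_eq hχs p.1 p.2 (1, 0)).symm.trans (deriv_fst_eq hs p.2).symm
    simp only [← hτ]
    rw [d1, df_eq hpK, ← hτ]
    simp only [hF₁, hF₂, d2, hk, ← hp, hgτ]
    simp only [hχ]
    have hKe : (R h).K = Icc a b := rfl
    rw [hKe]
    ring
  -- the time derivative cancels against the initial values, as `G` does not depend on time
  have e2 : ∫ p in dom h ×ˢ (R h).K, g p.1 p.2 * φ (0, p.1, p.2)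
      = ∫ q, (G q.1 q.2 - equil 0 q.2) * χ (0, q) ∂(halfStrip a b) := by
    refine ((measurePreserving_strip h).integral_comp (measurableEmbedding_strip h) _).symm.trans
      (integral_congr_ae (ae_of_all _ fun q => ?_))
    simp only [← hτ, hgτ, hχ]
  have e3 : ∫ p, F₁ p ∂μ = -∫ q, (G q.1 q.2 - equil 0 q.2) * χ (0, q) ∂(halfStrip a b) := by
    rw [hμ, integral_prod_symm _ iF₁, ← integral_neg]
    refine integral_congr_ae (ae_of_all _ fun q => ?_)
    have hs : ContDiff ℝ ∞ fun t => χ (t, q) := hχs.comp (by fun_prop)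
    simp only [hF₁, integral_const_mul, ← deriv_time_eq hχs]
    rw [integral_deriv_Ioi hs (hasCompactSupport_slice_state hχc q)]
    ring
  have e4 : ∫ p, F₂ p ∂μ = -∫ t in Ioi (0 : ℝ), ∫ ξ in Icc a b,
      velocity R h ξ * γ ξ * φ (t, 0, ξ) := by
    rw [hμ, integral_prod _ iF₂, ← integral_neg]
    refine integral_congr_ae (ae_of_all _ fun t => ?_)
    have := IsMild.integral_weak hε hα hG (Φ := fun q => χ (t, q)) (hχs.comp (by fun_prop))
      (hasCompactSupport_slice_time hχc t)
    simp only [fderiv_slice_eq hχs] at this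
    refine this.trans ?_
    simp only [hγ, hχ, mul_zero]
  have e5 : ∫ p in Ioi (0 : ℝ) ×ˢ (R h).K, (R h).df p.2 * γ p.2 * φ (p.1, 0, p.2)
      = τ * ∫ t in Ioi (0 : ℝ), ∫ ξ in Icc a b, velocity R h ξ * γ ξ * φ (t, 0, ξ) := by
    have hmeas : (volume : Measure (ℝ × ℝ)).restrict (Ioi (0 : ℝ) ×ˢ (R h).K) = halfStrip a b :=
      halfStrip_eq_restrict.symm
    have hφ0c : HasCompactSupport fun q : ℝ × ℝ => φ (q.1, 0, q.2) :=
      hc.comp_isClosedEmbedding (g := fun q : ℝ × ℝ => ((q.1, 0, q.2) : ℝ × ℝ × ℝ))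
        ((Topology.IsClosedEmbedding.id).prodMap
          (Topology.IsClosedEmbedding.of_continuous_injective_isClosedMap (f := fun ξ : ℝ => ((0, ξ) : ℝ × ℝ))
            (by fun_prop) (fun _ _ h => (Prod.ext_iff.1 h).2) (isClosedMap_prodMk_left 0)))
    have hi : Integrable (fun q : ℝ × ℝ => velocity R h q.2 * γ q.2 * φ (q.1, 0, q.2))
        (halfStrip a b) := by
      have hφ0s : Continuous fun q : ℝ × ℝ => φ (q.1, 0, q.2) :=
        hφ.continuous.comp (by fun_prop)
      refine ((hφ0s.integrable_of_hasCompactSupport hφ0c).mono_measure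
        halfStrip_le).bdd_mul (c := B) ?_
        (ae_of_all _ fun q => ?_)
      · have : Measurable fun ξ => velocity R h ξ * γ ξ := by
          simp only [hγ]
          exact hα.measurable.mul ((hG.measurable.comp measurable_prodMk_left).sub
            (measurable_equil_right 0))
        exact (this.comp measurable_snd).aestronglyMeasurable
      · rw [hγ]; exact hvG _ _
    rw [hmeas, ← integral_prod (μ := volume.restrict (Ioi (0 : ℝ)))
      (ν := volume.restrict (Icc a b)) _ hi, ← integral_const_mul]
    refine integral_congr_ae ?_
    filter_upwards [ae_halfStrip_snd (a := a) (b := b) (ae_restrict_mem measurableSet_Icc)]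
      with q hq
    rw [df_eq hq]
    simp only [hτ]
    ring
  rw [e1, e2, e3, e4, e5]
  have hs : sgn h * τ = -1 := by rw [hτ, mul_neg, sgn_mul_self]
  linear_combination (-∫ t in Ioi (0 : ℝ), ∫ ξ in Icc a b,
      velocity R h ξ * γ ξ * φ (t, 0, ξ)) * hs

end

/-! ### Stationary solutions solve the half-space problem -/

section
variable {n m : ℕ} {R : Fin n ⊕ Fin m → Road}

/-- A smooth density of a probability measure on `t > 0`. -/
theorem exists_time_weight : ∃ θ : ℝ → ℝ, ContDiff ℝ ∞ θ ∧ HasCompactSupport θ ∧ θ 0 = 0 ∧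
    ∫ t in Ioi 0, θ t = 1 := by
  have hd : ContDiff ℝ ∞ (deriv Real.smoothTransition) :=
    (contDiff_infty_iff_deriv.1 contDiff_smoothTransition).2
  refine ⟨fun t => deriv Real.smoothTransition (t - 1), hd.comp (by fun_prop),
    hasCompactSupport_deriv_smoothTransition.comp_homeomorph (Homeomorph.subRight (1 : ℝ)),
    deriv_smoothTransition_of_neg (by norm_num), ?_⟩
  rw [setIntegral_eq_integral_of_forall_compl_eq_zero,
    integral_sub_right_eq_self (deriv Real.smoothTransition), integral_deriv_smoothTransition]
  intro t ht
  exact deriv_smoothTransition_of_neg (by simp at ht; linarith)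

theorem exists_measurable_unit {X : Type*} [MeasurableSpace X] {μ : Measure X} {f : X → ℝ}
    (hf : AEStronglyMeasurable f μ) (hr : ∀ᵐ x ∂μ, f x ∈ Icc (0 : ℝ) 1) :
    ∃ F : X → ℝ, Measurable F ∧ (∀ x, F x ∈ Icc (0 : ℝ) 1) ∧ ∀ᵐ x ∂μ, F x = f x := by
  refine ⟨fun x => max 0 (min 1 (hf.mk f x)),
    measurable_const.max (measurable_const.min hf.measurable_mk),
    fun x => ⟨le_max_left _ _, max_le zero_le_one (min_le_left _ _)⟩, ?_⟩
  filter_upwards [hf.ae_eq_mk, hr] with x h1 h2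
  rw [← h1, min_eq_right h2.2, max_eq_right h2.1]

/-- In the coordinate `y = |x|` and after the shift, a stationary solution of the BGK model is a
solution of the half-space problem. -/
theorem IsStationarySolution.exists_isMild (hR : ∀ h, (R h).Admissible) {ε : ℝ} (hε : 0 < ε)
    {g : Fin n ⊕ Fin m → ℝ → ℝ → ℝ} {γ : Fin n ⊕ Fin m → ℝ → ℝ}
    (hs : IsStationarySolution R ε g γ) (h : Fin n ⊕ Fin m) :
    ∃ G, IsMild (R h).a (R h).b (fun ξ => ε * velocity R h ξ) G ∧
      (∀ᵐ p ∂(halfStrip (R h).a (R h).b), G p.1 p.2 = g h (-sgn h * p.1) p.2 + equil 0 p.2) ∧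
      ∀ᵐ ξ ∂(volume.restrict (R h).K), G 0 ξ = γ h ξ + equil 0 ξ := by
  have hα := isVelocity_velocity hR h
  obtain ⟨B, hB⟩ := hα.bounded
  have h0 : (0 : ℝ) ∈ Icc (R h).a (R h).b := (hR h).zero_mem
  have hKe : (R h).K = Icc (R h).a (R h).b := rfl
  set a := (R h).a with ha
  set b := (R h).b with hb
  set τ : ℝ := -sgn h with hτ
  have hττ : ∀ y, τ * (τ * y) = y := involutive_road h
  have hsm : Measurable (equil 0) := measurable_equil_right 0
  have hne0 : ∀ᵐ ξ ∂(volume.restrict (Icc a b)), ξ ≠ 0 := ae_restrict_of_ae (Measure.ae_ne volume 0)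
  -- measurable representatives with values in `[0, 1]`
  obtain ⟨G₀, hG₀m, hG₀r, hG₀⟩ : ∃ F : ℝ × ℝ → ℝ, Measurable F ∧ (∀ p, F p ∈ Icc (0 : ℝ) 1) ∧
      ∀ᵐ p ∂(halfStrip a b), F p = g h (τ * p.1) p.2 + equil 0 p.2 := by
    refine exists_measurable_unit ?_ ?_
    · exact ((hs.measurable_initial h).comp_measurePreserving (measurePreserving_strip h)).add
        (hsm.comp measurable_snd).aestronglyMeasurable
    · filter_upwards [(measurePreserving_strip h).quasiMeasurePreserving.ae (hs.initial_mem_D h),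
        ae_halfStrip_snd hne0] with p h1 h2
      exact (mem_D_iff h2).1 h1
  obtain ⟨γ₀, hγ₀m, hγ₀r, hγ₀⟩ : ∃ F : ℝ → ℝ, Measurable F ∧ (∀ ξ, F ξ ∈ Icc (0 : ℝ) 1) ∧
      ∀ᵐ ξ ∂(volume.restrict (Icc a b)), F ξ = γ h ξ + equil 0 ξ := by
    have hm := hs.measurable_trace h
    have hD := hs.trace_mem_D h
    rw [hKe, ← halfStrip_eq_restrict] at hm hD
    have : (ae (volume.restrict (Ioi (0 : ℝ)))).NeBot :=
      ae_neBot.2 (by simp [Measure.restrict_eq_zero])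
    have hm' := hm
    rw [halfStrip] at hm'
    obtain ⟨t, ht⟩ := hm'.prodMk_left.exists
    obtain ⟨t', ht'⟩ := (ae_halfStrip hD).1.exists
    refine exists_measurable_unit (ht.add hsm.aestronglyMeasurable) ?_
    filter_upwards [ht', hne0] with ξ h1 h2
    exact (mem_D_iff h2).1 h1
  set G₁ : ℝ → ℝ → ℝ := fun y ξ => G₀ (y, ξ) with hG₁
  have hG₁m : Measurable (Function.uncurry G₁) := hG₀m
  have hG₁r : ∀ y ξ, G₁ y ξ ∈ Icc (0 : ℝ) 1 := fun y ξ => hG₀r _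
  have hsrc := ae_source_eq h0 hG₁m hG₁r (g := fun y => g h (τ * y)) hG₀
  -- test with `θ(t) Φ(y, ξ)`, where `θ` has mean one, so that the time derivative drops out
  have hw : ∀ Φ : ℝ × ℝ → ℝ, ContDiff ℝ ∞ Φ → HasCompactSupport Φ →
      ∫ p, (ε * velocity R h p.2 * G₁ p.1 p.2 * fderiv ℝ Φ p (1, 0)
        + (equil (dens a b G₁ p.1) p.2 - G₁ p.1 p.2) * Φ p) ∂(halfStrip a b)
      = -∫ ξ in Icc a b, ε * velocity R h ξ * γ₀ ξ * Φ (0, ξ) := by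
    intro Φ hΦ hc
    obtain ⟨θ, hθ, hθc, hθ0, hθ1⟩ := exists_time_weight
    have hθ' : ∫ t in Ioi 0, deriv θ t = 0 := by rw [integral_deriv_Ioi hθ hθc, hθ0, neg_zero]
    have hθi : Integrable θ (volume.restrict (Ioi 0)) :=
      (hθ.continuous.integrable_of_hasCompactSupport hθc).integrableOn
    have hθ'i : Integrable (deriv θ) (volume.restrict (Ioi 0)) :=
      ((hθ.continuous_deriv (by simp)).integrable_of_hasCompactSupport
        hθc.deriv).integrableOn
    have hΦi : Integrable Φ (halfStrip a b) :=
      (hΦ.continuous.integrable_of_hasCompactSupport hc).mono_measure halfStrip_le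
    have hΦyi : Integrable (fun p => fderiv ℝ Φ p (1, 0)) (halfStrip a b) :=
      (integrable_fderiv hΦ hc _).mono_measure halfStrip_le
    have hGs : Measurable fun p : ℝ × ℝ => G₁ p.1 p.2 - equil 0 p.2 :=
      hG₁m.sub (hsm.comp measurable_snd)
    have hGsb : ∀ p : ℝ × ℝ, |G₁ p.1 p.2 - equil 0 p.2| ≤ 1 := fun p =>
      sub_mem_Icc (hG₁r _ _) (equil_mem 0 _)
    set F₁ : ℝ × ℝ → ℝ := fun p => (G₁ p.1 p.2 - equil 0 p.2) * Φ p with hF₁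
    set F₂ : ℝ × ℝ → ℝ := fun p => velocity R h p.2 * (G₁ p.1 p.2 - equil 0 p.2)
      * fderiv ℝ Φ p (1, 0) + (equil (dens a b G₁ p.1) p.2 - G₁ p.1 p.2) * (ε⁻¹ * Φ p) with hF₂
    have iF₁ : Integrable F₁ (halfStrip a b) :=
      hΦi.bdd_mul hGs.aestronglyMeasurable (ae_of_all _ hGsb)
    have iF₂ : Integrable F₂ (halfStrip a b) := by
      refine (hΦyi.bdd_mul (c := B)
        ((hα.measurable.comp measurable_snd).mul hGs).aestronglyMeasurable
        (ae_of_all _ fun p => ?_)).add ((hΦi.const_mul ε⁻¹).bdd_mul (c := 1)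
        ((measurable_equil_dens hG₁m).sub hG₁m).aestronglyMeasurable
        (ae_of_all _ fun p => sub_mem_Icc (equil_mem _ _) (hG₁r _ _)))
      refine (norm_mul_le _ _).trans ?_
      exact (mul_le_of_le_one_right (norm_nonneg _) (hGsb p)).trans (hB _)
    set φ : ℝ × ℝ × ℝ → ℝ := fun p => θ p.1 * Φ (τ * p.2.1, p.2.2) with hφ
    have hφs : ContDiff ℝ ∞ φ :=
      (hθ.comp contDiff_fst).mul (hΦ.comp (by fun_prop))
    have hφc : HasCompactSupport φ := by
      have hΨc : HasCompactSupport fun q : ℝ × ℝ => Φ (τ * q.1, q.2) :=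
        hc.comp_homeomorph ((roadHomeo h).prodCongr (Homeomorph.refl ℝ))
      refine HasCompactSupport.intro (hθc.isCompact.prod hΨc.isCompact) fun p hp => ?_
      rw [mem_prod, not_and_or] at hp
      rcases hp with hp | hp
      · simp only [hφ, image_eq_zero_of_notMem_tsupport hp, zero_mul]
      · have := image_eq_zero_of_notMem_tsupport hp
        simp only [hφ, this, mul_zero]
    have heq := hs.equation h φ hφs hφc
    have hK : ∀ᵐ p ∂(halfStrip a b), p.2 ∈ (R h).K :=
      ae_halfStrip_snd (ae_restrict_mem measurableSet_Icc)
    set μ : Measure (ℝ × ℝ × ℝ) := (volume.restrict (Ioi 0)).prod (halfStrip a b) with hμ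
    have i1 : Integrable (fun p : ℝ × ℝ × ℝ => deriv θ p.1 * F₁ p.2) μ := hθ'i.mul_prod iF₁
    have i2 : Integrable (fun p : ℝ × ℝ × ℝ => θ p.1 * F₂ p.2) μ := hθi.mul_prod iF₂
    have e1 : (∫ p in Ioi (0 : ℝ) ×ˢ dom h ×ˢ (R h).K,
        (g h p.2.1 p.2.2 * (deriv (fun t => φ (t, p.2.1, p.2.2)) p.1
            + (R h).df p.2.2 * deriv (fun x => φ (p.1, x, p.2.2)) p.2.1)
          + (chi (∫ ξ in (R h).K, g h p.2.1 ξ) p.2.2 - g h p.2.1 p.2.2) / ε * φ p))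
        = ∫ q, F₂ q ∂(halfStrip a b) := by
      have e : ∫ p, (deriv θ p.1 * F₁ p.2 + θ p.1 * F₂ p.2) ∂μ = ∫ q, F₂ q ∂(halfStrip a b) := by
        rw [integral_add i1 i2, hμ, integral_prod_mul, integral_prod_mul, hθ', hθ1]
        ring
      rw [← e]
      refine ((measurePreserving_time_strip h).integral_comp
        (measurableEmbedding_time_strip h) _).symm.trans (integral_congr_ae ?_)
      have hall : ∀ᵐ p ∂μ, (chi (∫ ξ in Icc a b, g h (τ * p.2.1) ξ) p.2.2 - g h (τ * p.2.1) p.2.2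
          = equil (dens a b G₁ p.2.1) p.2.2 - G₁ p.2.1 p.2.2) ∧
          G₀ p.2 = g h (τ * p.2.1) p.2.2 + equil 0 p.2.2 ∧ p.2.2 ∈ (R h).K :=
        Measure.quasiMeasurePreserving_snd.ae (hsrc.and (hG₀.and hK))
      filter_upwards [hall] with p ⟨hp1, hp2, hpK⟩
      have d1 : deriv (fun t => φ (t, τ * p.2.1, p.2.2)) p.1 = deriv θ p.1 * Φ p.2 := by
        simp only [hφ, hττ]
        exact deriv_mul_const (hθ.differentiable (by simp) _) _
      have d2 : deriv (fun x => φ (p.1, x, p.2.2)) (τ * p.2.1)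
          = θ p.1 * (τ * fderiv ℝ Φ p.2 (1, 0)) := by
        simp only [hφ]
        rw [deriv_const_mul_field]
        congr 1
        refine (deriv_comp_mul_left τ (fun y => Φ (y, p.2.2)) (τ * p.2.1)).trans ?_
        rw [hττ, smul_eq_mul, deriv_fst_eq hΦ p.2]
      have hg : g h (τ * p.2.1) p.2.2 = G₁ p.2.1 p.2.2 - equil 0 p.2.2 := by
        rw [eq_sub_iff_add_eq, ← hp2]
      have hφp : φ (p.1, τ * p.2.1, p.2.2) = θ p.1 * Φ p.2 := by simp only [hφ, hττ]
      simp only [← hτ]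
      rw [d1, d2, df_eq hpK, ← hτ, hφp, hKe, hp1, hg]
      simp only [hF₁, hF₂]
      have hτ1 : τ * τ = 1 := by rw [← mul_one (τ * τ), mul_assoc, hττ]
      linear_combination ((G₁ p.2.1 p.2.2 - equil 0 p.2.2) * velocity R h p.2.2 * θ p.1
        * fderiv ℝ Φ p.2 (1, 0)) * hτ1
    have e2 : ∫ p in dom h ×ˢ (R h).K, g h p.1 p.2 * φ (0, p.1, p.2) = 0 := by
      simp [hφ, hθ0]
    have e3 : ∫ p in Ioi (0 : ℝ) ×ˢ (R h).K, (R h).df p.2 * γ h p.2 * φ (p.1, 0, p.2)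
        = τ * ∫ ξ in Icc a b, velocity R h ξ * (γ₀ ξ - equil 0 ξ) * Φ (0, ξ) := by
      have e : ∫ q, θ q.1 * (τ * (velocity R h q.2 * (γ₀ q.2 - equil 0 q.2) * Φ (0, q.2)))
          ∂(halfStrip a b) = τ * ∫ ξ in Icc a b, velocity R h ξ * (γ₀ ξ - equil 0 ξ) * Φ (0, ξ) := by
        rw [halfStrip, integral_prod_mul θ
          fun ξ => τ * (velocity R h ξ * (γ₀ ξ - equil 0 ξ) * Φ (0, ξ)), hθ1, integral_const_mul,
          one_mul]
      rw [← e, hKe, ← halfStrip_eq_restrict]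
      refine integral_congr_ae ?_
      filter_upwards [hK, ae_halfStrip_snd hγ₀] with q hq1 hq2
      rw [df_eq hq1, hq2]
      simp only [hφ, mul_zero]
      ring
    rw [e1, e2, e3, add_zero, ← mul_assoc] at heq
    have hsτ : sgn h * τ = -1 := by rw [hτ, mul_neg, sgn_mul_self]
    rw [hsτ, neg_one_mul] at heq
    have hA : Measurable fun ξ => velocity R h ξ * equil 0 ξ := hα.measurable.mul hsm
    have hAB : ∀ {v : ℝ} ξ, v ∈ Icc (0 : ℝ) 1 → |velocity R h ξ * v| ≤ B := fun ξ hv => by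
      rw [abs_mul, abs_of_nonneg hv.1]
      exact (mul_le_of_le_one_right (abs_nonneg _) hv.2).trans (hB ξ)
    -- the shift itself is constant in `y` and contributes its boundary values
    obtain ⟨j1, j2⟩ := integral_weak_primitive (a := a) (b := b) hA (fun ξ => hAB ξ (equil_mem 0 ξ))
      (k := fun _ _ => 0) (C := 0) measurable_const (by simp) hΦ hc
    have hΦ0 : Integrable (fun ξ => Φ (0, ξ)) (volume.restrict (Icc a b)) :=
      ((contDiff_slice_right hΦ 0).continuous.integrable_of_hasCompactSupport
        (hasCompactSupport_slice_right hc 0)).integrableOn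
    have k1 : Integrable (fun ξ => velocity R h ξ * (γ₀ ξ - equil 0 ξ) * Φ (0, ξ))
        (volume.restrict (Icc a b)) := by
      refine hΦ0.bdd_mul (c := B) (hα.measurable.mul (hγ₀m.sub hsm)).aestronglyMeasurable
        (ae_of_all _ fun ξ => (norm_mul_le _ _).trans ?_)
      exact (mul_le_of_le_one_right (norm_nonneg _)
        (sub_mem_Icc (hγ₀r ξ) (equil_mem 0 ξ))).trans (hB ξ)
    have k2 : Integrable (fun ξ => velocity R h ξ * equil 0 ξ * Φ (0, ξ))
        (volume.restrict (Icc a b)) :=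
      hΦ0.bdd_mul (c := B) hA.aestronglyMeasurable (ae_of_all _ fun ξ => hAB ξ (equil_mem 0 ξ))
    have f1 := integral_add iF₂ j1
    have f2 := integral_add k1 k2
    rw [heq, j2, ← neg_add, ← f2] at f1
    have f3 := congrArg (fun x => ε * x) f1
    simp only [mul_neg, ← integral_const_mul] at f3
    refine Eq.trans (integral_congr_ae (ae_of_all _ fun p => ?_)) (f3.trans ?_)
    · simp only [hF₂, intervalIntegral.integral_zero]
      field_simp
      ring
    · congr 1
      refine integral_congr_ae (ae_of_all _ fun ξ => ?_)
      simp only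
      ring
  obtain ⟨G, hG, hG1, hG0⟩ := exists_isMild_of_weak (hα.scale hε) hG₁m hG₁r hγ₀m hγ₀r hw
  refine ⟨G, hG, ?_, ?_⟩
  · filter_upwards [hG1, hG₀] with p h1 h2
    rw [h1, ← h2]
  · filter_upwards [hG0, hγ₀] with ξ h1 h2
    rw [h1, h2]

end

/-! ### Stationary solutions on the network -/

section
variable {n m : ℕ} {R : Fin n ⊕ Fin m → Road} {ρb ρh : Fin n ⊕ Fin m → ℝ}

theorem lintegral_sub_chi {a b ρ : ℝ} {G g : ℝ → ℝ} (hG : Integrable G (volume.restrict (Icc a b)))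
    (hg : ∀ᵐ ξ ∂(volume.restrict (Icc a b)), G ξ = g ξ + equil 0 ξ) :
    ∫⁻ ξ in Icc a b, ‖g ξ - chi ρ ξ‖ₑ = ENNReal.ofReal (∫ ξ in Icc a b, |G ξ - equil ρ ξ|) := by
  have := ofReal_integral_norm_eq_lintegral_enorm (hG.sub (integrable_equil (a := a) (b := b) ρ))
  simp only [Pi.sub_apply, Real.norm_eq_abs] at this
  rw [this]
  refine lintegral_congr_ae ?_
  filter_upwards [hg, ae_chi_add_equil ρ (Icc a b)] with ξ h1 h2
  rw [h1, ← h2, add_sub_add_right_eq_sub]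

theorem tendsto_road_atTop (h : Fin n ⊕ Fin m) : Tendsto (fun y => -sgn h * y) atTop (roadEnd h) := by
  rcases h with i | j
  · simpa [sgn, roadEnd] using tendsto_neg_atTop_atBot (G := ℝ)
  · have := tendsto_id (α := ℝ) (x := atTop)
    simpa [sgn, roadEnd, Function.id_def] using this

theorem tendsto_roadEnd (h : Fin n ⊕ Fin m) : Tendsto (fun x => -sgn h * x) (roadEnd h) atTop := by
  rcases h with i | j
  · simpa [sgn, roadEnd] using tendsto_neg_atBot_atTop (G := ℝ)
  · have := tendsto_id (α := ℝ) (x := atTop)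
    simpa [sgn, roadEnd, Function.id_def] using this

theorem tendsto_road_ae (h : Fin n ⊕ Fin m) :
    Tendsto (fun y => -sgn h * y) (ae volume) (ae volume) := by
  rcases h with i | j
  · simpa [sgn] using (Measure.measurePreserving_neg (volume : Measure ℝ)).quasiMeasurePreserving.tendsto_ae
  · have := tendsto_id (α := ℝ) (x := ae volume)
    simpa [sgn, Function.id_def] using this

/-- Null sets do not exhaust a neighbourhood of infinity; this makes limits along the filter unique. -/
instance neBot_atTop_ae : (atTop ⊓ ae (volume : Measure ℝ)).NeBot := by
  rw [inf_neBot_iff]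
  intro s hs t ht
  obtain ⟨N, hN⟩ := mem_atTop_sets.1 hs
  by_contra hcon
  rw [not_nonempty_iff_eq_empty] at hcon
  have hsub : Ici N ⊆ tᶜ := fun x hx hxt =>
    (hcon ▸ (⟨hN x hx, hxt⟩ : x ∈ s ∩ t) : x ∈ (∅ : Set ℝ))
  have := measure_mono_null hsub ht
  simp at this

/-- Convergence of a stationary solution at infinity in terms of the half-space solution. -/
theorem tendsToEquil_of_tendsAtInfinity {ε : ℝ} {g : Fin n ⊕ Fin m → ℝ → ℝ → ℝ}
    (ht : TendsAtInfinityAE R ρb g) {h : Fin n ⊕ Fin m} {G : ℝ → ℝ → ℝ}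
    (hG : IsMild (R h).a (R h).b (fun ξ => ε * velocity R h ξ) G)
    (hg : ∀ᵐ p ∂(halfStrip (R h).a (R h).b), G p.1 p.2 = g h (-sgn h * p.1) p.2 + equil 0 p.2) :
    TendsToEquil (R h).a (R h).b G (atTop ⊓ ae volume) (ρb h) := by
  have h1 : Tendsto (fun y => -sgn h * y) (atTop ⊓ ae volume) (roadEnd h ⊓ ae volume) :=
    ((tendsto_road_atTop h).inf (tendsto_road_ae h))
  have h2 := (ht h).comp h1
  have h3 := (ENNReal.tendsto_toReal ENNReal.zero_ne_top).comp h2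
  rw [ENNReal.toReal_zero] at h3
  refine h3.congr' ?_
  have h4 : ∀ᶠ y in atTop ⊓ ae (volume : Measure ℝ), (0 : ℝ) < y :=
    (eventually_gt_atTop 0).filter_mono inf_le_left
  have h5 := ((ae_restrict_iff' measurableSet_Ioi).1 (ae_halfStrip hg).1).filter_mono
    (inf_le_right (a := atTop))
  filter_upwards [h4, h5] with y hy1 hy2
  simp only [Function.comp]
  have h6 := lintegral_sub_chi (ρ := ρb h) (hG.integrable y) (hy2 hy1)
  change (∫⁻ ξ in Icc (R h).a (R h).b, ‖g h (-sgn h * y) ξ - chi (ρb h) ξ‖ₑ).toReal = _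
  rw [h6, ENNReal.toReal_ofReal (integral_nonneg fun _ => abs_nonneg _)]

/-- A stationary solution is determined by its limits at infinity and by its outgoing values at the
junction. -/
theorem stationary_unique (hR : ∀ h, (R h).Admissible) {ε : ℝ} (hε : 0 < ε)
    {g g' : Fin n ⊕ Fin m → ℝ → ℝ → ℝ} {γ γ' : Fin n ⊕ Fin m → ℝ → ℝ}
    (hs : IsStationarySolution R ε g γ) (hs' : IsStationarySolution R ε g' γ')
    (ho : HasOutgoing R ρh γ) (ho' : HasOutgoing R ρh γ')
    (ht : TendsAtInfinityAE R ρb g) (ht' : TendsAtInfinityAE R ρb g') : AEEqual R g g' := by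
  intro h
  obtain ⟨G, hG, hGg, hG0⟩ := hs.exists_isMild hR hε h
  obtain ⟨G', hG', hGg', hG0'⟩ := hs'.exists_isMild hR hε h
  have hα := (isVelocity_velocity hR h).scale hε
  have hin : ∀ᵐ ξ ∂(volume.restrict (Icc (R h).a (R h).b)), 0 < ε * velocity R h ξ →
      G 0 ξ = G' 0 ξ := by
    filter_upwards [hG0, hG0', (ae_ΓOut_iff hR h).1 (ho h), (ae_ΓOut_iff hR h).1 (ho' h)]
      with ξ h1 h2 h3 h4 hpos
    have hv : 0 < velocity R h ξ := pos_of_mul_pos_right hpos hε.le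
    rw [h1, h2, h3 hv, h4 hv]
  have hu := fun y hy => mild_unique hα hG hG' hin (l := atTop ⊓ ae volume) inf_le_left
    (tendsToEquil_of_tendsAtInfinity ht hG hGg) (tendsToEquil_of_tendsAtInfinity ht' hG' hGg')
    (y := y) hy
  have hae : ∀ᵐ p ∂(halfStrip (R h).a (R h).b), G p.1 p.2 = G' p.1 p.2 := by
    have hms : MeasurableSet {p : ℝ × ℝ | G p.1 p.2 = G' p.1 p.2} :=
      measurableSet_eq_fun hG.measurable hG'.measurable
    rw [halfStrip, Measure.ae_prod_iff_ae_ae hms]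
    filter_upwards [ae_restrict_mem measurableSet_Ioi] with y hy
    exact hu y (le_of_lt hy)
  change ∀ᵐ p : ℝ × ℝ ∂(volume.restrict (dom h ×ˢ Icc (R h).a (R h).b)), _
  rw [← (measurePreserving_strip (a := (R h).a) (b := (R h).b) h).map_eq,
    (measurableEmbedding_strip h).ae_map_iff]
  filter_upwards [hae, hGg, hGg'] with p h1 h2 h3
  linarith

theorem ae_state_ne_zero (s : Set (ℝ × ℝ × ℝ)) : ∀ᵐ p ∂(volume.restrict s), p.2.2 ≠ 0 := by
  have h1 : ∀ᵐ q : ℝ × ℝ, q.2 ≠ 0 :=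
    Measure.quasiMeasurePreserving_snd.ae (Measure.ae_ne volume 0)
  have h2 : ∀ᵐ p : ℝ × ℝ × ℝ, p.2.2 ≠ 0 := Measure.quasiMeasurePreserving_snd.ae h1
  exact ae_restrict_of_ae h2

theorem ae_snd_ne_zero (s : Set (ℝ × ℝ)) : ∀ᵐ p ∂(volume.restrict s), p.2 ≠ 0 :=
  ae_restrict_of_ae (Measure.quasiMeasurePreserving_snd.ae (Measure.ae_ne volume 0))

/-- For each choice of junction states, the solutions `G` of the half-space problems on the roads
give stationary solutions `G(|x| / ε, ξ)` of the BGK model for all `ε`. -/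
theorem exists_stationary (hR : ∀ h, (R h).Admissible) (hf0 : ∑ h, sgn h * (R h).f 0 = 0)
    (hb : ∀ h, ρb h ∈ (R h).K) (hK : IsKState R ρb ρh) :
    ∃ G : Fin n ⊕ Fin m → ℝ → ℝ → ℝ, (∀ h, Measurable (Function.uncurry (G h))) ∧
      (∀ h y ξ, G h y ξ ∈ Icc (0 : ℝ) 1) ∧
      (∀ h, TendsToEquil (R h).a (R h).b (G h) atTop (ρb h)) ∧
      ∀ ε : ℝ, 0 < ε →
        IsStationarySolution R ε (fun h x ξ => G h (-sgn h * x / ε) ξ - equil 0 ξ)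
          (fun h ξ => G h 0 ξ - equil 0 ξ) ∧
        HasOutgoing R ρh (fun h ξ => G h 0 ξ - equil 0 ξ) ∧
        TendsAtInfinity R ρb fun h x ξ => G h (-sgn h * x / ε) ξ - equil 0 ξ := by
  have hα := isVelocity_velocity hR
  have hp := hK.1.1
  have hex := fun h => exists_mild (hα h) (hp.mem_K h) (hb h)
    (((hR h).strictlyCompatible_iff (hp.mem_K h) (hb h)).2 (hK.strictlyCompatible hR hb h))
  choose G hG hG0 hGt using hex
  have hGm : ∀ h, Measurable (Function.uncurry (G h)) := fun h => (hG h).measurable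
  have hGr : ∀ h y ξ, G h y ξ ∈ Icc (0 : ℝ) 1 := fun h => (hG h).range
  refine ⟨G, hGm, hGr, hGt, fun ε hε => ?_⟩
  have hout : HasOutgoing R ρh (fun h ξ => G h 0 ξ - equil 0 ξ) := by
    intro h
    rw [ae_ΓOut_iff hR h]
    filter_upwards [hG0 h, ae_chi_add_equil (ρh h) (R h).K] with ξ h1 h2 hpos
    rw [h1 hpos, ← h2, add_sub_cancel_right]
  have hDmem : ∀ h y ξ, ξ ≠ 0 → G h y ξ - equil 0 ξ ∈ D ξ := fun h y ξ hξ =>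
    (mem_D_iff hξ).2 (by rw [sub_add_cancel]; exact hGr h y ξ)
  have hgm : ∀ h, Measurable fun p : ℝ × ℝ => G h (-sgn h * p.1 / ε) p.2 - equil 0 p.2 := fun h =>
    ((hGm h).comp (((measurable_fst.const_mul _).div_const ε).prodMk measurable_snd)).sub
      ((measurable_equil_right 0).comp measurable_snd)
  have hγm : ∀ h, Measurable fun ξ => G h 0 ξ - equil 0 ξ := fun h =>
    ((hGm h).comp measurable_prodMk_left).sub (measurable_equil_right 0)
  refine ⟨⟨fun h => ((hgm h).comp measurable_snd).aestronglyMeasurable, fun h => ?_,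
    fun h => (hgm h).aestronglyMeasurable, fun h => ?_,
    fun h => ((hγm h).comp measurable_snd).aestronglyMeasurable, fun h => ?_,
    fun h φ hφ hc => ?_, ae_of_all _ fun _ => ⟨ρh, ⟨hp, ?_⟩, hout⟩⟩, hout, fun h => ?_⟩
  · filter_upwards [ae_state_ne_zero _] with p hp0 using hDmem h _ _ hp0
  · filter_upwards [ae_snd_ne_zero _] with p hp0 using hDmem h _ _ hp0
  · filter_upwards [ae_snd_ne_zero _] with p hp0 using hDmem h _ _ hp0
  · exact IsMild.equation hR hε.ne' ((hG h).scale hε) hφ hc (fun x ξ => rfl)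
      (fun ξ => by rw [zero_div])
  · have hterm : ∀ h, (∫ ξ in ΓOut R h, (R h).df ξ * chi (ρh h) ξ)
        + ∫ ξ in ΓIn R h, (R h).df ξ * (G h 0 ξ - equil 0 ξ) = (R h).f (ρb h) - (R h).f 0 := by
      intro h
      obtain ⟨B, hB⟩ := (hα h).bounded
      have iv : ∀ {u : ℝ → ℝ}, Measurable u → (∀ ξ, u ξ ∈ Icc (0 : ℝ) 1) →
          Integrable (fun ξ => velocity R h ξ * u ξ) (volume.restrict (Icc (R h).a (R h).b)) :=
        fun hum hur => integrable_Icc_of_bounded (C := B) ((hα h).measurable.mul hum) fun ξ => by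
          rw [abs_mul, abs_of_nonneg (hur ξ).1]
          exact (mul_le_of_le_one_right (abs_nonneg _) (hur ξ).2).trans (hB ξ)
      have i1 := iv ((hGm h).comp (measurable_prodMk_left (x := 0))) (hGr h 0)
      have i2 := iv (measurable_equil_right 0) (equil_mem 0)
      have heq : ∀ ξ ∈ (R h).K, (R h).df ξ * (G h 0 ξ - equil 0 ξ)
          = -sgn h * (velocity R h ξ * G h 0 ξ - velocity R h ξ * equil 0 ξ) := fun ξ hξ => by
        rw [df_eq hξ]; ring
      have hi : Integrable (fun ξ => (R h).df ξ * (G h 0 ξ - equil 0 ξ))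
          (volume.restrict (R h).K) := by
        refine ((i1.sub i2).const_mul (-sgn h)).congr ?_
        filter_upwards [ae_restrict_mem measurableSet_Icc] with ξ hξ using (heq ξ hξ).symm
      rw [coupling_flux h hi (hout h), setIntegral_congr_fun (s := (R h).K) measurableSet_Icc heq,
        integral_const_mul]
      have hflux := mild_flux (hα h) (hG h) le_rfl (hb h) (hGt h)
      have h1 : ∫ ξ in Icc (R h).a (R h).b, velocity R h ξ * equil 0 ξ
          = equilFlux (R h).a (velocity R h) 0 := integral_mul_equil _ (hR h).zero_mem
      have h2 : ∀ k ∈ (R h).K, equilFlux (R h).a (velocity R h) k = -sgn h * (R h).f k :=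
        fun k hk => (hR h).equilFlux_vel hk
      have h3 := integral_sub i1 i2
      simp only [Function.comp, Function.uncurry] at h3
      change -sgn h * ∫ ξ in Icc (R h).a (R h).b, _ = _
      rw [h3, hflux, h1, h2 _ (hb h), h2 _ (hR h).zero_mem]
      linear_combination ((R h).f (ρb h) - (R h).f 0) * sgn_mul_self h
    simp only [hterm]
    simp only [mul_sub, Finset.sum_sub_distrib]
    rw [hf0, hK.1.2.2, sub_zero]
  · have h1 := ((hGt h).scale hε).comp (tendsto_roadEnd h)
    have h2 := ENNReal.tendsto_ofReal h1
    rw [ENNReal.ofReal_zero] at h2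
    refine h2.congr fun x => ?_
    refine (lintegral_sub_chi (integrable_of_mem (hGm h) (hGr h) _)
      (ae_of_all _ fun ξ => ?_)).symm
    rw [sub_add_cancel]

/-- The scaled half-space solutions converge to the equilibrium away from the junction. The distance
at `x` is `e(|x| / ε)`, where `e` is bounded and tends to zero at infinity. -/
theorem tendsto_scaled {h : Fin n ⊕ Fin m} {G : ℝ → ℝ → ℝ} (hGm : Measurable (Function.uncurry G))
    (hGr : ∀ y ξ, G y ξ ∈ Icc (0 : ℝ) 1)
    (hGt : TendsToEquil (R h).a (R h).b G atTop (ρb h)) {C : Set (ℝ × ℝ × ℝ)} (hC : IsCompact C)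
    (hsub : C ⊆ Ioi 0 ×ˢ dom h ×ˢ (R h).K) :
    Tendsto (fun ε => ∫⁻ p in C, ‖G (-sgn h * p.2.1 / ε) p.2.2 - equil 0 p.2.2
      - chi (ρb h) p.2.2‖ₑ) (𝓝[>] 0) (𝓝 0) := by
  obtain ⟨T, hT⟩ := hC.isBounded.exists_norm_le
  set S : Set ℝ := dom h ∩ Icc (-T) T with hS
  have hSm : MeasurableSet S := by
    refine MeasurableSet.inter ?_ measurableSet_Icc
    rcases h with i | j
    exacts [measurableSet_Iio, measurableSet_Ioi]
  set e : ℝ → ENNReal := fun y => ∫⁻ ξ in (R h).K, ‖G y ξ - equil (ρb h) ξ‖ₑ with he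
  have hem : Measurable e := by
    have : Measurable fun p : ℝ × ℝ => ‖G p.1 p.2 - equil (ρb h) p.2‖ₑ :=
      (hGm.sub ((measurable_equil_right _).comp measurable_snd)).enorm
    exact this.lintegral_prod_right'
  have het : Tendsto e atTop (𝓝 0) := by
    have h1 := ENNReal.tendsto_ofReal hGt
    rw [ENNReal.ofReal_zero] at h1
    refine h1.congr fun y => ?_
    have := ofReal_integral_norm_eq_lintegral_enorm ((integrable_of_mem hGm hGr y).sub
      (integrable_equil (a := (R h).a) (b := (R h).b) (ρb h)))
    simp only [Pi.sub_apply, Real.norm_eq_abs] at this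
    exact this
  have heb : ∀ y, e y ≤ ∫⁻ ξ in (R h).K, 1 := by
    intro y
    refine lintegral_mono fun ξ => ?_
    rw [← ofReal_norm, ENNReal.ofReal_le_one]
    exact sub_mem_Icc (hGr y ξ) (equil_mem _ ξ)
  have hJ : Tendsto (fun ε => ∫⁻ x in S, e (-sgn h * x / ε)) (𝓝[>] 0) (𝓝 0) := by
    have := tendsto_lintegral_filter_of_dominated_convergence (μ := volume.restrict S)
      (l := 𝓝[>] (0 : ℝ)) (F := fun ε x => e (-sgn h * x / ε)) (f := fun _ => 0)
      (fun _ => ∫⁻ ξ in (R h).K, 1)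
      (Eventually.of_forall fun ε => hem.comp (by fun_prop))
      (Eventually.of_forall fun ε => ae_of_all _ fun x => heb _) ?_ ?_
    · simpa using this
    · have h1 : volume S ≤ volume (Icc (-T) T) := measure_mono inter_subset_right
      have h2 : volume S ≠ ⊤ := (h1.trans_lt measure_Icc_lt_top).ne
      have h3 : volume (R h).K ≠ ⊤ := measure_Icc_lt_top.ne
      simp only [lintegral_const, one_mul, Measure.restrict_apply MeasurableSet.univ, univ_inter]
      exact ENNReal.mul_ne_top h3 h2
    · filter_upwards [ae_restrict_mem hSm] with x hx
      have hpos : 0 < -sgn h * x := by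
        have := hx.1
        rcases h with i | j
        · simpa [sgn, dom] using this
        · simpa [sgn, dom] using this
      have : Tendsto (fun ε => -sgn h * x / ε) (𝓝[>] (0 : ℝ)) atTop := by
        simpa only [div_eq_mul_inv] using tendsto_inv_nhdsGT_zero.const_mul_atTop hpos
      exact het.comp this
  have hlim := ENNReal.Tendsto.const_mul (a := volume (Ioc (0 : ℝ) T)) hJ
    (Or.inr measure_Ioc_lt_top.ne)
  rw [mul_zero] at hlim
  refine tendsto_of_tendsto_of_tendsto_of_le_of_le tendsto_const_nhds hlim (fun _ => bot_le)
    fun ε => ?_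
  have hCsub : C ⊆ Ioc 0 T ×ˢ S ×ˢ (R h).K := by
    intro p hp
    have h1 := hT p hp
    have h2 : |p.1| ≤ T := (norm_fst_le p).trans h1
    have h3 : |p.2.1| ≤ T := (norm_fst_le p.2).trans ((norm_snd_le p).trans h1)
    have h4 := hsub hp
    exact ⟨⟨h4.1, (abs_le.1 h2).2⟩, ⟨h4.2.1, abs_le.1 h3⟩, h4.2.2⟩
  refine (lintegral_mono_set hCsub).trans ?_
  have hfm : Measurable fun q : ℝ × ℝ => ‖G (-sgn h * q.1 / ε) q.2 - equil (ρb h) q.2‖ₑ :=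
    ((hGm.comp (((measurable_fst.const_mul _).div_const ε).prodMk measurable_snd)).sub
      ((measurable_equil_right _).comp measurable_snd)).enorm
  have hfm3 : Measurable fun p : ℝ × ℝ × ℝ =>
      ‖G (-sgn h * p.2.1 / ε) p.2.2 - equil (ρb h) p.2.2‖ₑ := hfm.comp measurable_snd
  have e1 : ∫⁻ p in Ioc 0 T ×ˢ S ×ˢ (R h).K, ‖G (-sgn h * p.2.1 / ε) p.2.2 - equil 0 p.2.2
        - chi (ρb h) p.2.2‖ₑ
      = ∫⁻ p in Ioc 0 T ×ˢ S ×ˢ (R h).K,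
        ‖G (-sgn h * p.2.1 / ε) p.2.2 - equil (ρb h) p.2.2‖ₑ := by
    have hchi : ∀ᵐ p : ℝ × ℝ × ℝ ∂(volume.restrict (Ioc 0 T ×ˢ S ×ˢ (R h).K)),
        chi (ρb h) p.2.2 + equil 0 p.2.2 = equil (ρb h) p.2.2 := by
      have hv := ae_chi_add_equil (ρb h) univ
      rw [Measure.restrict_univ] at hv
      exact ae_restrict_of_ae (Measure.quasiMeasurePreserving_snd.ae (μa := volume)
        (Measure.quasiMeasurePreserving_snd.ae hv))
    refine lintegral_congr_ae ?_
    filter_upwards [hchi] with p hp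
    rw [← hp, sub_sub, add_comm (equil 0 p.2.2)]
  rw [e1, Measure.volume_eq_prod, ← Measure.prod_restrict,
    lintegral_prod _ hfm3.aemeasurable]
  simp only [lintegral_const, Measure.restrict_apply MeasurableSet.univ, univ_inter]
  rw [mul_comm]
  gcongr
  rw [Measure.volume_eq_prod, ← Measure.prod_restrict, lintegral_prod _ hfm.aemeasurable]

/-- The states which define the coupling of a stationary solution are junction states of its limits
at infinity: the solution solves the half-space problems, which forces strict compatibility. -/
theorem isKState_of_stationary (hR : ∀ h, (R h).Admissible) (hb : ∀ h, ρb h ∈ (R h).K)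
    (hsum : ∑ h, sgn h * (R h).f (ρb h) = 0) {ε : ℝ} (hε : 0 < ε)
    {g : Fin n ⊕ Fin m → ℝ → ℝ → ℝ} {γ : Fin n ⊕ Fin m → ℝ → ℝ}
    (hs : IsStationarySolution R ε g γ) (hp : IsPriorityState R ρh) (ho : HasOutgoing R ρh γ)
    (ht : TendsAtInfinityAE R ρb g) : IsKState R ρb ρh := by
  refine isKState_of_strictlyCompatible hR hb hp hsum fun h => ?_
  obtain ⟨G, hG, hGg, hG0⟩ := hs.exists_isMild hR hε h
  have hin : ∀ᵐ ξ ∂(volume.restrict (Icc (R h).a (R h).b)), 0 < ε * velocity R h ξ →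
      G 0 ξ = equil (ρh h) ξ := by
    filter_upwards [hG0, (ae_ΓOut_iff hR h).1 (ho h), ae_chi_add_equil (ρh h) (R h).K]
      with ξ h1 h2 h3 hpos
    rw [h1, h2 (pos_of_mul_pos_right hpos hε.le), h3]
  have hc := strictlyCompatible_of_mild ((isVelocity_velocity hR h).scale hε) hG (hp.mem_K h)
    (hb h) hin (l := atTop ⊓ ae volume) inf_le_left (tendsToEquil_of_tendsAtInfinity ht hG hGg)
  have e : ∀ k, equilFlux (R h).a (fun ξ => ε * velocity R h ξ) k
      = ε * equilFlux (R h).a (velocity R h) k := fun k => by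
    simp only [equilFlux, intervalIntegral.integral_const_mul]
  refine ((hR h).strictlyCompatible_iff (hp.mem_K h) (hb h)).1 ⟨fun k h1 h2 => ?_, fun k h1 h2 => ?_⟩
  · have := hc.1 k h1 h2
    rw [e, e] at this
    exact lt_of_mul_lt_mul_left this hε.le
  · have := hc.2 k h1 h2
    rw [e, e] at this
    exact lt_of_mul_lt_mul_left this hε.le

end

section
variable {n m : ℕ} {R : Fin n ⊕ Fin m → Road} {ρb ρh : Fin n ⊕ Fin m → ℝ}

theorem TendsAtInfinity.ae {g : Fin n ⊕ Fin m → ℝ → ℝ → ℝ} (ht : TendsAtInfinity R ρb g) :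
    TendsAtInfinityAE R ρb g :=
  fun h => (ht h).mono_left inf_le_left

/-- On sets of positive times, integrals of a stationary density depend only on its class modulo
null sets of the `(x, ξ)`-plane. -/
theorem AEEqual.lintegral_congr {g g' : Fin n ⊕ Fin m → ℝ → ℝ → ℝ} (hg : AEEqual R g g')
    (h : Fin n ⊕ Fin m) (ρ : ℝ) {C : Set (ℝ × ℝ × ℝ)} (hC : C ⊆ Ioi 0 ×ˢ dom h ×ˢ (R h).K) :
    ∫⁻ p in C, ‖g h p.2.1 p.2.2 - chi ρ p.2.2‖ₑ = ∫⁻ p in C, ‖g' h p.2.1 p.2.2 - chi ρ p.2.2‖ₑ := by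
  have h1 : ∀ᵐ p : ℝ × ℝ × ℝ ∂((volume.restrict (Ioi (0 : ℝ))).prod
      (volume.restrict (dom h ×ˢ (R h).K))), g h p.2.1 p.2.2 = g' h p.2.1 p.2.2 :=
    Measure.quasiMeasurePreserving_snd.ae (hg h)
  rw [Measure.prod_restrict, ← Measure.volume_eq_prod] at h1
  refine lintegral_congr_ae ?_
  filter_upwards [ae_mono (Measure.restrict_mono hC le_rfl) h1] with p hp
  rw [hp]

theorem IsStationarySolution.exists_hasOutgoing {ε : ℝ} {g : Fin n ⊕ Fin m → ℝ → ℝ → ℝ}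
    {γ : Fin n ⊕ Fin m → ℝ → ℝ} (hs : IsStationarySolution R ε g γ) :
    ∃ ρh, IsPriorityState R ρh ∧ HasOutgoing R ρh γ := by
  have : (ae (volume.restrict (Ioi (0 : ℝ)))).NeBot :=
    ae_neBot.2 (by simp [Measure.restrict_eq_zero])
  obtain ⟨_, ρh, hc, ho⟩ := hs.coupling.exists
  exact ⟨ρh, hc.1, ho⟩

end
end BGKNetwork

theorem mainTheorem10 (n m : ℕ) (R : Fin n ⊕ Fin m → BGKNetwork.Road)
    (hR : ∀ h, (R h).Admissible)
    (hf0 : ∑ i : Fin n, (R (Sum.inl i)).f 0 - ∑ j : Fin m, (R (Sum.inr j)).f 0 = 0)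
    (ρb : Fin n ⊕ Fin m → ℝ) (hρb : ρb ∈ BGKNetwork.setK R) :
    -- for each admissible choice of the junction states: existence, uniqueness, limit
    (∀ ρh, BGKNetwork.IsKState R ρb ρh →
      (∀ ε : ℝ, 0 < ε → ∃ g γ,
        BGKNetwork.IsStationarySolution R ε g γ ∧
        BGKNetwork.HasOutgoing R ρh γ ∧
        BGKNetwork.TendsAtInfinity R ρb g ∧
        ∀ g' γ', BGKNetwork.IsStationarySolution R ε g' γ' →
          BGKNetwork.HasOutgoing R ρh γ' →
          BGKNetwork.TendsAtInfinityAE R ρb g' → BGKNetwork.AEEqual R g' g) ∧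
      (∀ g : ℝ → Fin n ⊕ Fin m → ℝ → ℝ → ℝ, ∀ γ : ℝ → Fin n ⊕ Fin m → ℝ → ℝ,
        (∀ ε : ℝ, 0 < ε →
          BGKNetwork.IsStationarySolution R ε (g ε) (γ ε) ∧
          BGKNetwork.HasOutgoing R ρh (γ ε) ∧
          BGKNetwork.TendsAtInfinityAE R ρb (g ε)) →
        BGKNetwork.TendsLocally R ρb g)) ∧
    -- if the outgoing junction data are determined by `ρb`: unrestricted uniqueness
    ((∀ ρh ρh', BGKNetwork.IsKState R ρb ρh → BGKNetwork.IsKState R ρb ρh' →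
        BGKNetwork.HasOutgoing R ρh (fun h => BGKNetwork.chi (ρh' h))) →
      ∀ ε : ℝ, 0 < ε → ∃ g γ,
        BGKNetwork.IsStationarySolution R ε g γ ∧
        BGKNetwork.TendsAtInfinity R ρb g ∧
        ∀ g' γ', BGKNetwork.IsStationarySolution R ε g' γ' →
          BGKNetwork.TendsAtInfinityAE R ρb g' → BGKNetwork.AEEqual R g' g) := by
  have hsum0 : ∑ h, BGKNetwork.sgn h * (R h).f 0 = 0 := by
    rw [Fintype.sum_sum_type]
    simpa [BGKNetwork.sgn, sub_eq_add_neg] using hf0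
  obtain ⟨hb, ρh₀, hK₀⟩ := hρb
  refine ⟨fun ρh hK => ?_, fun hdet ε hε => ?_⟩
  · obtain ⟨G, hGm, hGr, hGt, hG⟩ := BGKNetwork.exists_stationary hR hsum0 hb hK
    refine ⟨fun ε hε => ?_, fun g γ hg h C hC hsub => ?_⟩
    · obtain ⟨hs, ho, ht⟩ := hG ε hε
      exact ⟨_, _, hs, ho, ht, fun g' γ' hs' ho' ht' =>
        BGKNetwork.stationary_unique hR hε hs' hs ho' ho ht' ht.ae⟩
    · refine (BGKNetwork.tendsto_scaled (hGm h) (hGr h) (hGt h) hC hsub).congr' ?_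
      filter_upwards [self_mem_nhdsWithin] with ε hε
      obtain ⟨hs, ho, ht⟩ := hG ε hε
      obtain ⟨hs', ho', ht'⟩ := hg ε hε
      exact (BGKNetwork.stationary_unique hR hε hs hs' ho ho' ht.ae ht').lintegral_congr h _ hsub
  · obtain ⟨G, -, -, -, hG⟩ := BGKNetwork.exists_stationary hR hsum0 hb hK₀
    obtain ⟨hs, ho, ht⟩ := hG ε hε
    refine ⟨_, _, hs, ht, fun g' γ' hs' ht' => ?_⟩
    -- the outgoing values of any other solution come from junction states, which `hdet` compares
    obtain ⟨ρh', hp, ho'⟩ := hs'.exists_hasOutgoing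
    have hK' := BGKNetwork.isKState_of_stationary hR hb hK₀.1.2.2 hε hs' hp ho' ht'
    refine BGKNetwork.stationary_unique hR hε hs' hs (fun h => ?_) ho ht' ht.ae
    filter_upwards [ho' h, hdet ρh₀ ρh' hK₀ hK' h] with ξ h1 h2
    rw [h1, h2]
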